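/- Let $X$ be a compact (connected, smooth) manifold of dimension $m+n$ with a Riemannian foliation $\mathcal F$ of rank $m$ (that is, a foliation endowed with a basic transverse metric $\overline g$ on $TX/\mathcal F$). Let $g$ be a Riemannian metric on $X$ which is bundle-like (it induces $\overline g$ on $\mathcal F^\perp\simeq TX/\mathcal F$) and for which the mean curvature vector field $\tau_g$ of the leaves is foliated, i.e. $[V,\tau_g]$ is tangent to $\mathcal F$ for every vector field $V$ tangent to $\mathcal F$. Let $(Y,h)$ be a Riemannian manifold, and let $\rho:\pi_1(X)\to\mathrm{Isom}(Y)$ be a representation, where $\pi_1(X)$ is regarded as the group of deck transformations of the universal cover $p:\widetilde X\to X$. Let $I=[0,t_0]$ and let $F:I\times\widetilde X\to Y$, $f_t:=F(t,\cdot)$, be a smooth map such that every $f_t$ is $\rho$-equivariant and $$\frac{\partial f_t}{\partial t}=\tau(f_t)\qquad (t\in I),$$ where $\tau(f_t)=\mathrm{Trace}\,\nabla(df_t)$ is the tension field of $f_t$ with respect to $p^*g$ and $h$. Call a map $f:\widetilde X\to Y$ $\mathcal F$-invariant if it is constant on every leaf of the lifted foliation $\widetilde{\mathcal F}=p^*\mathcal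 F$. If $f_0$ is $\mathcal F$-invariant, then $f_t$ is $\mathcal F$-invariant for every $t\in I$. -/

import Mathlib

open Set Filter Bundle
open scoped Manifold ContDiff Topology

noncomputable section

namespace FoliatedHeatFlow

/-! Manifolds are modelled on a finite dimensional real vector space `E` (no boundary). -/

section Tensors

variable {E : Type*} [NormedAddCommGroup E] [NormedSpace ℝ E]
  {M : Type*} [TopologicalSpace M] [ChartedSpace E M]
  {E' : Type*} [NormedAddCommGroup E'] [NormedSpace ℝ E']
  {M' : Type*} [TopologicalSpace M'] [ChartedSpace E' M']

variable (E M) in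
/-- Fields of bilinear forms on the tangent spaces of `M`. -/
abbrev BilinField : Type _ :=
  ∀ x : M, TangentSpace 𝓘(ℝ, E) x →L[ℝ] TangentSpace 𝓘(ℝ, E) x →L[ℝ] ℝ

variable (E M) in
/-- Fields of linear subspaces of the tangent spaces of `M`. -/
abbrev Distribution : Type _ :=
  ∀ x : M, Submodule ℝ (TangentSpace 𝓘(ℝ, E) x)

variable (E M) in
/-- Vector fields on `M` (a priori without regularity). -/
abbrev VField : Type _ := ∀ x : M, TangentSpace 𝓘(ℝ, E) x

variable (E M) in
/-- Smooth Riemannian metrics on `M`. -/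
abbrev RiemMetric [IsManifold 𝓘(ℝ, E) ∞ M] : Type _ :=
  ContMDiffRiemannianMetric 𝓘(ℝ, E) ∞ E (fun x : M => TangentSpace 𝓘(ℝ, E) x)

/-- The pull-back `p^* B` of a field of bilinear forms under a map. -/
def pullbackBilin (p : M → M') (B : BilinField E' M') : BilinField E M := fun x =>
  let b : E' →L[ℝ] E' →L[ℝ] ℝ := B (p x)
  let A : E →L[ℝ] E' := mfderiv 𝓘(ℝ, E) 𝓘(ℝ, E') p x
  (b.bilinearComp A A : E →L[ℝ] E →L[ℝ] ℝ)

/-- The pull-back of a distribution: vectors whose image under `dp` lies in `D`. -/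
def pullbackDistribution (p : M → M') (D : Distribution E' M') : Distribution E M := fun x =>
  (D (p x)).comap (mfderiv 𝓘(ℝ, E) 𝓘(ℝ, E') p x : TangentSpace 𝓘(ℝ, E) x →ₗ[ℝ] _)

/-! ### Levi-Civita connection in charts -/

/-- The matrix `g_{ij}` of a field of bilinear forms, read at the point `z` of the chart
centred at `c`. -/
def coordMetric (B : BilinField E M) (c : M) (z : E) : E →L[ℝ] E →L[ℝ] ℝ :=
  pullbackBilin (extChartAt 𝓘(ℝ, E) c).symm B z

/-- Christoffel symbols of the metric `B` at the point `z` of the chart centred at `c`: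
`g(Γ(u,v), w) = (∂_u g(v,w) + ∂_v g(u,w) - ∂_w g(u,v)) / 2`. The inverse is that of the musical
isomorphism `E → E^*` given by the metric. -/
def christoffel (B : BilinField E M) (c : M) (z : E) (u v : E) : E :=
  (coordMetric B c z).inverse
    ((1 / 2 : ℝ) • (fderiv ℝ (coordMetric B c) z u v + fderiv ℝ (coordMetric B c) z v u
      - ((fderiv ℝ (coordMetric B c) z).flip u).flip v))

/-- The Levi-Civita derivative `(∇_u V)(x)` of the vector field `V` in the direction `u ∈ T_x M`,
computed in the chart centred at `x`, through which `T_x M` is identified with `E`. -/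
def covDeriv (B : BilinField E M) (V : VField E M) (x : M) (u : TangentSpace 𝓘(ℝ, E) x) :
    TangentSpace 𝓘(ℝ, E) x :=
  let z : E := extChartAt 𝓘(ℝ, E) x x
  let Vloc : E → E := VectorField.mpullback 𝓘(ℝ, E) 𝓘(ℝ, E) (extChartAt 𝓘(ℝ, E) x).symm V
  fderiv ℝ Vloc z u + christoffel B x z u (Vloc z)

/-! ### Tension field -/

/-- The trace `∑ g^{ij} b(e_i, e_j)` of `b` with respect to the inner product `G`. -/
def metricTrace [FiniteDimensional ℝ E] (G : E →L[ℝ] E →L[ℝ] ℝ) (b : E → E → E') : E' :=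
  ∑ i, b (Module.finBasis ℝ E i)
    (G.inverse (LinearMap.toContinuousLinearMap ((Module.finBasis ℝ E).coord i)))

/-- The second fundamental form `∇(df)(u,v)` of a map `f` between Riemannian manifolds, read in
the charts centred at `c` and `c'`, at the point `z` of the first chart:
`D²f(u,v) - Df(Γ(u,v)) + Γ'(Df u, Df v)`. -/
def coordHessian (B : BilinField E M) (B' : BilinField E' M') (f : M → M') (c : M) (c' : M')
    (z u v : E) : E' :=
  let F : E → E' := extChartAt 𝓘(ℝ, E') c' ∘ f ∘ (extChartAt 𝓘(ℝ, E) c).symm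
  fderiv ℝ (fderiv ℝ F) z u v - fderiv ℝ F z (christoffel B c z u v)
    + christoffel B' c' (F z) (fderiv ℝ F z u) (fderiv ℝ F z v)

/-- The tension field `τ(f) = Trace ∇(df)`, a section of `f^* TM'`, computed at `x` in the charts
centred at `x` and at `f x` (through which `T_x M = E` and `T_{f x} M' = E'`). -/
def tension [FiniteDimensional ℝ E] (B : BilinField E M) (B' : BilinField E' M') (f : M → M')
    (x : M) : TangentSpace 𝓘(ℝ, E') (f x) :=
  let z : E := extChartAt 𝓘(ℝ, E) x x
  metricTrace (E' := E') (coordMetric B x z) (coordHessian B B' f x (f x) z)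

/-! ### Leaves and foliations -/

/-- Two points lie in the same leaf: they are joined by a smooth curve tangent to `D`. -/
def SameLeaf (D : Distribution E M) (x y : M) : Prop :=
  ∃ γ : ℝ → M, ContMDiff 𝓘(ℝ, ℝ) 𝓘(ℝ, E) ∞ γ ∧ γ 0 = x ∧ γ 1 = y ∧
    ∀ t, mfderiv 𝓘(ℝ, ℝ) 𝓘(ℝ, E) γ t (1 : ℝ) ∈ D (γ t)

/-- A map is leafwise constant (basic, invariant under the foliation). -/
def IsLeafwiseConstant {Z : Type*} (D : Distribution E M) (f : M → Z) : Prop :=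
  ∀ x y, SameLeaf D x y → f x = f y

/-- `φ = (x_1, …, x_m, y_1, …, y_n)` is a foliated chart for `D`: a diffeomorphism from an open
set of `M` onto an open set of `ℝ^m × ℝ^n` in which `D = {dy_1 = ⋯ = dy_n = 0}`. -/
structure IsFoliatedChart {m n : ℕ} (D : Distribution E M)
    (φ : OpenPartialHomeomorph M (EuclideanSpace ℝ (Fin m) × EuclideanSpace ℝ (Fin n))) : Prop where
  contMDiffOn : ContMDiffOn 𝓘(ℝ, E)
    𝓘(ℝ, EuclideanSpace ℝ (Fin m) × EuclideanSpace ℝ (Fin n)) ∞ φ φ.source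
  contMDiffOn_symm : ContMDiffOn 𝓘(ℝ, EuclideanSpace ℝ (Fin m) × EuclideanSpace ℝ (Fin n))
    𝓘(ℝ, E) ∞ φ.symm φ.target
  mem_iff : ∀ x ∈ φ.source, ∀ v : TangentSpace 𝓘(ℝ, E) x, v ∈ D x ↔
    mfderiv 𝓘(ℝ, E) 𝓘(ℝ, EuclideanSpace ℝ (Fin n)) (fun y => (φ y).2) x v = 0

variable (E M) in
/-- A smooth foliation of rank `m` and codimension `n`, given by its tangent distribution. -/
structure Foliation (m n : ℕ) where
  /-- the tangent spaces of the leaves -/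
  tangent : Distribution E M
  exists_chart : ∀ x : M,
    ∃ φ : OpenPartialHomeomorph M (EuclideanSpace ℝ (Fin m) × EuclideanSpace ℝ (Fin n)),
      x ∈ φ.source ∧ IsFoliatedChart tangent φ

variable (E M) in
/-- A Riemannian foliation: a foliation with a basic transverse metric. The transverse metric
is a symmetric form on the tangent spaces, positive on vectors not tangent to the foliation, which
in suitable foliated charts reads `∑ G_{ij}(y) dy_i dy_j` (in particular it has the tangent spaces
of the leaves in its kernel). -/
structure RiemFoliation (m n : ℕ) extends Foliation E M m n where
  /-- the transverse metric -/
  transverse : BilinField E M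
  transverse_symm : ∀ x u v, transverse x u v = transverse x v u
  transverse_pos : ∀ x v, v ∉ tangent x → 0 < transverse x v v
  transverse_basic : ∀ x : M,
    ∃ φ : OpenPartialHomeomorph M (EuclideanSpace ℝ (Fin m) × EuclideanSpace ℝ (Fin n)),
      x ∈ φ.source ∧ IsFoliatedChart tangent φ ∧
      ∃ G : EuclideanSpace ℝ (Fin n) →
          EuclideanSpace ℝ (Fin n) →L[ℝ] EuclideanSpace ℝ (Fin n) →L[ℝ] ℝ,
        ContDiffOn ℝ ∞ G (Prod.snd '' φ.target) ∧
        ∀ y ∈ φ.source, ∀ u v : TangentSpace 𝓘(ℝ, E) y,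
          transverse y u v = G (φ y).2
            (mfderiv 𝓘(ℝ, E) 𝓘(ℝ, EuclideanSpace ℝ (Fin n)) (fun y' => (φ y').2) y u)
            (mfderiv 𝓘(ℝ, E) 𝓘(ℝ, EuclideanSpace ℝ (Fin n)) (fun y' => (φ y').2) y v)

/-- The orthogonal complement of `D x` with respect to `B`. -/
def normalSpace (B : BilinField E M) (D : Distribution E M) (x : M) :
    Set (TangentSpace 𝓘(ℝ, E) x) :=
  {v | ∀ u ∈ D x, B x v u = 0}

/-- The metric `B` is bundle-like: it induces the given transverse metric on the orthogonal
complement of the foliation. -/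
def IsBundleLike {m n : ℕ} (B : BilinField E M) (𝓕 : RiemFoliation E M m n) : Prop :=
  ∀ x, ∀ u ∈ normalSpace B 𝓕.tangent x, ∀ v ∈ normalSpace B 𝓕.tangent x,
    B x u v = 𝓕.transverse x u v

/-- `V` is of class `C^∞` near `x`. -/
def SmoothVFieldAt [IsManifold 𝓘(ℝ, E) 1 M] (V : VField E M) (x : M) : Prop :=
  ContMDiffAt 𝓘(ℝ, E) 𝓘(ℝ, E).tangent ∞ (fun y => (⟨y, V y⟩ : TangentBundle 𝓘(ℝ, E) M)) x

/-- `e` is an orthonormal frame of the rank `m` distribution `D` near `x`. -/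
structure IsOrthonormalFrameNear [IsManifold 𝓘(ℝ, E) 1 M] {m : ℕ} (B : BilinField E M)
    (D : Distribution E M) (e : Fin m → VField E M) (x : M) : Prop where
  smooth : ∀ i, SmoothVFieldAt (e i) x
  mem : ∀ᶠ y in 𝓝 x, ∀ i, e i y ∈ D y
  orthonormal : ∀ᶠ y in 𝓝 x, ∀ i j, B y (e i y) (e j y) = if i = j then 1 else 0

/-- `H` is the mean curvature vector field of the leaves of `𝓕`: at each point it is the component
orthogonal to the leaf of `∑ ∇_{e_i} e_i`, for any local orthonormal frame `(e_i)` of `𝓕`. -/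
def IsMeanCurvatureField [IsManifold 𝓘(ℝ, E) 1 M] {m n : ℕ} (B : BilinField E M)
    (𝓕 : Foliation E M m n) (H : VField E M) : Prop :=
  ∀ x, H x ∈ normalSpace B 𝓕.tangent x ∧
    ∀ e : Fin m → VField E M, IsOrthonormalFrameNear B 𝓕.tangent e x →
      ∑ i, covDeriv B (e i) x (e i x) - H x ∈ 𝓕.tangent x

/-- `W` is a foliated vector field: it is smooth, and its bracket with every smooth vector field
tangent to `D` is tangent to `D`. -/
def IsFoliatedField [IsManifold 𝓘(ℝ, E) 1 M] (D : Distribution E M) (W : VField E M) : Prop :=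
  (∀ x, SmoothVFieldAt W x) ∧
  ∀ V : VField E M, (∀ x, SmoothVFieldAt V x) → (∀ x, V x ∈ D x) →
    ∀ x, VectorField.mlieBracket 𝓘(ℝ, E) V W x ∈ D x

/-- The foliation is tense for the metric `B`: the mean curvature vector field of the leaves is
foliated. -/
def IsTense [IsManifold 𝓘(ℝ, E) 1 M] {m n : ℕ} (B : BilinField E M)
    (𝓕 : Foliation E M m n) : Prop :=
  ∃ H : VField E M, IsMeanCurvatureField B 𝓕 H ∧ IsFoliatedField 𝓕.tangent H

/-! ### Universal cover, deck transformations, isometries -/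

variable (E E') in
/-- `p` exhibits its source as the (smooth) universal cover of its target. -/
structure IsSmoothUniversalCover (p : M → M') : Prop where
  simplyConnected : SimplyConnectedSpace M
  surjective : Function.Surjective p
  isCoveringMap : IsCoveringMap p
  isLocalDiffeomorph : IsLocalDiffeomorph 𝓘(ℝ, E) 𝓘(ℝ, E') ∞ p

/-- The group of deck transformations of `p`. If `p : X̃ → X` is a universal cover, it is the
fundamental group of `X`. -/
def deckGroup (p : M → M') : Subgroup (M ≃ₜ M) where
  carrier := {γ | ∀ x, p (γ x) = p x}
  mul_mem' := fun {a b} ha hb x => (ha (b x)).trans (hb x)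
  one_mem' := fun _ => rfl
  inv_mem' := fun {a} ha x => by
    have h := ha (a.symm x)
    rw [a.apply_symm_apply] at h
    exact h.symm

/-- The group of isometries of a Riemannian manifold: diffeomorphisms preserving the metric. -/
def isometryGroup (B : BilinField E M) : Subgroup (M ≃ₜ M) where
  carrier := {φ | ContMDiff 𝓘(ℝ, E) 𝓘(ℝ, E) ∞ φ ∧ ContMDiff 𝓘(ℝ, E) 𝓘(ℝ, E) ∞ φ.symm ∧
    ∀ y, ∀ u v : TangentSpace 𝓘(ℝ, E) y,
      B (φ y) (mfderiv 𝓘(ℝ, E) 𝓘(ℝ, E) φ y u) (mfderiv 𝓘(ℝ, E) 𝓘(ℝ, E) φ y v) = B y u v}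
  mul_mem' := fun {a b} ha hb => by
    obtain ⟨ha1, ha2, ha3⟩ := ha
    obtain ⟨hb1, hb2, hb3⟩ := hb
    refine ⟨ha1.comp hb1, hb2.comp ha2, fun y u v => ?_⟩
    have h : mfderiv 𝓘(ℝ, E) 𝓘(ℝ, E) (⇑(a * b)) y =
        (mfderiv 𝓘(ℝ, E) 𝓘(ℝ, E) a (b y)).comp (mfderiv 𝓘(ℝ, E) 𝓘(ℝ, E) b y) :=
      mfderiv_comp y ((ha1 (b y)).mdifferentiableAt (by simp))
        ((hb1 y).mdifferentiableAt (by simp))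
    rw [h]
    exact (ha3 (b y) _ _).trans (hb3 y u v)
  one_mem' := by
    refine ⟨contMDiff_id, contMDiff_id, fun y u v => ?_⟩
    have h : mfderiv 𝓘(ℝ, E) 𝓘(ℝ, E) (⇑(1 : M ≃ₜ M)) y = ContinuousLinearMap.id ℝ _ :=
      mfderiv_id
    rw [h]
    rfl
  inv_mem' := fun {a} ha => by
    obtain ⟨ha1, ha2, ha3⟩ := ha
    refine ⟨ha2, ha1, fun y u v => ?_⟩
    change B (a.symm y) (mfderiv 𝓘(ℝ, E) 𝓘(ℝ, E) a.symm y u)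
      (mfderiv 𝓘(ℝ, E) 𝓘(ℝ, E) a.symm y v) = B y u v
    have hc : (mfderiv 𝓘(ℝ, E) 𝓘(ℝ, E) a (a.symm y)).comp (mfderiv 𝓘(ℝ, E) 𝓘(ℝ, E) a.symm y)
        = mfderiv 𝓘(ℝ, E) 𝓘(ℝ, E) (a ∘ a.symm) y :=
      (mfderiv_comp y ((ha1 (a.symm y)).mdifferentiableAt (by simp))
        ((ha2 y).mdifferentiableAt (by simp))).symm
    have hid : (a ∘ a.symm : M → M) = id := by
      funext z
      exact a.apply_symm_apply z
    rw [hid, mfderiv_id] at hc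
    have hu : ∀ w, mfderiv 𝓘(ℝ, E) 𝓘(ℝ, E) a (a.symm y)
        (mfderiv 𝓘(ℝ, E) 𝓘(ℝ, E) a.symm y w) = w := fun w => DFunLike.congr_fun hc w
    have h := ha3 (a.symm y) (mfderiv 𝓘(ℝ, E) 𝓘(ℝ, E) a.symm y u)
      (mfderiv 𝓘(ℝ, E) 𝓘(ℝ, E) a.symm y v)
    rw [← h, hu, hu, a.apply_symm_apply]

/-! ### Equivariant harmonic map heat flow -/

/-- `f : X̃ → Z` is invariant under the foliation `𝓕` of `X`: it is constant on the leaves of the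
foliation `p^* 𝓕` lifted to `X̃`, where `p : X̃ → X` is the universal cover. -/
def IsInvariant {X X' Z : Type*} [TopologicalSpace X] [ChartedSpace E X]
    [TopologicalSpace X'] [ChartedSpace E X'] {m n : ℕ} (𝓕 : Foliation E X m n) (p : X' → X)
    (f : X' → Z) : Prop :=
  IsLeafwiseConstant (pullbackDistribution p 𝓕.tangent : Distribution E X') f

/-- `f` is equivariant under the representation `ρ` of the deck group of `p`. -/
def IsEquivariant (p : M → M') {Y : Type*} [TopologicalSpace Y] {G : Subgroup (Y ≃ₜ Y)}
    (ρ : deckGroup p →* G) (f : M → Y) : Prop :=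
  ∀ (γ : deckGroup p) (x : M), f (γ.1 x) = (ρ γ).1 (f x)

/-- `(f_t)_{t ∈ [0, t₀]}` is a smooth solution on `[0, t₀] × M` of the harmonic map heat flow
`∂f_t/∂t = τ(f_t)` (with one-sided time derivatives at the end points). -/
structure IsHeatFlow [FiniteDimensional ℝ E] (B : BilinField E M) (B' : BilinField E' M')
    (t₀ : ℝ) (f : ℝ → M → M') : Prop where
  smooth : ContMDiffOn (𝓘(ℝ, ℝ).prod 𝓘(ℝ, E)) 𝓘(ℝ, E') ∞
    (fun q : ℝ × M => f q.1 q.2) (Icc 0 t₀ ×ˢ univ)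
  evolution : ∀ t ∈ Icc 0 t₀, ∀ x : M,
    mfderivWithin 𝓘(ℝ, ℝ) 𝓘(ℝ, E') (fun s => f s x) (Icc 0 t₀) t (1 : ℝ) = tension B B' (f t) x

end Tensors

end FoliatedHeatFlow

end

open FoliatedHeatFlow

set_option maxSynthPendingDepth 3
set_option linter.unusedSectionVars false
set_option synthInstance.maxHeartbeats 100000

noncomputable section

/-! The proof shows that the leafwise derivative of `f t` stays zero, by a maximum principle for a
linear parabolic inequality.

Take a foliated chart with leaf factor `A` and transverse factor `B`, write the map there as `F`,
and let `W` be its derivative along `A`. In coordinates the tension is `g^{ij}(∂_i∂_j F + Γ'(F)(∂_i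
F, ∂_j F)) - dF(R)`, where `R = g^{ij}Γ_{ij}`. Differentiating it along the leaf gives `g^{ij}∂_i∂_j
W`, terms linear in `W` and `DW`, and two dangerous terms involving purely transverse derivatives of
`F`, which `W` does not control. Their coefficients are the leafwise derivatives of the transverse
block of `g^{ij}` and of the transverse part of `R`. The first vanishes because the metric is
bundle-like. The second vanishes because that part of `R` is the mean curvature plus a trace of
Christoffel symbols of the transverse metric: the former is constant along leaves since the
foliation is tense, the latter since the transverse metric is basic. This is
`RiemFoliation.exists_tense_chart`, and the resulting estimate on `∂_t W` is
`exists_evolution_bound`, which rests on `norm_fderiv_tension_sub_le`.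

The energy `u = ∑_j |df(V_j)|²`, for finitely many fields `V_j` spanning the tangent spaces of the
leaves, is locally a positive definite form `Q(W, W)`. At a spatial maximum the second derivative
test supplies a negative term quadratic in `DW`, which absorbs every product of `W` and `DW`, so
`∂_t u ≤ C u` there (`parabolic_pointwise`, `exists_leafEnergy_bound`). No Bochner formula or
curvature bound is needed.

By equivariance `u` is invariant under deck transformations (`tangentEnergy_deck`), so its values
are all taken on a compact set. The constants can then be chosen uniformly and maxima are attained;
since `u = 0` initially, `eq_zero_of_growth_at_max` gives `u = 0` at all times. A map with zero
leafwise derivative is constant along curves tangent to the leaves. -/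

namespace FoliatedHeatFlow

/-! ### Inner products, traces, Christoffel symbols and Hessians on vector spaces. -/

section FlatGeometry

variable {E : Type*} [NormedAddCommGroup E] [NormedSpace ℝ E]
  {E₁ : Type*} [NormedAddCommGroup E₁] [NormedSpace ℝ E₁]
  {V : Type*} [NormedAddCommGroup V] [NormedSpace ℝ V]
  {V₁ : Type*} [NormedAddCommGroup V₁] [NormedSpace ℝ V₁]

/-- A bilinear form is an inner product: symmetric and positive definite. -/
structure IsInner (G : E →L[ℝ] E →L[ℝ] ℝ) : Prop where
  symm : ∀ u v, G u v = G v u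
  pos : ∀ v, v ≠ 0 → 0 < G v v

theorem IsInner.nonneg {G : E →L[ℝ] E →L[ℝ] ℝ} (hG : IsInner G) (v : E) : 0 ≤ G v v := by
  rcases eq_or_ne v 0 with rfl | hv
  · simp
  · exact (hG.pos v hv).le

theorem IsInner.injective {G : E →L[ℝ] E →L[ℝ] ℝ} (hG : IsInner G) : Function.Injective G := by
  refine (injective_iff_map_eq_zero G).2 fun v hv => ?_
  by_contra h
  have := hG.pos v h
  simp [hv] at this

/-- `ContinuousLinearMap.inverse` takes the value `0` on non-invertible maps, so this is what makes
the inverse metric meaningful. -/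
theorem IsInner.isInvertible [FiniteDimensional ℝ E] {G : E →L[ℝ] E →L[ℝ] ℝ} (hG : IsInner G) :
    G.IsInvertible := by
  have hd : Module.finrank ℝ E = Module.finrank ℝ (E →L[ℝ] ℝ) := by
    rw [← LinearEquiv.finrank_eq (LinearMap.toContinuousLinearMap (𝕜 := ℝ) (E := E) (F' := ℝ))]
    exact (Subspace.dual_finrank_eq (K := ℝ) (V := E)).symm
  let e : E ≃ₗ[ℝ] (E →L[ℝ] ℝ) :=
    LinearEquiv.ofInjectiveOfFinrankEq (G : E →ₗ[ℝ] (E →L[ℝ] ℝ)) hG.injective hd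
  exact ⟨e.toContinuousLinearEquiv, by ext; rfl⟩

theorem IsInner.apply_inverse [FiniteDimensional ℝ E] {G : E →L[ℝ] E →L[ℝ] ℝ} (hG : IsInner G)
    (φ : E →L[ℝ] ℝ) : G (G.inverse φ) = φ := by
  obtain ⟨e, he⟩ := hG.isInvertible
  rw [← he, ContinuousLinearMap.inverse_equiv]
  simp

theorem IsInner.inverse_apply [FiniteDimensional ℝ E] {G : E →L[ℝ] E →L[ℝ] ℝ} (hG : IsInner G)
    (v : E) : G.inverse (G v) = v := hG.injective (hG.apply_inverse _)

/-- A dual basis element as a continuous form. -/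
abbrev coordL [FiniteDimensional ℝ E] {ι : Type*} (e : Module.Basis ι ℝ E) (i : ι) : E →L[ℝ] ℝ :=
  LinearMap.toContinuousLinearMap (e.coord i)

/-- The contraction of a bilinear map on `E × E^*` does not depend on the basis. -/
theorem sum_basis_coord_eq [FiniteDimensional ℝ E] {ι κ : Type*} [Fintype ι] [Fintype κ]
    (e : Module.Basis ι ℝ E) (f : Module.Basis κ ℝ E) (T : E →L[ℝ] (E →L[ℝ] ℝ) →L[ℝ] V) :
    ∑ j, T (f j) (coordL f j) = ∑ i, T (e i) (coordL e i) := by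
  have h1 : ∀ j, T (f j) (coordL f j) = ∑ i, e.coord i (f j) • T (e i) (coordL f j) := by
    intro j
    conv_lhs => rw [← e.sum_repr (f j)]
    simp only [map_sum, FunLike.coe_sum, Finset.sum_apply, map_smul, smul_apply,
      Module.Basis.coord_apply]
  have h2 : ∀ i, coordL e i = ∑ j, e.coord i (f j) • coordL f j := by
    intro i
    ext x
    simp only [coordL, LinearMap.coe_toContinuousLinearMap', FunLike.coe_sum,
      Finset.sum_apply, smul_apply, smul_eq_mul]
    conv_lhs => rw [← f.sum_repr x]
    rw [map_sum]
    refine Finset.sum_congr rfl fun j _ => ?_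
    simp [mul_comm]
  simp_rw [h1]
  rw [Finset.sum_comm]
  refine Finset.sum_congr rfl fun i _ => ?_
  conv_rhs => rw [h2 i]
  simp

/-- Only linearity of `G.inverse` matters, so basis independence holds for an arbitrary form `G`. -/
theorem metricTrace_eq [FiniteDimensional ℝ E] {ι : Type*} [Fintype ι] (e : Module.Basis ι ℝ E)
    (G : E →L[ℝ] E →L[ℝ] ℝ) (b : E →L[ℝ] E →L[ℝ] V) :
    metricTrace G (fun u v => b u v) = ∑ i, b (e i) (G.inverse (coordL e i)) := by
  have := sum_basis_coord_eq e (Module.finBasis ℝ E)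
    (((ContinuousLinearMap.compL ℝ (E →L[ℝ] ℝ) E V).flip G.inverse).comp b)
  simpa [metricTrace] using this

/-- The trace in an orthonormal basis. -/
theorem metricTrace_eq_orthonormal [FiniteDimensional ℝ E] {ι : Type*} [Fintype ι] [DecidableEq ι]
    (e : Module.Basis ι ℝ E) {G : E →L[ℝ] E →L[ℝ] ℝ} (hG : IsInner G)
    (he : ∀ i j, G (e i) (e j) = if i = j then 1 else 0) (b : E →L[ℝ] E →L[ℝ] V) :
    metricTrace G (fun u v => b u v) = ∑ i, b (e i) (e i) := by
  rw [metricTrace_eq e]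
  refine Finset.sum_congr rfl fun i _ => ?_
  have h : coordL e i = G (e i) := by
    refine ContinuousLinearMap.coe_injective (e.ext fun j => ?_)
    simp [he, Finsupp.single_apply, eq_comm]
  rw [h, hG.inverse_apply]

/-- The trace is basis-free, so the basis of `E₁` may be carried to `E` by `A`; it remains to match
the two families of dual vectors. -/
theorem metricTrace_comp [FiniteDimensional ℝ E] [FiniteDimensional ℝ E₁]
    {G : E →L[ℝ] E →L[ℝ] ℝ} (hG : IsInner G) (A : E₁ ≃L[ℝ] E) (b : E →L[ℝ] E →L[ℝ] V) :
    metricTrace (G.bilinearComp (A : E₁ →L[ℝ] E) (A : E₁ →L[ℝ] E))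
      (fun u v => b (A u) (A v)) = metricTrace G (fun u v => b u v) := by
  have hG₁ : IsInner (G.bilinearComp (A : E₁ →L[ℝ] E) (A : E₁ →L[ℝ] E)) :=
    ⟨fun u v => hG.symm _ _, fun v hv => hG.pos _ (by simpa using hv)⟩
  have h0 := metricTrace_eq (Module.finBasis ℝ E₁)
    (G.bilinearComp (A : E₁ →L[ℝ] E) (A : E₁ →L[ℝ] E))
    (b.bilinearComp (A : E₁ →L[ℝ] E) (A : E₁ →L[ℝ] E))
  simp only [ContinuousLinearMap.bilinearComp_apply, ContinuousLinearEquiv.coe_coe] at h0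
  rw [h0, metricTrace_eq ((Module.finBasis ℝ E₁).map A.toLinearEquiv)]
  refine Finset.sum_congr rfl fun i _ => ?_
  simp only [Module.Basis.map_apply]
  congr 1
  apply hG.injective
  rw [hG.apply_inverse]
  ext w
  have h1 := DFunLike.congr_fun (hG₁.apply_inverse (coordL (Module.finBasis ℝ E₁) i)) (A.symm w)
  simp only [ContinuousLinearMap.bilinearComp_apply, ContinuousLinearEquiv.coe_coe,
    ContinuousLinearEquiv.apply_symm_apply] at h1
  rw [h1]
  simp [coordL]

/-- Christoffel symbols of a metric on a vector space, as a bilinear map. -/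
def levi (b : E → E →L[ℝ] E →L[ℝ] ℝ) (z : E) : E →L[ℝ] E →L[ℝ] E :=
  (ContinuousLinearMap.compL ℝ E (E →L[ℝ] ℝ) E (b z).inverse).comp
    ((1 / 2 : ℝ) • (fderiv ℝ b z + (fderiv ℝ b z).flip -
      ((ContinuousLinearMap.flipₗᵢ ℝ E E ℝ).toContinuousLinearEquiv :
        (E →L[ℝ] E →L[ℝ] ℝ) →L[ℝ] (E →L[ℝ] E →L[ℝ] ℝ)).comp (fderiv ℝ b z).flip))

/-- The right side is the body of `christoffel`, so `levi` and `christoffel` agree definitionally.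
The later `rfl` proofs unfolding `tension` and `covDeriv` depend on this. -/
theorem levi_apply (b : E → E →L[ℝ] E →L[ℝ] ℝ) (z u v : E) :
    levi b z u v = (b z).inverse ((1 / 2 : ℝ) • (fderiv ℝ b z u v + fderiv ℝ b z v u
      - ((fderiv ℝ b z).flip u).flip v)) := rfl

theorem apply_levi [FiniteDimensional ℝ E] {b : E → E →L[ℝ] E →L[ℝ] ℝ} {z : E}
    (hb : IsInner (b z)) (u v w : E) :
    b z (levi b z u v) w =
      1 / 2 * (fderiv ℝ b z u v w + fderiv ℝ b z v u w - fderiv ℝ b z w u v) := by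
  rw [levi_apply, hb.apply_inverse]
  simp

theorem fderiv_symm {b : E → V →L[ℝ] V →L[ℝ] V₁} {z : E}
    (hb : DifferentiableAt ℝ b z) (hs : ∀ᶠ y in 𝓝 z, ∀ u v, b y u v = b y v u) (u : E) (v w : V) :
    fderiv ℝ b z u v w = fderiv ℝ b z u w v := by
  have h1 : HasFDerivAt (fun y => b y v w)
      ((ContinuousLinearMap.apply ℝ V₁ w).comp
        ((ContinuousLinearMap.apply ℝ (V →L[ℝ] V₁) v).comp (fderiv ℝ b z))) z :=
    (ContinuousLinearMap.apply ℝ V₁ w).hasFDerivAt.comp z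
      ((ContinuousLinearMap.apply ℝ (V →L[ℝ] V₁) v).hasFDerivAt.comp z hb.hasFDerivAt)
  have h2 : HasFDerivAt (fun y => b y w v)
      ((ContinuousLinearMap.apply ℝ V₁ v).comp
        ((ContinuousLinearMap.apply ℝ (V →L[ℝ] V₁) w).comp (fderiv ℝ b z))) z :=
    (ContinuousLinearMap.apply ℝ V₁ v).hasFDerivAt.comp z
      ((ContinuousLinearMap.apply ℝ (V →L[ℝ] V₁) w).hasFDerivAt.comp z hb.hasFDerivAt)
  have h3 : (fun y => b y v w) =ᶠ[𝓝 z] fun y => b y w v := hs.mono fun y hy => hy v w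
  have := (h2.congr_of_eventuallyEq h3).unique h1
  exact (DFunLike.congr_fun this u).symm

theorem ContDiffAt.levi [FiniteDimensional ℝ E] {b : E → E →L[ℝ] E →L[ℝ] ℝ} {z : E}
    (hb : ContDiffAt ℝ ∞ b z) (hz : IsInner (b z)) : ContDiffAt ℝ ∞ (levi b) z := by
  have hd : ContDiffAt ℝ ∞ (fderiv ℝ b) z := hb.fderiv_right (by simp)
  have hfl : ContDiffAt ℝ ∞ (fun y => (fderiv ℝ b y).flip) z :=
    (ContinuousLinearMap.flipₗᵢ ℝ E E (E →L[ℝ] ℝ)).contDiff.contDiffAt.comp z hd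
  have hinv : ContDiffAt ℝ ∞ (fun y => (b y).inverse) z := by
    obtain ⟨e, he⟩ := hz.isInvertible
    have := contDiffAt_map_inverse (𝕜 := ℝ) (n := ∞) e
    rw [he] at this
    exact this.comp z hb
  refine ContDiffAt.clm_comp ((ContinuousLinearMap.contDiff _).contDiffAt.comp z hinv) ?_
  refine ContDiffAt.const_smul _ ((hd.add hfl).sub ?_)
  exact ContDiffAt.clm_comp contDiffAt_const hfl

/-- Derivative of the pull-back of a metric. -/
theorem fderiv_pullback {b₂ : E → E →L[ℝ] E →L[ℝ] ℝ} {b₁ : E₁ → E₁ →L[ℝ] E₁ →L[ℝ] ℝ}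
    {ψ : E₁ → E} {z : E₁} (hψ : ContDiffAt ℝ 2 ψ z) (hb₂ : DifferentiableAt ℝ b₂ (ψ z))
    (h : ∀ᶠ y in 𝓝 z, ∀ u v, b₁ y u v = b₂ (ψ y) (fderiv ℝ ψ y u) (fderiv ℝ ψ y v))
    (hb₁ : DifferentiableAt ℝ b₁ z) (u v w : E₁) :
    fderiv ℝ b₁ z u v w = fderiv ℝ b₂ (ψ z) (fderiv ℝ ψ z u) (fderiv ℝ ψ z v) (fderiv ℝ ψ z w)
      + b₂ (ψ z) (fderiv ℝ (fderiv ℝ ψ) z u v) (fderiv ℝ ψ z w)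
      + b₂ (ψ z) (fderiv ℝ ψ z v) (fderiv ℝ (fderiv ℝ ψ) z u w) := by
  have h1 : HasFDerivAt (fun y => b₁ y v w)
      ((ContinuousLinearMap.apply ℝ ℝ w).comp
        ((ContinuousLinearMap.apply ℝ (E₁ →L[ℝ] ℝ) v).comp (fderiv ℝ b₁ z))) z :=
    (ContinuousLinearMap.apply ℝ ℝ w).hasFDerivAt.comp z
      ((ContinuousLinearMap.apply ℝ (E₁ →L[ℝ] ℝ) v).hasFDerivAt.comp z hb₁.hasFDerivAt)
  have hψd : HasFDerivAt ψ (fderiv ℝ ψ z) z := (hψ.differentiableAt (by simp)).hasFDerivAt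
  have hψ2 : HasFDerivAt (fderiv ℝ ψ) (fderiv ℝ (fderiv ℝ ψ) z) z :=
    ((hψ.fderiv_right (m := 1) (by norm_num)).differentiableAt (by simp)).hasFDerivAt
  have h2 := ((hb₂.hasFDerivAt.comp z hψd).clm_apply (hψ2.clm_apply (hasFDerivAt_const v z))).clm_apply
    (hψ2.clm_apply (hasFDerivAt_const w z))
  have h3 : (fun y => b₁ y v w) =ᶠ[𝓝 z]
      fun y => b₂ (ψ y) (fderiv ℝ ψ y v) (fderiv ℝ ψ y w) := h.mono fun y hy => hy v w
  have h4 := DFunLike.congr_fun (h1.unique (h2.congr_of_eventuallyEq h3)) u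
  simp at h4
  rw [h4]
  ring

/-- The transformation law of Christoffel symbols. -/
theorem levi_pullback [FiniteDimensional ℝ E] [FiniteDimensional ℝ E₁]
    {b₂ : E → E →L[ℝ] E →L[ℝ] ℝ} {b₁ : E₁ → E₁ →L[ℝ] E₁ →L[ℝ] ℝ}
    {ψ : E₁ → E} {z : E₁} (hψ : ContDiffAt ℝ 2 ψ z) (hb₂ : DifferentiableAt ℝ b₂ (ψ z))
    (hs₂ : ∀ᶠ y in 𝓝 (ψ z), IsInner (b₂ y))
    (h : ∀ᶠ y in 𝓝 z, ∀ u v, b₁ y u v = b₂ (ψ y) (fderiv ℝ ψ y u) (fderiv ℝ ψ y v))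
    (hb₁ : DifferentiableAt ℝ b₁ z) (hsurj : Function.Surjective (fderiv ℝ ψ z))
    (hs₁ : IsInner (b₁ z)) (u v : E₁) :
    fderiv ℝ ψ z (levi b₁ z u v) =
      fderiv ℝ (fderiv ℝ ψ) z u v + levi b₂ (ψ z) (fderiv ℝ ψ z u) (fderiv ℝ ψ z v) := by
  have hI := hs₂.self_of_nhds
  apply hI.injective
  ext w'
  obtain ⟨w, rfl⟩ := hsurj w'
  have hsym : ∀ u v, fderiv ℝ (fderiv ℝ ψ) z u v = fderiv ℝ (fderiv ℝ ψ) z v u := fun u v =>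
    (hψ.isSymmSndFDerivAt (by simp)).eq u v
  -- Tested against `dψ(w)`, both sides become Koszul formulas. The three metric derivatives produce
  -- six terms in `D²ψ`: by symmetry four cancel, and the other two add up to the inhomogeneous
  -- term.
  rw [← h.self_of_nhds, apply_levi hs₁, map_add, add_apply, apply_levi hI,
    fderiv_pullback hψ hb₂ h hb₁, fderiv_pullback hψ hb₂ h hb₁, fderiv_pullback hψ hb₂ h hb₁,
    hsym v u, hsym w u, hsym w v, hI.symm (fderiv ℝ ψ z v) (fderiv ℝ (fderiv ℝ ψ) z u w),
    hI.symm (fderiv ℝ ψ z u) (fderiv ℝ (fderiv ℝ ψ) z v w)]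
  ring

/-- The second covariant derivative of a map into a flat space. -/
def hessFlat (b : E → E →L[ℝ] E →L[ℝ] ℝ) (F : E → V) (z : E) : E →L[ℝ] E →L[ℝ] V :=
  fderiv ℝ (fderiv ℝ F) z - (ContinuousLinearMap.compL ℝ E E V (fderiv ℝ F z)).comp (levi b z)

theorem hessFlat_apply (b : E → E →L[ℝ] E →L[ℝ] ℝ) (F : E → V) (z u v : E) :
    hessFlat b F z u v = fderiv ℝ (fderiv ℝ F) z u v - fderiv ℝ F z (levi b z u v) := rfl

/-- The second covariant derivative of a map between spaces with metrics. -/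
def hess (b : E → E →L[ℝ] E →L[ℝ] ℝ) (b' : V → V →L[ℝ] V →L[ℝ] ℝ) (F : E → V) (z : E) :
    E →L[ℝ] E →L[ℝ] V :=
  hessFlat b F z + (levi b' (F z)).bilinearComp (fderiv ℝ F z) (fderiv ℝ F z)

theorem hess_apply (b : E → E →L[ℝ] E →L[ℝ] ℝ) (b' : V → V →L[ℝ] V →L[ℝ] ℝ) (F : E → V)
    (z u v : E) :
    hess b b' F z u v = fderiv ℝ (fderiv ℝ F) z u v - fderiv ℝ F z (levi b z u v)
      + levi b' (F z) (fderiv ℝ F z u) (fderiv ℝ F z v) := rfl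

theorem fderiv_comp_eventually {F : E → V} {ψ : E₁ → E} {z : E₁} (hψ : ContDiffAt ℝ 1 ψ z)
    (hF : ContDiffAt ℝ 1 F (ψ z)) :
    ∀ᶠ y in 𝓝 z, fderiv ℝ (F ∘ ψ) y = (fderiv ℝ F (ψ y)).comp (fderiv ℝ ψ y) := by
  have h1 : ∀ᶠ y in 𝓝 z, ContDiffAt ℝ 1 ψ y := hψ.eventually (by simp)
  have h2 : ∀ᶠ y in 𝓝 z, ContDiffAt ℝ 1 F (ψ y) :=
    hψ.continuousAt.eventually (hF.eventually (by simp))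
  filter_upwards [h1, h2] with y hy1 hy2
  exact fderiv_comp y (hy2.differentiableAt (by simp)) (hy1.differentiableAt (by simp))

theorem fderiv_fderiv_comp {F : E → V} {ψ : E₁ → E} {z : E₁} (hψ : ContDiffAt ℝ 2 ψ z)
    (hF : ContDiffAt ℝ 2 F (ψ z)) (u v : E₁) :
    fderiv ℝ (fderiv ℝ (F ∘ ψ)) z u v =
      fderiv ℝ (fderiv ℝ F) (ψ z) (fderiv ℝ ψ z u) (fderiv ℝ ψ z v)
        + fderiv ℝ F (ψ z) (fderiv ℝ (fderiv ℝ ψ) z u v) := by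
  have he := fderiv_comp_eventually (hψ.of_le (by norm_num)) (hF.of_le (by norm_num))
  have hψd : HasFDerivAt ψ (fderiv ℝ ψ z) z := (hψ.differentiableAt (by simp)).hasFDerivAt
  have hψ2 : HasFDerivAt (fderiv ℝ ψ) (fderiv ℝ (fderiv ℝ ψ) z) z :=
    ((hψ.fderiv_right (m := 1) (by norm_num)).differentiableAt (by simp)).hasFDerivAt
  have hF2 : HasFDerivAt (fderiv ℝ F) (fderiv ℝ (fderiv ℝ F) (ψ z)) (ψ z) :=
    ((hF.fderiv_right (m := 1) (by norm_num)).differentiableAt (by simp)).hasFDerivAt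
  have h := ((hF2.comp z hψd).clm_comp hψ2).congr_of_eventuallyEq he
  rw [h.fderiv]
  simp [add_comm]

/-- The chain rule adds `dF(D²ψ(u, v))`, and the transformation law of the Christoffel symbols
subtracts the same term. -/
theorem hessFlat_comp [FiniteDimensional ℝ E] [FiniteDimensional ℝ E₁]
    {b₂ : E → E →L[ℝ] E →L[ℝ] ℝ} {b₁ : E₁ → E₁ →L[ℝ] E₁ →L[ℝ] ℝ}
    {ψ : E₁ → E} {z : E₁} (hψ : ContDiffAt ℝ 2 ψ z) (hb₂ : DifferentiableAt ℝ b₂ (ψ z))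
    (hs₂ : ∀ᶠ y in 𝓝 (ψ z), IsInner (b₂ y))
    (h : ∀ᶠ y in 𝓝 z, ∀ u v, b₁ y u v = b₂ (ψ y) (fderiv ℝ ψ y u) (fderiv ℝ ψ y v))
    (hb₁ : DifferentiableAt ℝ b₁ z) (hsurj : Function.Surjective (fderiv ℝ ψ z))
    (hs₁ : IsInner (b₁ z)) {F : E → V} (hF : ContDiffAt ℝ 2 F (ψ z)) (u v : E₁) :
    hessFlat b₁ (F ∘ ψ) z u v = hessFlat b₂ F (ψ z) (fderiv ℝ ψ z u) (fderiv ℝ ψ z v) := by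
  rw [hessFlat_apply, hessFlat_apply, fderiv_fderiv_comp hψ hF,
    fderiv_comp z (hF.differentiableAt (by simp)) (hψ.differentiableAt (by simp)),
    ContinuousLinearMap.comp_apply, levi_pullback hψ hb₂ hs₂ h hb₁ hsurj hs₁, map_add]
  abel

theorem hess_comp_source [FiniteDimensional ℝ E] [FiniteDimensional ℝ E₁]
    {b₂ : E → E →L[ℝ] E →L[ℝ] ℝ} {b₁ : E₁ → E₁ →L[ℝ] E₁ →L[ℝ] ℝ}
    (b' : V → V →L[ℝ] V →L[ℝ] ℝ)
    {ψ : E₁ → E} {z : E₁} (hψ : ContDiffAt ℝ 2 ψ z) (hb₂ : DifferentiableAt ℝ b₂ (ψ z))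
    (hs₂ : ∀ᶠ y in 𝓝 (ψ z), IsInner (b₂ y))
    (h : ∀ᶠ y in 𝓝 z, ∀ u v, b₁ y u v = b₂ (ψ y) (fderiv ℝ ψ y u) (fderiv ℝ ψ y v))
    (hb₁ : DifferentiableAt ℝ b₁ z) (hsurj : Function.Surjective (fderiv ℝ ψ z))
    (hs₁ : IsInner (b₁ z)) {F : E → V} (hF : ContDiffAt ℝ 2 F (ψ z)) (u v : E₁) :
    hess b₁ b' (F ∘ ψ) z u v = hess b₂ b' F (ψ z) (fderiv ℝ ψ z u) (fderiv ℝ ψ z v) := by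
  have h1 := hessFlat_comp hψ hb₂ hs₂ h hb₁ hsurj hs₁ hF u v
  simp only [hess, add_apply, ContinuousLinearMap.bilinearComp_apply, h1,
    fderiv_comp z (hF.differentiableAt (by simp)) (hψ.differentiableAt (by simp)),
    ContinuousLinearMap.comp_apply, Function.comp_apply]

/-- On the target side, the `D²ψ` of the chain rule together with the Christoffel term of `b₂` is
the image under `dψ` of the Christoffel term of `b₁`. -/
theorem hess_comp_target [FiniteDimensional ℝ V] [FiniteDimensional ℝ V₁]
    (b : E → E →L[ℝ] E →L[ℝ] ℝ)
    {b₂ : V → V →L[ℝ] V →L[ℝ] ℝ} {b₁ : V₁ → V₁ →L[ℝ] V₁ →L[ℝ] ℝ}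
    {ψ : V₁ → V} {F : E → V₁} {z : E} (hψ : ContDiffAt ℝ 2 ψ (F z))
    (hb₂ : DifferentiableAt ℝ b₂ (ψ (F z)))
    (hs₂ : ∀ᶠ y in 𝓝 (ψ (F z)), IsInner (b₂ y))
    (h : ∀ᶠ y in 𝓝 (F z), ∀ u v, b₁ y u v = b₂ (ψ y) (fderiv ℝ ψ y u) (fderiv ℝ ψ y v))
    (hb₁ : DifferentiableAt ℝ b₁ (F z)) (hsurj : Function.Surjective (fderiv ℝ ψ (F z)))
    (hs₁ : IsInner (b₁ (F z))) (hF : ContDiffAt ℝ 2 F z) (u v : E) :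
    hess b b₂ (ψ ∘ F) z u v = fderiv ℝ ψ (F z) (hess b b₁ F z u v) := by
  have hc := fderiv_comp z (hψ.differentiableAt (by simp)) (hF.differentiableAt (by simp))
  rw [hess_apply, hess_apply, fderiv_fderiv_comp hF hψ, hc]
  simp only [ContinuousLinearMap.comp_apply, Function.comp_apply, map_add, map_sub]
  rw [levi_pullback hψ hb₂ hs₂ h hb₁ hsurj hs₁]
  abel

end FlatGeometry

/-! ### Bundle-like metrics on a product of a leaf factor and a transverse factor. -/

section FlatFoliation

variable {A : Type*} [NormedAddCommGroup A] [NormedSpace ℝ A] [FiniteDimensional ℝ A]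
  {B : Type*} [NormedAddCommGroup B] [NormedSpace ℝ B] [FiniteDimensional ℝ B]
  {E : Type*} [NormedAddCommGroup E] [NormedSpace ℝ E]
  {V : Type*} [NormedAddCommGroup V] [NormedSpace ℝ V]

theorem ContDiffAt.bilinearComp_const {C : Type*} [NormedAddCommGroup C] [NormedSpace ℝ C]
    {g : E → C →L[ℝ] C →L[ℝ] V} {z : E} (hg : ContDiffAt ℝ ∞ g z) (L : A →L[ℝ] C) (M : B →L[ℝ] C) :
    ContDiffAt ℝ ∞ (fun y => (g y).bilinearComp L M) z := by
  have h1 : ContDiffAt ℝ ∞ (fun y => (ContinuousLinearMap.precomp V M).comp ((g y).comp L)) z :=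
    contDiffAt_const.clm_comp (hg.clm_comp contDiffAt_const)
  exact h1

theorem ContDiffAt.metricTrace {g : E → A →L[ℝ] A →L[ℝ] ℝ}
    {b : E → A →L[ℝ] A →L[ℝ] V} {z : E} (hg : ContDiffAt ℝ ∞ g z) (hz : IsInner (g z))
    (hb : ContDiffAt ℝ ∞ b z) : ContDiffAt ℝ ∞ (fun y => metricTrace (g y) fun u v => b y u v) z := by
  have hinv : ContDiffAt ℝ ∞ (fun y => (g y).inverse) z := by
    obtain ⟨e, he⟩ := hz.isInvertible
    have := contDiffAt_map_inverse (𝕜 := ℝ) (n := ∞) e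
    rw [he] at this
    exact this.comp z hg
  unfold FoliatedHeatFlow.metricTrace
  exact ContDiffAt.sum fun i _ =>
    (hb.clm_apply contDiffAt_const).clm_apply (hinv.clm_apply contDiffAt_const)

/-- The restriction of a form on `A × B` to the first factor. -/
abbrev resLeft (g : A × B →L[ℝ] A × B →L[ℝ] V) : A →L[ℝ] A →L[ℝ] V :=
  g.bilinearComp (ContinuousLinearMap.inl ℝ A B) (ContinuousLinearMap.inl ℝ A B)

/-- The restriction of a form on `A × B` to the second factor. -/
abbrev resRight (g : A × B →L[ℝ] A × B →L[ℝ] V) : B →L[ℝ] B →L[ℝ] V :=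
  g.bilinearComp (ContinuousLinearMap.inr ℝ A B) (ContinuousLinearMap.inr ℝ A B)

theorem IsInner.resLeft {g : A × B →L[ℝ] A × B →L[ℝ] ℝ} (hg : IsInner g) :
    IsInner (resLeft g) :=
  ⟨fun _ _ => hg.symm _ _, fun v hv => hg.pos _ (by simpa using hv)⟩

theorem IsInner.resRight {g : A × B →L[ℝ] A × B →L[ℝ] ℝ} (hg : IsInner g) :
    IsInner (resRight g) :=
  ⟨fun _ _ => hg.symm _ _, fun v hv => hg.pos _ (by simpa using hv)⟩

/-- Orthogonality of the factors makes the inverse metric block diagonal; `hl` and `hr` express this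
on the dual basis. -/
theorem metricTrace_prod {g : A × B →L[ℝ] A × B →L[ℝ] ℝ} (hg : IsInner g)
    (h : ∀ a b, g (a, 0) (0, b) = 0) (b : A × B →L[ℝ] A × B →L[ℝ] V) :
    metricTrace g (fun u v => b u v) = metricTrace (resLeft g) (fun u v => b (u, 0) (v, 0))
      + metricTrace (resRight g) (fun u v => b (0, u) (0, v)) := by
  have h1 := metricTrace_eq (Module.finBasis ℝ A) (resLeft g) (resLeft b)
  have h2 := metricTrace_eq (Module.finBasis ℝ B) (resRight g) (resRight b)
  simp only [ContinuousLinearMap.bilinearComp_apply, ContinuousLinearMap.inl_apply,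
    ContinuousLinearMap.inr_apply] at h1 h2
  rw [h1, h2, metricTrace_eq ((Module.finBasis ℝ A).prod (Module.finBasis ℝ B)),
    Fintype.sum_sum_type]
  have hl : ∀ i, g.inverse (coordL ((Module.finBasis ℝ A).prod (Module.finBasis ℝ B)) (Sum.inl i))
      = ((resLeft g).inverse (coordL (Module.finBasis ℝ A) i), 0) := by
    intro i
    apply hg.injective
    rw [hg.apply_inverse]
    ext v
    · have := DFunLike.congr_fun (hg.resLeft.apply_inverse (coordL (Module.finBasis ℝ A) i)) v
      simp only [ContinuousLinearMap.bilinearComp_apply, ContinuousLinearMap.inl_apply] at this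
      simp [this]
    · simp [h]
  have hr : ∀ i, g.inverse (coordL ((Module.finBasis ℝ A).prod (Module.finBasis ℝ B)) (Sum.inr i))
      = (0, (resRight g).inverse (coordL (Module.finBasis ℝ B) i)) := by
    intro i
    apply hg.injective
    rw [hg.apply_inverse]
    ext v
    · simp [hg.symm _ (v, 0), h]
    · have := DFunLike.congr_fun (hg.resRight.apply_inverse (coordL (Module.finBasis ℝ B) i)) v
      simp only [ContinuousLinearMap.bilinearComp_apply, ContinuousLinearMap.inr_apply] at this
      simp [this]
  simp [hl, hr]

/-- The horizontal lift of a vector of `B` to a vector orthogonal to `A`. -/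
def horLift (g : A × B →L[ℝ] A × B →L[ℝ] ℝ) : B →L[ℝ] A × B :=
  ContinuousLinearMap.inr ℝ A B - (ContinuousLinearMap.inl ℝ A B).comp ((resLeft g).inverse.comp
    (g.bilinearComp (ContinuousLinearMap.inr ℝ A B) (ContinuousLinearMap.inl ℝ A B)))

theorem horLift_snd (g : A × B →L[ℝ] A × B →L[ℝ] ℝ) (b : B) : (horLift g b).2 = b := by
  simp [horLift]

theorem IsInner.horLift_left {g : A × B →L[ℝ] A × B →L[ℝ] ℝ} (hg : IsInner g) (b : B) (a : A) :
    g (horLift g b) (a, 0) = 0 := by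
  have h := DFunLike.congr_fun (hg.resLeft.apply_inverse
    (g.bilinearComp (ContinuousLinearMap.inr ℝ A B) (ContinuousLinearMap.inl ℝ A B) b)) a
  simp only [ContinuousLinearMap.bilinearComp_apply, ContinuousLinearMap.inl_apply,
    ContinuousLinearMap.inr_apply] at h
  have e : horLift g b = (0, b) - ((FoliatedHeatFlow.resLeft g).inverse
      (g.bilinearComp (ContinuousLinearMap.inr ℝ A B) (ContinuousLinearMap.inl ℝ A B) b), 0) := rfl
  rw [e, map_sub, sub_apply, h, sub_self]

theorem IsInner.left_horLift {g : A × B →L[ℝ] A × B →L[ℝ] ℝ} (hg : IsInner g) (b : B) (a : A) :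
    g (a, 0) (horLift g b) = 0 := by
  rw [hg.symm, hg.horLift_left]

/-- The metric `g` on (a part of) `A × B` induces the metric `G` of `B` on the
orthogonal complement of `A`. -/
def BundleLikeAt (g : A × B → A × B →L[ℝ] A × B →L[ℝ] ℝ) (G : B → B →L[ℝ] B →L[ℝ] ℝ)
    (z : A × B) : Prop :=
  ∀ u v, (∀ a, g z u (a, 0) = 0) → (∀ a, g z v (a, 0) = 0) → g z u v = G z.2 u.2 v.2

variable {g : A × B → A × B →L[ℝ] A × B →L[ℝ] ℝ} {G : B → B →L[ℝ] B →L[ℝ] ℝ} {z : A × B}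

theorem BundleLikeAt.apply_horLift (h : BundleLikeAt g G z) (hg : IsInner (g z)) (b c : B) :
    g z (horLift (g z) b) (horLift (g z) c) = G z.2 b c := by
  rw [h _ _ (hg.horLift_left b) (hg.horLift_left c), horLift_snd, horLift_snd]

theorem BundleLikeAt.isInner (h : BundleLikeAt g G z) (hg : IsInner (g z)) : IsInner (G z.2) := by
  refine ⟨fun u v => ?_, fun v hv => ?_⟩
  · rw [← h.apply_horLift hg, ← h.apply_horLift hg, hg.symm]
  · rw [← h.apply_horLift hg]
    refine hg.pos _ fun h0 => hv ?_
    rw [← horLift_snd (g z) v, h0]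
    rfl

/-- Subtracting the horizontal lift of `x.2` from `x` leaves a vector of `A`, which is orthogonal to
horizontal vectors. Hence pairing with horizontal lifts determines transverse components, because
`G` is nondegenerate. -/
theorem BundleLikeAt.apply_right_horLift (h : BundleLikeAt g G z) (hg : IsInner (g z))
    (x : A × B) (c : B) : g z x (horLift (g z) c) = G z.2 x.2 c := by
  have h2 : x = ((x - horLift (g z) x.2).1, 0) + horLift (g z) x.2 := by
    ext <;> simp [horLift_snd]
  rw [h2, map_add, add_apply, hg.left_horLift, h.apply_horLift hg]
  simp [horLift_snd]

/-- The transverse part of the inverse of a bundle-like metric. -/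
theorem BundleLikeAt.inverse_snd (h : BundleLikeAt g G z) (hg : IsInner (g z)) (β : B →L[ℝ] ℝ) :
    ((g z).inverse (β.comp (ContinuousLinearMap.snd ℝ A B))).2 = (G z.2).inverse β := by
  apply (h.isInner hg).injective
  rw [(h.isInner hg).apply_inverse]
  ext c
  rw [← h.apply_right_horLift hg, hg.apply_inverse]
  simp [horLift_snd]

theorem ContDiffAt.horLift (hg : ContDiffAt ℝ ∞ g z) (hz : IsInner (g z)) :
    ContDiffAt ℝ ∞ (fun y => horLift (g y)) z := by
  have hres : ∀ L : A →L[ℝ] A × B,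
      ContDiffAt ℝ ∞ (fun y => (g y).bilinearComp L (ContinuousLinearMap.inl ℝ A B)) z :=
    fun L => hg.bilinearComp_const L _
  have hres' : ∀ L : B →L[ℝ] A × B,
      ContDiffAt ℝ ∞ (fun y => (g y).bilinearComp L (ContinuousLinearMap.inl ℝ A B)) z :=
    fun L => hg.bilinearComp_const L _
  have hinv : ContDiffAt ℝ ∞ (fun y => (resLeft (g y)).inverse) z := by
    obtain ⟨e, he⟩ := hz.resLeft.isInvertible
    have := contDiffAt_map_inverse (𝕜 := ℝ) (n := ∞) e
    rw [he] at this
    exact this.comp z (hres _)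
  exact contDiffAt_const.sub (contDiffAt_const.clm_comp (hinv.clm_comp (hres' _)))

/-- Differentiate `g(hor b, hor c) = G(b, c)`. The lifts have constant transverse part, so their
derivatives lie in `A` and pair to zero with the other horizontal lift. -/
theorem BundleLikeAt.fderiv_apply (hg : ContDiffAt ℝ ∞ g z) (hz : ∀ᶠ y in 𝓝 z, IsInner (g y))
    (h : ∀ᶠ y in 𝓝 z, BundleLikeAt g G y) (hG : DifferentiableAt ℝ G z.2) (x : A × B) (b c : B) :
    fderiv ℝ g z x (horLift (g z) b) (horLift (g z) c) = fderiv ℝ G z.2 x.2 b c := by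
  have hI := hz.self_of_nhds
  have hgd : HasFDerivAt g (fderiv ℝ g z) z := (hg.differentiableAt (by simp)).hasFDerivAt
  have hhor : HasFDerivAt (fun y => horLift (g y)) (fderiv ℝ (fun y => horLift (g y)) z) z :=
    ((ContDiffAt.horLift hg hI).differentiableAt (by simp)).hasFDerivAt
  have hsnd : ∀ b, (fderiv ℝ (fun y => horLift (g y)) z x b).2 = 0 := by
    intro b
    have h1 : HasFDerivAt (fun y => (horLift (g y) b).2)
        ((ContinuousLinearMap.snd ℝ A B).comp
          ((ContinuousLinearMap.apply ℝ (A × B) b).comp (fderiv ℝ (fun y => horLift (g y)) z))) z :=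
      (ContinuousLinearMap.snd ℝ A B).hasFDerivAt.comp z
        ((ContinuousLinearMap.apply ℝ (A × B) b).hasFDerivAt.comp z hhor)
    simp only [horLift_snd] at h1
    exact DFunLike.congr_fun (h1.unique (hasFDerivAt_const b z)) x
  have hpair : ∀ b, fderiv ℝ (fun y => horLift (g y)) z x b
      = ((fderiv ℝ (fun y => horLift (g y)) z x b).1, 0) := fun b => Prod.ext rfl (hsnd b)
  have h1 := (hgd.clm_apply (hhor.clm_apply (hasFDerivAt_const b z))).clm_apply
    (hhor.clm_apply (hasFDerivAt_const c z))
  have h2 : HasFDerivAt (fun y : A × B => G y.2 b c)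
      ((ContinuousLinearMap.apply ℝ ℝ c).comp ((ContinuousLinearMap.apply ℝ (B →L[ℝ] ℝ) b).comp
        ((fderiv ℝ G z.2).comp (ContinuousLinearMap.snd ℝ A B)))) z :=
    (ContinuousLinearMap.apply ℝ ℝ c).hasFDerivAt.comp z
      ((ContinuousLinearMap.apply ℝ (B →L[ℝ] ℝ) b).hasFDerivAt.comp z
        (hG.hasFDerivAt.comp z (ContinuousLinearMap.snd ℝ A B).hasFDerivAt))
  have h3 : (fun y : A × B => G y.2 b c) =ᶠ[𝓝 z]
      fun y => g y (horLift (g y) b) (horLift (g y) c) := by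
    filter_upwards [hz, h] with y hy1 hy2
    exact (hy2.apply_horLift hy1 b c).symm
  have h4 := DFunLike.congr_fun (h2.unique (h1.congr_of_eventuallyEq h3)) x
  simp only [ContinuousLinearMap.coe_comp, Function.comp_apply, ContinuousLinearMap.apply_apply,
    ContinuousLinearMap.coe_snd', add_apply, ContinuousLinearMap.flip_apply,
    zero_apply, map_zero, zero_add] at h4
  rw [hpair b, hpair c, hI.horLift_left, hI.left_horLift] at h4
  simpa using h4.symm

/-- The Christoffel symbols of a bundle-like metric on horizontal vectors. -/
theorem BundleLikeAt.levi_horLift_snd (hg : ContDiffAt ℝ ∞ g z)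
    (hz : ∀ᶠ y in 𝓝 z, IsInner (g y))
    (h : ∀ᶠ y in 𝓝 z, BundleLikeAt g G y) (hG : DifferentiableAt ℝ G z.2) (b c : B) :
    (levi g z (horLift (g z) b) (horLift (g z) c)).2 = levi G z.2 b c := by
  have hI := hz.self_of_nhds
  have hGI := h.self_of_nhds.isInner hI
  apply hGI.injective
  ext w
  -- Pairing with the horizontal lift of `w` reduces the claim to two Koszul formulas, which agree
  -- term by term.
  rw [← h.self_of_nhds.apply_right_horLift hI, apply_levi hI, apply_levi hGI]
  simp only [BundleLikeAt.fderiv_apply hg hz h hG, horLift_snd]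

/-- The isomorphism of `A × B` sending `B` to the orthogonal complement of `A`. -/
def horEquiv (g : A × B →L[ℝ] A × B →L[ℝ] ℝ) : (A × B) ≃L[ℝ] A × B :=
  ContinuousLinearEquiv.equivOfInverse
    ((ContinuousLinearMap.inl ℝ A B).coprod (horLift g))
    (ContinuousLinearMap.id ℝ (A × B) - (ContinuousLinearMap.inl ℝ A B).comp
      ((ContinuousLinearMap.fst ℝ A B).comp ((horLift g).comp (ContinuousLinearMap.snd ℝ A B))))
    (fun x => by ext <;> simp [horLift_snd]) (fun x => by ext <;> simp [horLift_snd])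

theorem horEquiv_apply (g : A × B →L[ℝ] A × B →L[ℝ] ℝ) (x : A × B) :
    horEquiv g x = (x.1, 0) + horLift g x.2 := by
  simp [horEquiv]

/-- The transverse part of the trace of the Christoffel symbols of a bundle-like metric. -/
theorem BundleLikeAt.metricTrace_levi_snd (hg : ContDiffAt ℝ ∞ g z)
    (hz : ∀ᶠ y in 𝓝 z, IsInner (g y))
    (h : ∀ᶠ y in 𝓝 z, BundleLikeAt g G y) (hG : DifferentiableAt ℝ G z.2) :
    (metricTrace (g z) fun u v => levi g z u v).2 =
      metricTrace (resLeft (g z)) (fun u v => (levi g z (u, 0) (v, 0)).2)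
        + metricTrace (G z.2) (fun u v => levi G z.2 u v) := by
  have hI := hz.self_of_nhds
  have hB := h.self_of_nhds
  -- In general `A` and `B` are not orthogonal. Changing variables by `horEquiv` makes them so,
  -- after which the trace splits.
  have hT := metricTrace_comp hI (horEquiv (g z)) (levi g z)
  have hI' : IsInner ((g z).bilinearComp (horEquiv (g z) : A × B →L[ℝ] A × B)
      (horEquiv (g z) : A × B →L[ℝ] A × B)) :=
    ⟨fun u v => hI.symm _ _, fun v hv => hI.pos _ (by simpa using hv)⟩
  have h1 := metricTrace_prod hI' (fun a b => by
    have e0 : ((0 : A), (0 : B)) = 0 := rfl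
    simp [horEquiv_apply, hI.left_horLift, e0])
    ((levi g z).bilinearComp (horEquiv (g z) : A × B →L[ℝ] A × B)
      (horEquiv (g z) : A × B →L[ℝ] A × B))
  simp only [ContinuousLinearMap.bilinearComp_apply, ContinuousLinearEquiv.coe_coe] at h1
  rw [← hT, h1]
  have e1 : resLeft ((g z).bilinearComp (horEquiv (g z) : A × B →L[ℝ] A × B)
      (horEquiv (g z) : A × B →L[ℝ] A × B)) = resLeft (g z) := by
    ext u v
    simp [horEquiv_apply]
  have e2 : resRight ((g z).bilinearComp (horEquiv (g z) : A × B →L[ℝ] A × B)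
      (horEquiv (g z) : A × B →L[ℝ] A × B)) = G z.2 := by
    ext u v
    simp only [ContinuousLinearMap.bilinearComp_apply, ContinuousLinearMap.inr_apply,
      ContinuousLinearEquiv.coe_coe, horEquiv_apply]
    have e0 : ((0 : A), (0 : B)) = 0 := rfl
    simp only [← hB.apply_horLift hI, e0, zero_add]
  rw [e1, e2, Prod.snd_add]
  have z1 : ∀ u : A, horEquiv (g z) (u, 0) = (u, 0) := fun u => by simp [horEquiv_apply]
  have z2 : ∀ u : B, horEquiv (g z) (0, u) = horLift (g z) u := fun u => by simp [horEquiv_apply]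
  simp only [z1, z2]
  simp only [metricTrace, Prod.snd_sum, BundleLikeAt.levi_horLift_snd hg hz h hG]

/-- The function `k` need not be regular: `f` is differentiated along the line `z + s • (a, 0)`, on
which it is constant near `z`. -/
theorem fderiv_left_eq_zero {f : A × B → V} {k : B → V} (h : ∀ᶠ y in 𝓝 z, f y = k y.2)
    (hf : DifferentiableAt ℝ f z) (a : A) : fderiv ℝ f z (a, 0) = 0 := by
  have hl : HasDerivAt (fun s : ℝ => z + s • ((a, 0) : A × B)) (a, 0) 0 := by
    simpa using ((hasDerivAt_id (0 : ℝ)).smul_const ((a, 0) : A × B)).const_add z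
  have hf' : HasFDerivAt f (fderiv ℝ f z) (z + (0 : ℝ) • ((a, 0) : A × B)) := by
    simpa using hf.hasFDerivAt
  have h1 := hf'.comp_hasDerivAt (0 : ℝ) hl
  have hc : Tendsto (fun s : ℝ => z + s • ((a, 0) : A × B)) (𝓝 0) (𝓝 z) := by
    simpa using hl.continuousAt.tendsto
  have h2 : (fun s : ℝ => f (z + s • ((a, 0) : A × B))) =ᶠ[𝓝 0] fun _ => k z.2 := by
    filter_upwards [hc.eventually h] with s hs
    rw [hs]
    simp
  exact h1.unique ((hasDerivAt_const (0 : ℝ) (k z.2)).congr_of_eventuallyEq h2)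

/-- Smooth families of inner products have smooth local orthonormal families. -/
theorem exists_orthonormal_family {P : E → A →L[ℝ] A →L[ℝ] ℝ} {z : E} (hP : ContDiffAt ℝ ∞ P z)
    (hI : ∀ᶠ y in 𝓝 z, IsInner (P y)) (r : ℕ) (hr : r ≤ Module.finrank ℝ A) :
    ∃ e : Fin r → E → A, (∀ i, ContDiffAt ℝ ∞ (e i) z) ∧
      ∀ᶠ y in 𝓝 z, ∀ i j, P y (e i y) (e j y) = if i = j then 1 else 0 := by
  induction r with
  | zero => exact ⟨Fin.elim0, fun i => i.elim0, Eventually.of_forall fun y i => i.elim0⟩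
  | succ r ih =>
    obtain ⟨e, he, heo⟩ := ih (by omega)
    have hspan : Submodule.span ℝ (Set.range fun i => e i z) ≠ ⊤ := by
      intro h
      have := finrank_range_le_card (R := ℝ) (fun i => e i z)
      rw [Set.finrank, h, finrank_top, Fintype.card_fin] at this
      omega
    obtain ⟨a, -, ha⟩ := SetLike.exists_of_lt hspan.lt_top
    -- Gram–Schmidt applied to a constant vector `a` outside the span at `z`. Thus `w z ≠ 0`, and `P
    -- y (w y) (w y)` stays positive near `z`, so the normalization is smooth.
    set w : E → A := fun y => a - ∑ i, P y a (e i y) • e i y with hw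
    have hwc : ContDiffAt ℝ ∞ w z := contDiffAt_const.sub (ContDiffAt.sum fun i _ =>
      ((hP.clm_apply contDiffAt_const).clm_apply (he i)).smul (he i))
    have hw0 : w z ≠ 0 := by
      intro h
      apply ha
      rw [hw, sub_eq_zero] at h
      rw [h]
      exact Submodule.sum_mem _ fun i _ => Submodule.smul_mem _ _ (Submodule.subset_span ⟨i, rfl⟩)
    have hqc : ContDiffAt ℝ ∞ (fun y => P y (w y) (w y)) z := (hP.clm_apply hwc).clm_apply hwc
    have hq0 : 0 < P z (w z) (w z) := hI.self_of_nhds.pos _ hw0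
    have hq : ∀ᶠ y in 𝓝 z, 0 < P y (w y) (w y) := hqc.continuousAt.eventually (lt_mem_nhds hq0)
    set ν : E → A := fun y => (√(P y (w y) (w y)))⁻¹ • w y with hν
    have hνc : ContDiffAt ℝ ∞ ν z :=
      ((hqc.sqrt hq0.ne').inv (Real.sqrt_pos.2 hq0).ne').smul hwc
    refine ⟨Fin.snoc e ν, fun i => ?_, ?_⟩
    · refine Fin.lastCases ?_ (fun i => ?_) i
      · simpa using hνc
      · simpa using he i
    · filter_upwards [hI, heo, hq] with y hy hyo hyq
      have hwe : ∀ j, P y (w y) (e j y) = 0 := by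
        intro j
        simp [hw, hyo]
      have hνe : ∀ j, P y (ν y) (e j y) = 0 := fun j => by simp [hν, hwe]
      have hνν : P y (ν y) (ν y) = 1 := by
        have hs := Real.mul_self_sqrt hyq.le
        have hs0 := (Real.sqrt_pos.2 hyq).ne'
        simp only [hν, map_smul, smul_apply, smul_eq_mul]
        nth_rw 3 [← hs]
        field_simp
      intro i j
      refine Fin.lastCases ?_ (fun i => ?_) i <;> refine Fin.lastCases ?_ (fun j => ?_) j
      · simp [hνν]
      · simp [hνe, (Fin.castSucc_lt_last _).ne']
      · simp [hy.symm _ (ν y), hνe, (Fin.castSucc_lt_last _).ne]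
      · simp [hyo]

end FlatFoliation

/-! ### Space and time derivatives on a time interval, and locally uniform bounds. -/

section Slices

variable {E : Type*} [NormedAddCommGroup E] [NormedSpace ℝ E]
  {V : Type*} [NormedAddCommGroup V] [NormedSpace ℝ V]

/-- The spatial derivative of a function of time and space. -/
def spaceDeriv (F : ℝ × E → V) (q : ℝ × E) : E →L[ℝ] V := fderiv ℝ (fun y => F (q.1, y)) q.2

/-- The derivative in time, within a time interval `J`. -/
def timeDeriv (J : Set ℝ) (F : ℝ × E → V) (q : ℝ × E) : V := derivWithin (fun s => F (s, q.2)) J q.1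

theorem two_le_infty : (2 : ℕ∞ω) ≤ ∞ := by
  have : ((2 : ℕ∞) : ℕ∞ω) ≤ ((⊤ : ℕ∞) : ℕ∞ω) := WithTop.coe_le_coe.2 le_top
  exact this

theorem one_le_infty : (1 : ℕ∞ω) ≤ ∞ := le_trans (by norm_num) two_le_infty

variable {J : Set ℝ} {U : Set E} {F : ℝ × E → V}

/-- Since `U` is open, the spatial derivative is a full derivative even where the derivative in time
is one-sided. -/
theorem hasFDerivAt_slice (hU : IsOpen U) (hF : ContDiffOn ℝ ∞ F (J ×ˢ U)) {q : ℝ × E}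
    (hq : q ∈ J ×ˢ U) : HasFDerivAt (fun y => F (q.1, y))
      ((fderivWithin ℝ F (J ×ˢ U) q).comp (ContinuousLinearMap.inr ℝ ℝ E)) q.2 := by
  have h1 : HasFDerivWithinAt F (fderivWithin ℝ F (J ×ˢ U) q) (J ×ˢ U) (q.1, q.2) :=
    (hF.differentiableOn (by simp) q hq).hasFDerivWithinAt
  have h2 : HasFDerivWithinAt (fun y : E => (q.1, y)) (ContinuousLinearMap.inr ℝ ℝ E) U q.2 :=
    (hasFDerivAt_prodMk_right q.1 q.2).hasFDerivWithinAt
  exact (h1.comp q.2 h2 (t := J ×ˢ U) fun y hy => Set.mk_mem_prod hq.1 hy).hasFDerivAt (hU.mem_nhds hq.2)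

theorem spaceDeriv_eq (hU : IsOpen U) (hF : ContDiffOn ℝ ∞ F (J ×ˢ U)) {q : ℝ × E}
    (hq : q ∈ J ×ˢ U) : spaceDeriv F q =
      (fderivWithin ℝ F (J ×ˢ U) q).comp (ContinuousLinearMap.inr ℝ ℝ E) :=
  (hasFDerivAt_slice hU hF hq).fderiv

theorem hasDerivWithinAt_slice (hF : ContDiffOn ℝ ∞ F (J ×ˢ U)) {q : ℝ × E}
    (hq : q ∈ J ×ˢ U) : HasDerivWithinAt (fun s => F (s, q.2))
      (fderivWithin ℝ F (J ×ˢ U) q (1, 0)) J q.1 := by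
  have h1 : HasFDerivWithinAt F (fderivWithin ℝ F (J ×ˢ U) q) (J ×ˢ U) (q.1, q.2) :=
    (hF.differentiableOn (by simp) q hq).hasFDerivWithinAt
  have h2 : HasDerivWithinAt (fun s : ℝ => (s, q.2)) ((1 : ℝ), (0 : E)) J q.1 :=
    (hasDerivWithinAt_id q.1 J).prodMk (hasDerivWithinAt_const q.1 J q.2)
  exact h1.comp_hasDerivWithinAt q.1 h2 (t := J ×ˢ U) fun s hs => Set.mk_mem_prod hs hq.2

theorem timeDeriv_eq (hJ : UniqueDiffOn ℝ J) (hF : ContDiffOn ℝ ∞ F (J ×ˢ U)) {q : ℝ × E}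
    (hq : q ∈ J ×ˢ U) : timeDeriv J F q = fderivWithin ℝ F (J ×ˢ U) q (1, 0) :=
  (hasDerivWithinAt_slice hF hq).derivWithin (hJ q.1 hq.1)

theorem ContDiffOn.spaceDeriv (hJ : UniqueDiffOn ℝ J) (hU : IsOpen U)
    (hF : ContDiffOn ℝ ∞ F (J ×ˢ U)) : ContDiffOn ℝ ∞ (spaceDeriv F) (J ×ˢ U) := by
  have h : ContDiffOn ℝ ∞ (fderivWithin ℝ F (J ×ˢ U)) (J ×ˢ U) :=
    hF.fderivWithin (hJ.prod hU.uniqueDiffOn) (by simp)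
  exact (h.clm_comp contDiffOn_const).congr fun q hq => spaceDeriv_eq hU hF hq

theorem ContDiffOn.timeDeriv (hJ : UniqueDiffOn ℝ J) (hU : IsOpen U)
    (hF : ContDiffOn ℝ ∞ F (J ×ˢ U)) : ContDiffOn ℝ ∞ (timeDeriv J F) (J ×ˢ U) := by
  have h : ContDiffOn ℝ ∞ (fderivWithin ℝ F (J ×ˢ U)) (J ×ˢ U) :=
    hF.fderivWithin (hJ.prod hU.uniqueDiffOn) (by simp)
  exact (h.clm_apply contDiffOn_const).congr fun q hq => timeDeriv_eq hJ hF hq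

theorem ContDiffOn.slice (hU : IsOpen U) (hF : ContDiffOn ℝ ∞ F (J ×ˢ U)) {q : ℝ × E}
    (hq : q ∈ J ×ˢ U) : ContDiffAt ℝ ∞ (fun y => F (q.1, y)) q.2 := by
  have h : ContDiffOn ℝ ∞ (fun y : E => F (q.1, y)) U :=
    hF.comp (t := J ×ˢ U) (contDiff_prodMk_right q.1).contDiffOn fun y hy => Set.mk_mem_prod hq.1 hy
  exact h.contDiffAt (hU.mem_nhds hq.2)

/-- Time and space derivatives commute. -/
theorem timeDeriv_spaceDeriv (hJ : UniqueDiffOn ℝ J) (hJ' : J ⊆ closure (interior J))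
    (hU : IsOpen U) (hF : ContDiffOn ℝ ∞ F (J ×ˢ U)) {q : ℝ × E} (hq : q ∈ J ×ˢ U) :
    timeDeriv J (spaceDeriv F) q = spaceDeriv (timeDeriv J F) q := by
  have hS : UniqueDiffOn ℝ (J ×ˢ U) := hJ.prod hU.uniqueDiffOn
  -- Symmetry of the second derivative within a set holds at limits of interior points; this covers
  -- the end points of the time interval.
  have hcl : q ∈ closure (interior (J ×ˢ U)) := by
    rw [interior_prod_eq, hU.interior_eq, closure_prod_eq]
    exact ⟨hJ' hq.1, subset_closure hq.2⟩
  have hsym := (hF q hq).isSymmSndFDerivWithinAt (by simpa using two_le_infty) hS hcl hq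
  have hL : ContDiffOn ℝ ∞ (fderivWithin ℝ F (J ×ˢ U)) (J ×ˢ U) := hF.fderivWithin hS (by simp)
  have h1 : HasDerivWithinAt (fun s => spaceDeriv F (s, q.2))
      ((fderivWithin ℝ (fderivWithin ℝ F (J ×ˢ U)) (J ×ˢ U) q (1, 0)).comp
        (ContinuousLinearMap.inr ℝ ℝ E)) J q.1 := by
    have := ((ContinuousLinearMap.precomp V
      (ContinuousLinearMap.inr ℝ ℝ E)).hasFDerivAt).comp_hasDerivWithinAt q.1
        (hasDerivWithinAt_slice hL hq)
    exact this.congr (fun s hs => spaceDeriv_eq hU hF (q := (s, q.2)) ⟨hs, hq.2⟩)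
      (spaceDeriv_eq hU hF hq)
  have h2 : HasFDerivAt (fun y => timeDeriv J F (q.1, y))
      ((ContinuousLinearMap.apply ℝ V ((1 : ℝ), (0 : E))).comp
        ((fderivWithin ℝ (fderivWithin ℝ F (J ×ˢ U)) (J ×ˢ U) q).comp
          (ContinuousLinearMap.inr ℝ ℝ E))) q.2 := by
    have := (ContinuousLinearMap.apply ℝ V ((1 : ℝ), (0 : E))).hasFDerivAt.comp q.2
      (hasFDerivAt_slice hU hL hq)
    refine this.congr_of_eventuallyEq ?_
    filter_upwards [hU.mem_nhds hq.2] with y hy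
    exact timeDeriv_eq hJ hF (q := (q.1, y)) ⟨hq.1, hy⟩
  rw [timeDeriv, h1.derivWithin (hJ q.1 hq.1), spaceDeriv, h2.fderiv]
  ext v
  exact hsym.eq _ _

theorem timeDeriv_clm_comp {V' : Type*} [NormedAddCommGroup V'] [NormedSpace ℝ V']
    (hJ : UniqueDiffOn ℝ J) (hF : ContDiffOn ℝ ∞ F (J ×ˢ U)) (L : V →L[ℝ] V') {q : ℝ × E}
    (hq : q ∈ J ×ˢ U) : timeDeriv J (fun q => L (F q)) q = L (timeDeriv J F q) := by
  have h := L.hasFDerivAt.comp_hasDerivWithinAt q.1 (hasDerivWithinAt_slice hF hq)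
  rw [timeDeriv_eq hJ hF hq]
  exact h.derivWithin (hJ q.1 hq.1)

theorem exists_eventually_norm_le {X : Type*} [TopologicalSpace X] {S : Set X} {f : X → V} {x : X}
    (hf : ContinuousWithinAt f S x) : ∃ K, ∀ᶠ y in 𝓝[S] x, ‖f y‖ ≤ K :=
  ⟨‖f x‖ + 1, (hf.norm.eventually (Iio_mem_nhds (lt_add_one _))).mono fun _ h => le_of_lt h⟩

/-- Inner products depending continuously on a parameter are locally uniformly coercive. -/
theorem exists_eventually_coercive [FiniteDimensional ℝ V] {X : Type*} [TopologicalSpace X]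
    {S : Set X} {Q : X → V →L[ℝ] V →L[ℝ] ℝ} {x : X} (hQ : ContinuousWithinAt Q S x)
    (hx : IsInner (Q x)) : ∃ κ > 0, ∀ᶠ y in 𝓝[S] x, ∀ v, κ * ‖v‖ ^ 2 ≤ Q y v v := by
  -- The constant `m` is the minimum of `Q x` on the unit sphere. Half of it survives for forms at
  -- distance less than `m / 2` from `Q x`.
  obtain ⟨m, hm, hmv⟩ : ∃ m > 0, ∀ v, m * ‖v‖ ^ 2 ≤ Q x v v := by
    rcases subsingleton_or_nontrivial V with hV | hV
    · exact ⟨1, one_pos, fun v => by simp [Subsingleton.elim v 0]⟩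
    obtain ⟨v₀, hv₀, hmin⟩ := (isCompact_sphere (0 : V) 1).exists_isMinOn
      (NormedSpace.sphere_nonempty.2 zero_le_one)
      (f := fun v => Q x v v) (by fun_prop)
    have hv₀' : v₀ ≠ 0 := by
      rintro rfl
      simp at hv₀
    refine ⟨Q x v₀ v₀, hx.pos _ hv₀', fun v => ?_⟩
    rcases eq_or_ne v 0 with rfl | hv
    · simp
    have hn : 0 < ‖v‖ := norm_pos_iff.2 hv
    have h1 : Q x v₀ v₀ ≤ Q x (‖v‖⁻¹ • v) (‖v‖⁻¹ • v) := hmin (by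
      simp [norm_smul, hn.ne'])
    simp only [map_smul, smul_apply, smul_eq_mul] at h1
    calc Q x v₀ v₀ * ‖v‖ ^ 2 ≤ (‖v‖⁻¹ * (‖v‖⁻¹ * Q x v v)) * ‖v‖ ^ 2 := by gcongr
      _ = Q x v v := by field_simp
  refine ⟨m / 2, half_pos hm, ?_⟩
  have hd : ∀ᶠ y in 𝓝[S] x, ‖Q y - Q x‖ < m / 2 := by
    have := (hQ.sub continuousWithinAt_const).norm (f := fun y => Q y - Q x)
    exact this.eventually (Iio_mem_nhds (by simpa using half_pos hm))
  filter_upwards [hd] with y hy v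
  have h1 : |(Q y - Q x) v v| ≤ ‖Q y - Q x‖ * ‖v‖ * ‖v‖ := (Q y - Q x).le_opNorm₂ v v
  have h2 : ‖Q y - Q x‖ * ‖v‖ * ‖v‖ ≤ m / 2 * ‖v‖ ^ 2 := by
    rw [mul_assoc, ← pow_two]
    gcongr
  have h3 := (abs_le.1 (h1.trans h2)).1
  have h4 := hmv v
  simp only [sub_apply] at h3
  linarith

end Slices

/-! ### The second derivative test at a maximum. -/

section LocalMax

variable {E : Type*} [NormedAddCommGroup E] [NormedSpace ℝ E]
  {H : Type*} [NormedAddCommGroup H] [NormedSpace ℝ H]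

/-- If `φ''` were positive, `x` would also be a local minimum. Then `φ` would be constant near `x`,
forcing `φ'' = 0`. -/
theorem IsLocalMax.deriv_deriv_nonpos {φ φ' : ℝ → ℝ} {φ'' x : ℝ} (h : IsLocalMax φ x)
    (h1 : ∀ᶠ s in 𝓝 x, HasDerivAt φ (φ' s) s) (h2 : HasDerivAt φ' φ'' x) : φ'' ≤ 0 := by
  by_contra hpos
  push Not at hpos
  have e1 : deriv φ =ᶠ[𝓝 x] φ' := h1.mono fun s hs => hs.deriv
  have e2 : deriv (deriv φ) x = φ'' := (h2.congr_of_eventuallyEq e1).deriv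
  have hmin : IsLocalMin φ x := isLocalMin_of_deriv_deriv_pos (by rw [e2]; exact hpos)
    h.deriv_eq_zero h1.self_of_nhds.continuousAt
  have hconst : φ =ᶠ[𝓝 x] fun _ => φ x := by
    filter_upwards [h, hmin] with s hs1 hs2 using le_antisymm hs1 hs2
  have e3 : deriv φ =ᶠ[𝓝 x] fun _ => 0 := by
    simpa using hconst.deriv
  have : φ'' = 0 := by rw [← e2, e3.deriv_eq]; simp
  linarith

theorem hasDerivAt_line {f : E → H} {f' : E →L[ℝ] H} {z e : E} {s : ℝ}
    (hf : HasFDerivAt f f' (z + s • e)) : HasDerivAt (fun s : ℝ => f (z + s • e)) (f' e) s := by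
  have hl : HasDerivAt (fun s : ℝ => z + s • e) e s := by
    simpa using ((hasDerivAt_id s).smul_const e).const_add z
  exact hf.comp_hasDerivAt s hl

/-- The second derivative test for `q(w,w)` in a direction `e`. -/
theorem second_deriv_test {q : E → H →L[ℝ] H →L[ℝ] ℝ} {w : E → H} {z : E}
    (hq : ContDiffAt ℝ ∞ q z) (hw : ContDiffAt ℝ ∞ w z)
    (hs : ∀ᶠ y in 𝓝 z, ∀ a b, q y a b = q y b a)
    (hmax : IsLocalMax (fun y => q y (w y) (w y)) z) (e : E) :
    2 * q z (w z) (fderiv ℝ (fderiv ℝ w) z e e) ≤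
      - 2 * q z (fderiv ℝ w z e) (fderiv ℝ w z e) - 4 * fderiv ℝ q z e (w z) (fderiv ℝ w z e)
        - fderiv ℝ (fderiv ℝ q) z e e (w z) (w z) := by
  have hl : ∀ s : ℝ, HasDerivAt (fun s : ℝ => z + s • e) e s := fun s => by
    simpa using ((hasDerivAt_id s).smul_const e).const_add z
  have hl0 : z + (0 : ℝ) • e = z := by simp
  have hc : Tendsto (fun s : ℝ => z + s • e) (𝓝 0) (𝓝 z) := by
    simpa using (hl 0).continuousAt.tendsto
  have hq1 : ∀ᶠ y in 𝓝 z, HasFDerivAt q (fderiv ℝ q y) y :=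
    ((hq.of_le one_le_infty).eventually (by simp)).mono fun y hy =>
      (hy.differentiableAt one_ne_zero).hasFDerivAt
  have hw1 : ∀ᶠ y in 𝓝 z, HasFDerivAt w (fderiv ℝ w y) y :=
    ((hw.of_le one_le_infty).eventually (by simp)).mono fun y hy =>
      (hy.differentiableAt one_ne_zero).hasFDerivAt
  have hq2 : HasFDerivAt (fderiv ℝ q) (fderiv ℝ (fderiv ℝ q) z) (z + (0 : ℝ) • e) := by
    rw [hl0]
    exact ((hq.fderiv_right (m := ∞) (by simp)).differentiableAt (by simp)).hasFDerivAt
  have hw2 : HasFDerivAt (fderiv ℝ w) (fderiv ℝ (fderiv ℝ w) z) (z + (0 : ℝ) • e) := by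
    rw [hl0]
    exact ((hw.fderiv_right (m := ∞) (by simp)).differentiableAt (by simp)).hasFDerivAt
  have hφ1 : ∀ᶠ s : ℝ in 𝓝 0, HasDerivAt (fun s : ℝ => q (z + s • e) (w (z + s • e)) (w (z + s • e)))
      (fderiv ℝ q (z + s • e) e (w (z + s • e)) (w (z + s • e))
        + 2 * q (z + s • e) (w (z + s • e)) (fderiv ℝ w (z + s • e) e)) s := by
    filter_upwards [hc.eventually hq1, hc.eventually hw1, hc.eventually hs] with s h1 h2 h3
    have := ((hasDerivAt_line h1).clm_apply (hasDerivAt_line h2)).clm_apply (hasDerivAt_line h2)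
    refine this.congr_deriv ?_
    rw [add_apply, h3 (fderiv ℝ w (z + s • e) e)]
    ring
  have hqz : HasFDerivAt q (fderiv ℝ q z) (z + (0 : ℝ) • e) := by
    rw [hl0]; exact hq1.self_of_nhds
  have hwz : HasFDerivAt w (fderiv ℝ w z) (z + (0 : ℝ) • e) := by
    rw [hl0]; exact hw1.self_of_nhds
  have hφ2 := ((((hasDerivAt_line hq2).clm_apply (hasDerivAt_const _ e)).clm_apply (hasDerivAt_line hwz)).clm_apply
    (hasDerivAt_line hwz)).add ((((hasDerivAt_line hqz).clm_apply (hasDerivAt_line hwz)).clm_apply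
      ((hasDerivAt_line hw2).clm_apply (hasDerivAt_const _ e))).const_mul 2)
  have hmax' : IsLocalMax (fun s : ℝ => q (z + s • e) (w (z + s • e)) (w (z + s • e))) 0 := by
    have := hc.eventually hmax
    simpa [IsLocalMax, IsMaxFilter] using this
  have hfin := hmax'.deriv_deriv_nonpos hφ1 hφ2
  simp only [hl0, map_zero, add_zero, add_apply] at hfin
  have hsz := hs.self_of_nhds
  -- Symmetry of `Dq` merges the mixed terms: one from each entry of `Dq(w, w)` and two from `2 q(w,
  -- Dw)`, which is the factor 4.
  have hsd := fderiv_symm (hq.differentiableAt (by simp)) hs e (fderiv ℝ w z e) (w z)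
  rw [hsd] at hfin
  linarith

end LocalMax

/-! ### Growth of a quadratic form of a parabolic solution at a spatial maximum. -/

section Parabolic

variable {E : Type*} [NormedAddCommGroup E] [NormedSpace ℝ E] [FiniteDimensional ℝ E]
  {H : Type*} [NormedAddCommGroup H] [NormedSpace ℝ H] [FiniteDimensional ℝ H]

theorem linearIndependent_of_orthonormal {ι : Type*} [Fintype ι] [DecidableEq ι]
    {P : E →L[ℝ] E →L[ℝ] ℝ} {e : ι → E} (h : ∀ i j, P (e i) (e j) = if i = j then 1 else 0) :
    LinearIndependent ℝ e := by
  rw [Fintype.linearIndependent_iff]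
  intro c hc i
  have h1 : P (∑ j, c j • e j) (e i) = 0 := by rw [hc]; simp
  simpa [map_sum, h] using h1

theorem exists_orthonormal_basis {P : E →L[ℝ] E →L[ℝ] ℝ} (hP : IsInner P) :
    ∃ e : Module.Basis (Fin (Module.finrank ℝ E)) ℝ E,
      ∀ i j, P (e i) (e j) = if i = j then 1 else 0 := by
  -- A constant family over a dummy real parameter.
  obtain ⟨e, -, he⟩ := exists_orthonormal_family (z := (0 : ℝ))
    (contDiffAt_const (c := P)) (Eventually.of_forall fun _ => hP) _ le_rfl
  have h0 := he.self_of_nhds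
  have hli := linearIndependent_of_orthonormal h0
  refine ⟨Module.Basis.mk hli (hli.span_eq_top_of_card_eq_finrank' (by simp)).ge, fun i j => ?_⟩
  simpa using h0 i j

/-- Completing the square: the negative term in `d`, a derivative, pays for its product with `x`,
the size of the solution. -/
theorem quadratic_bound {κ M d x : ℝ} (hκ : 0 < κ) :
    -2 * κ * d ^ 2 + M * x * d ≤ M ^ 2 / (8 * κ) * x ^ 2 := by
  have h : M ^ 2 / (8 * κ) * x ^ 2 - (-2 * κ * d ^ 2 + M * x * d)
      = 2 * κ * (d - M * x / (4 * κ)) ^ 2 := by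
    field_simp
    ring
  have : 0 ≤ 2 * κ * (d - M * x / (4 * κ)) ^ 2 := by positivity
  linarith

/-- The parabolic inequality at a spatial maximum, with explicit constants. -/
theorem parabolic_pointwise {g : E →L[ℝ] E →L[ℝ] ℝ} (hg : IsInner g)
    {q : E → H →L[ℝ] H →L[ℝ] ℝ} {w : E → H} {z : E}
    (hq : ContDiffAt ℝ ∞ q z) (hw : ContDiffAt ℝ ∞ w z)
    (hs : ∀ᶠ y in 𝓝 z, ∀ a b, q y a b = q y b a)
    (hmax : IsLocalMax (fun y => q y (w y) (w y)) z)
    {q' : H →L[ℝ] H →L[ℝ] ℝ} {w' : H} {κ κg K C : ℝ} (hκ : 0 < κ) (hκg : 0 < κg) (hC : 0 ≤ C)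
    (hκq : ∀ v, κ * ‖v‖ ^ 2 ≤ q z v v) (hgv : ∀ v, κg * ‖v‖ ^ 2 ≤ g v v)
    (hgK : ‖g‖ ≤ K) (hqK : ‖q z‖ ≤ K) (hqK1 : ‖fderiv ℝ q z‖ ≤ K)
    (hqK2 : ‖fderiv ℝ (fderiv ℝ q) z‖ ≤ K) (hq' : ‖q'‖ ≤ K)
    (hw' : ‖w' - metricTrace g (fun u v => fderiv ℝ (fderiv ℝ w) z u v)‖
      ≤ C * (‖w z‖ + ‖fderiv ℝ w z‖)) :
    q' (w z) (w z) + 2 * q z (w z) w' ≤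
      (K + 2 * K * C + Module.finrank ℝ E *
        ((4 * K * (1 / κg + 1) + 2 * K ^ 2 * C * (1 / κg + 1)) ^ 2 / (8 * κ)
          + K * (1 / κg + 1) ^ 2)) / κ * q z (w z) (w z) := by
  obtain ⟨ε, hε⟩ := exists_orthonormal_basis hg
  -- An orthonormal vector has `‖ε i‖ ^ 2 ≤ 1 / κg`; adding 1 bounds `‖ε i‖` without a square root.
  set ρ := 1 / κg + 1 with hρ
  set x := ‖w z‖ with hx
  have hK : 0 ≤ K := (norm_nonneg _).trans hgK
  have hρ0 : 0 ≤ ρ := by positivity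
  have hερ : ∀ i, ‖ε i‖ ≤ ρ := by
    intro i
    have h1 := hgv (ε i)
    rw [hε, if_pos rfl] at h1
    have h2 : ‖ε i‖ ^ 2 ≤ 1 / κg := by
      rw [le_div_iff₀ hκg]
      linarith
    nlinarith [sq_nonneg (‖ε i‖ - 1)]
  set d : Fin (Module.finrank ℝ E) → ℝ := fun i => ‖fderiv ℝ w z (ε i)‖ with hd
  -- The error term contains the full norm of `Dw`, whereas the second derivative test controls only
  -- the derivatives `d i` along the orthonormal frame. Expanding vectors in this frame compares the
  -- two.
  have hDw : ‖fderiv ℝ w z‖ ≤ ∑ i, K * ρ * d i := by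
    refine ContinuousLinearMap.opNorm_le_bound _
      (Finset.sum_nonneg fun i _ => by positivity) fun v => ?_
    have hv : v = ∑ i, g v (ε i) • ε i := by
      have h1 : ∀ i, ε.repr v i = g v (ε i) := by
        intro i
        conv_rhs => rw [← ε.sum_repr v]
        rw [map_sum, FunLike.coe_sum, Finset.sum_apply]
        simp [hε, -Module.Basis.sum_repr]
      conv_lhs => rw [← ε.sum_repr v]
      simp [h1]
    conv_lhs => rw [hv]
    rw [map_sum, Finset.sum_mul]
    refine (norm_sum_le _ _).trans (Finset.sum_le_sum fun i _ => ?_)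
    rw [map_smul, norm_smul]
    have h2 : ‖g v (ε i)‖ ≤ K * ‖v‖ * ρ := by
      refine (g.le_opNorm₂ v (ε i)).trans ?_
      gcongr
      exact hερ i
    calc ‖g v (ε i)‖ * ‖fderiv ℝ w z (ε i)‖ ≤ K * ‖v‖ * ρ * d i := by gcongr
      _ = K * ρ * d i * ‖v‖ := by ring
  set T := metricTrace g (fun u v => fderiv ℝ (fderiv ℝ w) z u v) with hT
  have hTε : T = ∑ i, fderiv ℝ (fderiv ℝ w) z (ε i) (ε i) :=
    metricTrace_eq_orthonormal ε hg hε _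
  have hterm : ∀ i, 2 * q z (w z) (fderiv ℝ (fderiv ℝ w) z (ε i) (ε i)) ≤
      -2 * κ * d i ^ 2 + 4 * K * ρ * x * d i + K * ρ ^ 2 * x ^ 2 := by
    intro i
    have h1 := second_deriv_test hq hw hs hmax (ε i)
    have h2 := hκq (fderiv ℝ w z (ε i))
    have h3 : -(fderiv ℝ q z (ε i) (w z) (fderiv ℝ w z (ε i))) ≤ K * ρ * x * d i := by
      refine (neg_le_abs _).trans ?_
      refine ((fderiv ℝ q z (ε i)).le_opNorm₂ _ _).trans ?_
      have := ((fderiv ℝ q z).le_opNorm (ε i)).trans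
        (mul_le_mul hqK1 (hερ i) (norm_nonneg _) hK)
      gcongr
    have h4 : -(fderiv ℝ (fderiv ℝ q) z (ε i) (ε i) (w z) (w z)) ≤ K * ρ ^ 2 * x ^ 2 := by
      refine (neg_le_abs _).trans ?_
      refine ((fderiv ℝ (fderiv ℝ q) z (ε i) (ε i)).le_opNorm₂ _ _).trans ?_
      have h5 : ‖fderiv ℝ (fderiv ℝ q) z (ε i) (ε i)‖ ≤ K * ρ * ρ := by
        refine ((fderiv ℝ (fderiv ℝ q) z).le_opNorm₂ _ _).trans ?_
        have := hερ i
        gcongr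
      calc ‖fderiv ℝ (fderiv ℝ q) z (ε i) (ε i)‖ * ‖w z‖ * ‖w z‖ ≤ K * ρ * ρ * x * x := by gcongr
        _ = K * ρ ^ 2 * x ^ 2 := by ring
    simp only [hd] at *
    linarith
  have hsum : 2 * q z (w z) T ≤
      ∑ i, (-2 * κ * d i ^ 2 + 4 * K * ρ * x * d i + K * ρ ^ 2 * x ^ 2) := by
    rw [hTε, map_sum, Finset.mul_sum]
    exact Finset.sum_le_sum fun i _ => hterm i
  have herr : 2 * q z (w z) (w' - T) ≤ 2 * K * C * x ^ 2 + ∑ i, 2 * K ^ 2 * C * ρ * x * d i := by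
    have h1 : q z (w z) (w' - T) ≤ K * x * (C * (x + ∑ i, K * ρ * d i)) := by
      refine (le_abs_self _).trans (((q z).le_opNorm₂ _ _).trans ?_)
      have h2 : ‖w' - T‖ ≤ C * (x + ∑ i, K * ρ * d i) := hw'.trans (by gcongr)
      gcongr
    have h3 : 2 * (K * x * (C * (x + ∑ i, K * ρ * d i)))
        = 2 * K * C * x ^ 2 + ∑ i, 2 * K ^ 2 * C * ρ * x * d i := by
      rw [mul_add, mul_add, mul_add, Finset.mul_sum, Finset.mul_sum, Finset.mul_sum]
      congr 1
      · ring
      · exact Finset.sum_congr rfl fun i _ => by ring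
    linarith
  have hq'x : q' (w z) (w z) ≤ K * x ^ 2 := by
    refine (le_abs_self _).trans ((q'.le_opNorm₂ _ _).trans ?_)
    rw [mul_assoc, ← pow_two]
    gcongr
  have hsplit : q z (w z) w' = q z (w z) T + q z (w z) (w' - T) := by
    rw [← map_add, add_sub_cancel]
  -- All terms linear in `d i`, from the test and from the error, are absorbed at once by `-2 * κ *
  -- d i ^ 2`.
  have hfin : ∑ i, (-2 * κ * d i ^ 2 + 4 * K * ρ * x * d i + K * ρ ^ 2 * x ^ 2)
      + ∑ i, 2 * K ^ 2 * C * ρ * x * d i ≤ Module.finrank ℝ E *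
        ((4 * K * ρ + 2 * K ^ 2 * C * ρ) ^ 2 / (8 * κ) + K * ρ ^ 2) * x ^ 2 := by
    rw [← Finset.sum_add_distrib]
    have h1 : ∀ i, -2 * κ * d i ^ 2 + 4 * K * ρ * x * d i + K * ρ ^ 2 * x ^ 2
        + 2 * K ^ 2 * C * ρ * x * d i
        ≤ ((4 * K * ρ + 2 * K ^ 2 * C * ρ) ^ 2 / (8 * κ) + K * ρ ^ 2) * x ^ 2 := by
      intro i
      have := quadratic_bound (M := 4 * K * ρ + 2 * K ^ 2 * C * ρ) (d := d i) (x := x) hκ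
      linarith
    refine (Finset.sum_le_sum fun i _ => h1 i).trans ?_
    simp [mul_assoc]
  have hx2 : x ^ 2 ≤ q z (w z) (w z) / κ := by
    rw [le_div_iff₀ hκ, mul_comm]
    exact hκq _
  set N := K + 2 * K * C + Module.finrank ℝ E *
        ((4 * K * ρ + 2 * K ^ 2 * C * ρ) ^ 2 / (8 * κ) + K * ρ ^ 2) with hN
  have hN0 : 0 ≤ N := by positivity
  calc q' (w z) (w z) + 2 * q z (w z) w' ≤ N * x ^ 2 := by
        rw [hsplit, hN]
        linarith
    _ ≤ N * (q z (w z) (w z) / κ) := by gcongr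
    _ = N / κ * q z (w z) (w z) := by ring

/-- If `W` solves a linear parabolic system up to lower order terms, then at a spatial maximum of
`Q(W,W)` its time derivative is bounded by a locally uniform multiple of `Q(W,W)`. -/
theorem exists_parabolic_bound {J : Set ℝ} {U : Set E} (hJ : UniqueDiffOn ℝ J) (hU : IsOpen U)
    {g : E → E →L[ℝ] E →L[ℝ] ℝ} (hg : ContinuousOn g U) (hgI : ∀ z ∈ U, IsInner (g z))
    {Q : ℝ × E → H →L[ℝ] H →L[ℝ] ℝ} (hQ : ContDiffOn ℝ ∞ Q (J ×ˢ U))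
    (hQI : ∀ q ∈ J ×ˢ U, IsInner (Q q)) {W : ℝ × E → H} (hW : ContDiffOn ℝ ∞ W (J ×ˢ U))
    {q₀ : ℝ × E} (hq₀ : q₀ ∈ J ×ˢ U)
    (hev : ∃ C, ∀ᶠ q in 𝓝[J ×ˢ U] q₀, ‖timeDeriv J W q -
        metricTrace (g q.2) (fun u v => spaceDeriv (spaceDeriv W) q u v)‖
      ≤ C * (‖W q‖ + ‖spaceDeriv W q‖)) :
    ∃ C, ∀ᶠ q in 𝓝[J ×ˢ U] q₀,
      IsLocalMax (fun y => Q (q.1, y) (W (q.1, y)) (W (q.1, y))) q.2 →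
      timeDeriv J (fun q => Q q (W q) (W q)) q ≤ C * Q q (W q) (W q) := by
  obtain ⟨C, hC⟩ := hev
  have hgc : ContinuousWithinAt (fun q : ℝ × E => g q.2) (J ×ˢ U) q₀ :=
    (hg q₀.2 hq₀.2).comp continuousWithinAt_snd fun q hq => hq.2
  have hQ1 := hQ.spaceDeriv hJ hU
  have hQ2 := hQ1.spaceDeriv hJ hU
  have hQt := hQ.timeDeriv hJ hU
  obtain ⟨κ, hκ, hκe⟩ := exists_eventually_coercive (hQ.continuousOn q₀ hq₀) (hQI q₀ hq₀)
  obtain ⟨κg, hκg, hκge⟩ := exists_eventually_coercive hgc (hgI q₀.2 hq₀.2)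
  obtain ⟨K0, hK0⟩ := exists_eventually_norm_le hgc
  obtain ⟨K1, hK1⟩ := exists_eventually_norm_le (hQ.continuousOn q₀ hq₀)
  obtain ⟨K2, hK2⟩ := exists_eventually_norm_le (hQ1.continuousOn q₀ hq₀)
  obtain ⟨K3, hK3⟩ := exists_eventually_norm_le (hQ2.continuousOn q₀ hq₀)
  obtain ⟨K4, hK4⟩ := exists_eventually_norm_le (hQt.continuousOn q₀ hq₀)
  set K := max K0 (max K1 (max K2 (max K3 K4))) with hK
  refine ⟨(K + 2 * K * max C 0 + Module.finrank ℝ E *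
        ((4 * K * (1 / κg + 1) + 2 * K ^ 2 * max C 0 * (1 / κg + 1)) ^ 2 / (8 * κ)
          + K * (1 / κg + 1) ^ 2)) / κ, ?_⟩
  filter_upwards [hC, hκe, hκge, hK0, hK1, hK2, hK3, hK4, self_mem_nhdsWithin]
    with q hCq hκq hκgq h0 h1 h2 h3 h4 hq hmax
  have hsl := hasDerivWithinAt_slice hQ hq
  have hwl := hasDerivWithinAt_slice hW hq
  have ht := ((hsl.clm_apply hwl).clm_apply hwl).derivWithin (hJ q.1 hq.1)
  have ht' : timeDeriv J (fun q => Q q (W q) (W q)) q =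
      timeDeriv J Q q (W q) (W q) + 2 * Q q (W q) (timeDeriv J W q) := by
    rw [timeDeriv_eq hJ hQ hq, timeDeriv_eq hJ hW hq]
    refine ht.trans ?_
    rw [add_apply, (hQI q hq).symm _ (W (q.1, q.2))]
    ring
  rw [ht']
  have hCq' : ‖timeDeriv J W q -
        metricTrace (g q.2) (fun u v => spaceDeriv (spaceDeriv W) q u v)‖
      ≤ max C 0 * (‖W q‖ + ‖spaceDeriv W q‖) :=
    hCq.trans (mul_le_mul_of_nonneg_right (le_max_left _ _) (by positivity))
  refine parabolic_pointwise (hgI q.2 hq.2) (hQ.slice hU hq) (hW.slice hU hq) ?_ hmax hκ hκg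
    (le_max_right C 0) hκq hκgq (K := K) (h0.trans ?_) (h1.trans ?_) (h2.trans ?_) (h3.trans ?_)
    (h4.trans ?_) hCq'
  · filter_upwards [hU.mem_nhds hq.2] with y hy
    exact (hQI (q.1, y) ⟨hq.1, hy⟩).symm
  all_goals simp [hK]

end Parabolic

/-! ### Differentiating the tension along the leaves. -/

section Evolution

variable {A : Type*} [NormedAddCommGroup A] [NormedSpace ℝ A]
  {B : Type*} [NormedAddCommGroup B] [NormedSpace ℝ B]
  {V : Type*} [NormedAddCommGroup V] [NormedSpace ℝ V]

/-- The part of the derivative of `f` along the first factor. -/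
def leafDeriv (f : A × B → V) (z : A × B) : A →L[ℝ] V :=
  ContinuousLinearMap.precomp V (ContinuousLinearMap.inl ℝ A B) (fderiv ℝ f z)

theorem leafDeriv_apply (f : A × B → V) (z : A × B) (a : A) :
    leafDeriv f z a = fderiv ℝ f z (a, 0) := rfl

variable {f : A × B → V} {z : A × B}

theorem fderiv_leafDeriv (hf : ContDiffAt ℝ ∞ f z) (u : A × B) (a : A) :
    fderiv ℝ (leafDeriv f) z u a = fderiv ℝ (fderiv ℝ f) z u (a, 0) := by
  have h : HasFDerivAt (fderiv ℝ f) (fderiv ℝ (fderiv ℝ f) z) z :=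
    ((hf.fderiv_right (m := ∞) (by simp)).differentiableAt (by simp)).hasFDerivAt
  have := ((ContinuousLinearMap.precomp V (ContinuousLinearMap.inl ℝ A B)).hasFDerivAt.comp z h)
  change fderiv ℝ ((ContinuousLinearMap.precomp V (ContinuousLinearMap.inl ℝ A B)) ∘ fderiv ℝ f) z
    u a = _
  rw [this.fderiv]
  rfl

theorem fderiv_fderiv_leafDeriv (hf : ContDiffAt ℝ ∞ f z) (u v : A × B) (a : A) :
    fderiv ℝ (fderiv ℝ (leafDeriv f)) z u v a
      = fderiv ℝ (fderiv ℝ (fderiv ℝ f)) z u v (a, 0) := by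
  have hd : ContDiffAt ℝ ∞ (fderiv ℝ f) z := hf.fderiv_right (by simp)
  have hev : fderiv ℝ (leafDeriv f) =ᶠ[𝓝 z] fun y =>
      (ContinuousLinearMap.precomp V (ContinuousLinearMap.inl ℝ A B)).comp
        (fderiv ℝ (fderiv ℝ f) y) := by
    filter_upwards [(hd.of_le one_le_infty).eventually (by simp)] with y hy
    exact ((ContinuousLinearMap.precomp V (ContinuousLinearMap.inl ℝ A B)).hasFDerivAt.comp y
      (hy.differentiableAt one_ne_zero).hasFDerivAt).fderiv
  have h2 : HasFDerivAt (fderiv ℝ (fderiv ℝ f)) (fderiv ℝ (fderiv ℝ (fderiv ℝ f)) z) z :=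
    ((hd.fderiv_right (m := ∞) (by simp)).differentiableAt (by simp)).hasFDerivAt
  rw [hev.fderiv_eq, ((hasFDerivAt_const (ContinuousLinearMap.precomp V
    (ContinuousLinearMap.inl ℝ A B)) z).clm_comp h2).fderiv]
  simp

/-- Moving the direction `x` to the last slot turns a leafwise derivative of `D²f` into a second
derivative of `leafDeriv f`. -/
theorem third_deriv_symm (hf : ContDiffAt ℝ ∞ f z) (x u v : A × B) :
    fderiv ℝ (fderiv ℝ (fderiv ℝ f)) z x u v = fderiv ℝ (fderiv ℝ (fderiv ℝ f)) z u v x := by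
  have hd : ContDiffAt ℝ ∞ (fderiv ℝ f) z := hf.fderiv_right (by simp)
  have hdd : ContDiffAt ℝ ∞ (fderiv ℝ (fderiv ℝ f)) z := hd.fderiv_right (by simp)
  have h1 := (hd.isSymmSndFDerivAt (by simpa using two_le_infty)).eq x u
  rw [h1]
  refine fderiv_symm (hdd.differentiableAt (by simp)) ?_ u x v
  filter_upwards [(hf.of_le two_le_infty).eventually (by simp)] with y hy
  exact fun u v => (hy.isSymmSndFDerivAt (by simp)).eq u v

/-- The derivative along the first factor of the tension of `f` agrees with the trace of the
second derivative of the leafwise derivative, up to terms linear in the leafwise derivative and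
its first derivative. -/
theorem norm_fderiv_tension_sub_le {ι : Type*} [Fintype ι] (hf : ContDiffAt ℝ ∞ f z)
    {Γ : V → V →L[ℝ] V →L[ℝ] V} (hΓ : DifferentiableAt ℝ Γ (f z))
    {e : ι → A × B} {N : ι → A × B → A × B} (hN : ∀ i, DifferentiableAt ℝ (N i) z)
    {R : A × B → A × B} (hR : DifferentiableAt ℝ R z)
    (hN' : ∀ i, (e i).2 = 0 ∨ ∀ a : A, (fderiv ℝ (N i) z (a, 0)).2 = 0)
    (hR' : ∀ a : A, (fderiv ℝ R z (a, 0)).2 = 0) {K : ℝ} (hK : 1 ≤ K)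
    (he : ∀ i, ‖e i‖ ≤ K) (hNK : ∀ i, ‖N i z‖ ≤ K) (hNK' : ∀ i, ‖fderiv ℝ (N i) z‖ ≤ K)
    (hRK : ‖R z‖ ≤ K) (hRK' : ‖fderiv ℝ R z‖ ≤ K) (hfK : ‖fderiv ℝ f z‖ ≤ K)
    (hΓK : ‖Γ (f z)‖ ≤ K) (hΓK' : ‖fderiv ℝ Γ (f z)‖ ≤ K) (a : A) :
    ‖fderiv ℝ (fun y => ∑ i, (fderiv ℝ (fderiv ℝ f) y (e i) (N i y)
          + Γ (f y) (fderiv ℝ f y (e i)) (fderiv ℝ f y (N i y))) - fderiv ℝ f y (R y)) z (a, 0)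
        - ∑ i, fderiv ℝ (fderiv ℝ (leafDeriv f)) z (e i) (N i z) a‖ ≤
      (5 * Fintype.card ι + 2) * K ^ 5 * (‖leafDeriv f z‖ + ‖fderiv ℝ (leafDeriv f) z‖) * ‖a‖ := by
  have hd : ContDiffAt ℝ ∞ (fderiv ℝ f) z := hf.fderiv_right (by simp)
  have hdd : ContDiffAt ℝ ∞ (fderiv ℝ (fderiv ℝ f)) z := hd.fderiv_right (by simp)
  have h0 : HasFDerivAt f (fderiv ℝ f z) z := (hf.differentiableAt (by simp)).hasFDerivAt
  have h1 : HasFDerivAt (fderiv ℝ f) (fderiv ℝ (fderiv ℝ f) z) z :=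
    (hd.differentiableAt (by simp)).hasFDerivAt
  have h2 : HasFDerivAt (fderiv ℝ (fderiv ℝ f)) (fderiv ℝ (fderiv ℝ (fderiv ℝ f)) z) z :=
    (hdd.differentiableAt (by simp)).hasFDerivAt
  -- By the product rule, the terms with `D³f` form the subtracted trace. The others, bounded in
  -- `t1` to `t7`, each contain `Df` or `D²f` with a leaf vector as an argument, hence are
  -- controlled by `leafDeriv f` and its derivative.
  have hsum := HasFDerivAt.fun_sum (u := Finset.univ) fun i _ =>
    (((h2.clm_apply (hasFDerivAt_const (e i) z)).clm_apply (hN i).hasFDerivAt).add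
      (((hΓ.hasFDerivAt.comp z h0).clm_apply (h1.clm_apply (hasFDerivAt_const (e i) z))).clm_apply
        (h1.clm_apply (hN i).hasFDerivAt)))
  have htot := hsum.sub (h1.clm_apply hR.hasFDerivAt)
  have hfd := htot.fderiv
  simp only [Function.comp_apply] at hfd
  rw [show (fun y => ∑ i, (fderiv ℝ (fderiv ℝ f) y (e i) (N i y)
          + Γ (f y) (fderiv ℝ f y (e i)) (fderiv ℝ f y (N i y))) - fderiv ℝ f y (R y)) =
      ((fun y => ∑ i, (fderiv ℝ (fderiv ℝ f) y (e i) (N i y)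
          + Γ (f y) (fderiv ℝ f y (e i)) (fderiv ℝ f y (N i y)))) - fun y => fderiv ℝ f y (R y))
      from rfl]
  erw [hfd]
  clear hfd htot hsum
  set x : A × B := (a, 0) with hx
  have hxn : ‖x‖ = ‖a‖ := by simp [hx, Prod.norm_def]
  have s1 : ∀ u v, fderiv ℝ (fderiv ℝ f) z u v = fderiv ℝ (fderiv ℝ f) z v u := fun u v =>
    (hf.isSymmSndFDerivAt (by simpa using two_le_infty)).eq u v
  set w := ‖leafDeriv f z‖ with hw
  set w' := ‖fderiv ℝ (leafDeriv f) z‖ with hw'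
  have hw0 : 0 ≤ w := norm_nonneg _
  have hw'0 : 0 ≤ w' := norm_nonneg _
  have hK0 : 0 ≤ K := zero_le_one.trans hK
  have s2 : ∀ (u y : A × B), y.2 = 0 → ‖fderiv ℝ (fderiv ℝ f) z u y‖ ≤ w' * ‖u‖ * ‖y‖ := by
    rintro u ⟨y, y'⟩ rfl
    rw [← fderiv_leafDeriv hf]
    refine ((fderiv ℝ (leafDeriv f) z).le_opNorm₂ u y).trans ?_
    simp [Prod.norm_def, hw']
  have s3 : ∀ y : A × B, y.2 = 0 → ‖fderiv ℝ f z y‖ ≤ w * ‖y‖ := by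
    rintro ⟨y, y'⟩ rfl
    rw [← leafDeriv_apply]
    refine ((leafDeriv f z).le_opNorm y).trans ?_
    simp [Prod.norm_def, hw]
  have s4 : ∀ y : A × B, ‖fderiv ℝ f z y‖ ≤ K * ‖y‖ := fun y =>
    ((fderiv ℝ f z).le_opNorm y).trans (by gcongr)
  have s5 : ∀ u v : V, ‖Γ (f z) u v‖ ≤ K * ‖u‖ * ‖v‖ := fun u v =>
    ((Γ (f z)).le_opNorm₂ u v).trans (by gcongr)
  have s6 : ∀ i, ‖fderiv ℝ (N i) z x‖ ≤ K * ‖a‖ := fun i =>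
    ((fderiv ℝ (N i) z).le_opNorm x).trans (by rw [hxn]; gcongr; exact hNK' i)
  have s7 : ‖fderiv ℝ R z x‖ ≤ K * ‖a‖ :=
    ((fderiv ℝ R z).le_opNorm x).trans (by rw [hxn]; gcongr)
  -- A common bound: `K ≥ 1` allows every power of `K` to be raised to the fifth, reached in `t2`.
  -- Five such terms occur for each index and two more come from `R`, whence `5 * Fintype.card ι +
  -- 2`.
  set T := K ^ 5 * (w + w') * ‖a‖ with hT
  have hp1 : K ≤ K ^ 5 := le_self_pow₀ hK (by norm_num)
  have hp2 : K ^ 2 ≤ K ^ 5 := pow_le_pow_right₀ hK (by norm_num)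
  have hp4 : K ^ 4 ≤ K ^ 5 := pow_le_pow_right₀ hK (by norm_num)
  have hTw : ∀ {k : ℝ}, k ≤ K ^ 5 → k * w * ‖a‖ ≤ T := by
    intro k hk
    have : K ^ 5 * w ≤ K ^ 5 * (w + w') := by gcongr; linarith
    exact mul_le_mul_of_nonneg_right ((mul_le_mul_of_nonneg_right hk hw0).trans this)
      (norm_nonneg a)
  have hTw' : ∀ {k : ℝ}, k ≤ K ^ 5 → k * w' * ‖a‖ ≤ T := by
    intro k hk
    have : K ^ 5 * w' ≤ K ^ 5 * (w + w') := by gcongr; linarith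
    exact mul_le_mul_of_nonneg_right ((mul_le_mul_of_nonneg_right hk hw'0).trans this)
      (norm_nonneg a)
  -- Here a purely transverse second derivative of `f` could appear. The alternative `hN'` puts a
  -- leaf vector in one of the two slots; `t5` uses it in the same way, while `hR'` does this for
  -- `R` in `t7`.
  have t1 : ∀ i, ‖fderiv ℝ (fderiv ℝ f) z (e i) (fderiv ℝ (N i) z x)‖ ≤ T := by
    intro i
    refine le_trans ?_ (hTw' hp2)
    rcases hN' i with h | h
    · rw [s1]
      calc _ ≤ w' * ‖fderiv ℝ (N i) z x‖ * ‖e i‖ := s2 _ _ h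
        _ ≤ w' * (K * ‖a‖) * K := by gcongr; exacts [s6 i, he i]
        _ = K ^ 2 * w' * ‖a‖ := by ring
    · calc _ ≤ w' * ‖e i‖ * ‖fderiv ℝ (N i) z x‖ := s2 _ _ (h a)
        _ ≤ w' * K * (K * ‖a‖) := by gcongr; exacts [he i, s6 i]
        _ = K ^ 2 * w' * ‖a‖ := by ring
  have t2 : ∀ i, ‖fderiv ℝ Γ (f z) (fderiv ℝ f z x) (fderiv ℝ f z (e i)) (fderiv ℝ f z (N i z))‖
      ≤ T := by
    intro i
    refine le_trans ?_ (hTw (le_refl (K ^ 5)))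
    refine (ContinuousLinearMap.le_opNorm₂ _ _ _).trans ?_
    have h3 : ‖fderiv ℝ Γ (f z) (fderiv ℝ f z x)‖ ≤ K * (w * ‖a‖) := by
      refine ((fderiv ℝ Γ (f z)).le_opNorm _).trans ?_
      have := s3 x rfl
      rw [hxn] at this
      gcongr
    calc _ ≤ K * (w * ‖a‖) * (K * K) * (K * K) := by
          gcongr
          · exact (s4 _).trans (by gcongr; exact he i)
          · exact (s4 _).trans (by gcongr; exact hNK i)
      _ = K ^ 5 * w * ‖a‖ := by ring
  have t3 : ∀ i, ‖Γ (f z) (fderiv ℝ (fderiv ℝ f) z x (e i)) (fderiv ℝ f z (N i z))‖ ≤ T := by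
    intro i
    refine le_trans ?_ (hTw' hp4)
    have h3 : ‖fderiv ℝ (fderiv ℝ f) z x (e i)‖ ≤ w' * K * ‖a‖ := by
      rw [s1, ← hxn]
      exact (s2 _ x rfl).trans (by gcongr; exact he i)
    calc _ ≤ K * (w' * K * ‖a‖) * (K * K) := by
          refine (s5 _ _).trans ?_
          gcongr
          exact (s4 _).trans (by gcongr; exact hNK i)
      _ = K ^ 4 * w' * ‖a‖ := by ring
  have t4 : ∀ i, ‖Γ (f z) (fderiv ℝ f z (e i)) (fderiv ℝ (fderiv ℝ f) z x (N i z))‖ ≤ T := by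
    intro i
    refine le_trans ?_ (hTw' hp4)
    have h3 : ‖fderiv ℝ (fderiv ℝ f) z x (N i z)‖ ≤ w' * K * ‖a‖ := by
      rw [s1, ← hxn]
      exact (s2 _ x rfl).trans (by gcongr; exact hNK i)
    calc _ ≤ K * (K * K) * (w' * K * ‖a‖) := by
          refine (s5 _ _).trans ?_
          gcongr
          exact (s4 _).trans (by gcongr; exact he i)
      _ = K ^ 4 * w' * ‖a‖ := by ring
  have t5 : ∀ i, ‖Γ (f z) (fderiv ℝ f z (e i)) (fderiv ℝ f z (fderiv ℝ (N i) z x))‖ ≤ T := by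
    intro i
    refine le_trans ?_ (hTw hp4)
    rcases hN' i with h | h
    · calc _ ≤ K * (w * K) * (K * (K * ‖a‖)) := by
            refine (s5 _ _).trans ?_
            gcongr
            · exact (s3 _ h).trans (by gcongr; exact he i)
            · exact (s4 _).trans (by gcongr; exact s6 i)
        _ = K ^ 4 * w * ‖a‖ := by ring
    · calc _ ≤ K * (K * K) * (w * (K * ‖a‖)) := by
            refine (s5 _ _).trans ?_
            gcongr
            · exact (s4 _).trans (by gcongr; exact he i)
            · exact (s3 _ (h a)).trans (by gcongr; exact s6 i)
        _ = K ^ 4 * w * ‖a‖ := by ring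
  have t6 : ‖fderiv ℝ (fderiv ℝ f) z x (R z)‖ ≤ T := by
    refine le_trans ?_ (hTw' hp1)
    rw [s1]
    refine (s2 _ x rfl).trans ?_
    rw [hxn]
    calc w' * ‖R z‖ * ‖a‖ ≤ w' * K * ‖a‖ := by gcongr
      _ = K * w' * ‖a‖ := by ring
  have t7 : ‖fderiv ℝ f z (fderiv ℝ R z x)‖ ≤ T := by
    refine le_trans ?_ (hTw hp1)
    calc _ ≤ w * (K * ‖a‖) := (s3 _ (hR' a)).trans (by gcongr)
      _ = K * w * ‖a‖ := by ring
  simp only [sub_apply, FunLike.coe_sum, Finset.sum_apply, add_apply,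
    ContinuousLinearMap.coe_comp, Function.comp_apply, ContinuousLinearMap.flip_apply,
    zero_apply, map_zero, zero_add]
  simp only [fderiv_fderiv_leafDeriv hf, ← hx, third_deriv_symm hf x]
  have hnn : ∀ i ∈ (Finset.univ : Finset ι),
      ‖fderiv ℝ (fderiv ℝ f) z (e i) (fderiv ℝ (N i) z x)
        + fderiv ℝ Γ (f z) (fderiv ℝ f z x) (fderiv ℝ f z (e i)) (fderiv ℝ f z (N i z))
        + Γ (f z) (fderiv ℝ (fderiv ℝ f) z x (e i)) (fderiv ℝ f z (N i z))
        + Γ (f z) (fderiv ℝ f z (e i)) (fderiv ℝ (fderiv ℝ f) z x (N i z))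
        + Γ (f z) (fderiv ℝ f z (e i)) (fderiv ℝ f z (fderiv ℝ (N i) z x))‖ ≤ 5 * T := by
    intro i _
    refine (norm_add_le_of_le (norm_add_le_of_le (norm_add_le_of_le (norm_add_le_of_le (t1 i) (t2 i))
      (t3 i)) (t4 i)) (t5 i)).trans (le_of_eq (by ring))
  have hS := norm_sum_le_of_le _ hnn
  have hfinal := norm_sub_le_of_le hS (norm_add_le_of_le t6 t7)
  refine le_trans (le_of_eq ?_) (hfinal.trans (le_of_eq ?_))
  · congr 1
    rw [sub_right_comm, ← Finset.sum_sub_distrib]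
    congr 1
    · refine Finset.sum_congr rfl fun i _ => ?_
      simp only [map_add]
      abel
    · abel
  · rw [Finset.sum_const, Finset.card_univ, nsmul_eq_mul, hT]
    ring

end Evolution

/-! ### The heat flow in a foliated chart and its leafwise energy. -/

section FlatHeatFlow

variable {A : Type*} [NormedAddCommGroup A] [NormedSpace ℝ A] [FiniteDimensional ℝ A]
  {B : Type*} [NormedAddCommGroup B] [NormedSpace ℝ B] [FiniteDimensional ℝ B]
  {V : Type*} [NormedAddCommGroup V] [NormedSpace ℝ V] [FiniteDimensional ℝ V]

/-- A metric on an open subset of `A × B` for which the inverse metric on forms of `B` and the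
transverse part of the trace of the Christoffel symbols do not vary along `A`. -/
structure IsTenseMetricOn (g : A × B → A × B →L[ℝ] A × B →L[ℝ] ℝ) (U : Set (A × B)) : Prop where
  contDiffOn : ContDiffOn ℝ ∞ g U
  isInner : ∀ z ∈ U, IsInner (g z)
  inverse_snd : ∀ z ∈ U, ∀ (β : B →L[ℝ] ℝ) (a : A),
    (fderiv ℝ (fun y => (g y).inverse (β.comp (ContinuousLinearMap.snd ℝ A B))) z (a, 0)).2 = 0
  trace_snd : ∀ z ∈ U, ∀ a : A,
    (fderiv ℝ (fun y => metricTrace (g y) fun u v => levi g y u v) z (a, 0)).2 = 0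

/-- The derivative along `A` of a function of time and space. -/
def leafSpaceDeriv (F : ℝ × (A × B) → V) (q : ℝ × (A × B)) : A →L[ℝ] V :=
  ContinuousLinearMap.precomp V (ContinuousLinearMap.inl ℝ A B) (spaceDeriv F q)

theorem IsInner.contDiffAt_inverse {E C : Type*} [NormedAddCommGroup E] [NormedSpace ℝ E]
    [NormedAddCommGroup C] [NormedSpace ℝ C] [FiniteDimensional ℝ C]
    {g : E → C →L[ℝ] C →L[ℝ] ℝ} {z : E}
    (hg : ContDiffAt ℝ ∞ g z) (hz : IsInner (g z)) : ContDiffAt ℝ ∞ (fun y => (g y).inverse) z := by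
  obtain ⟨e, he⟩ := hz.isInvertible
  have := contDiffAt_map_inverse (𝕜 := ℝ) (n := ∞) e
  rw [he] at this
  exact this.comp z hg

/-- With `e` a basis adapted to `A × B` and `N i` the metric duals of its coordinates, the tension
has the form treated in `norm_fderiv_tension_sub_le`. Continuity bounds all coefficients by one `K`
near `q₀`. -/
theorem exists_evolution_bound {J : Set ℝ} {U : Set (A × B)} (hJ : UniqueDiffOn ℝ J)
    (hJ' : J ⊆ closure (interior J)) (hU : IsOpen U)
    {g : A × B → A × B →L[ℝ] A × B →L[ℝ] ℝ} (hg : IsTenseMetricOn g U)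
    {h : V → V →L[ℝ] V →L[ℝ] ℝ} {O : Set V} (hO : IsOpen O) (hh : ContDiffOn ℝ ∞ h O)
    (hhI : ∀ y ∈ O, IsInner (h y))
    {F : ℝ × (A × B) → V} (hF : ContDiffOn ℝ ∞ F (J ×ˢ U)) (hFO : ∀ q ∈ J ×ˢ U, F q ∈ O)
    (hev : ∀ q ∈ J ×ˢ U, timeDeriv J F q =
      metricTrace (g q.2) fun u v => hess g h (fun y => F (q.1, y)) q.2 u v)
    {q₀ : ℝ × (A × B)} (hq₀ : q₀ ∈ J ×ˢ U) :
    ∃ C, ∀ᶠ q in 𝓝[J ×ˢ U] q₀, ‖timeDeriv J (leafSpaceDeriv F) q -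
        metricTrace (g q.2) (fun u v => spaceDeriv (spaceDeriv (leafSpaceDeriv F)) q u v)‖
      ≤ C * (‖leafSpaceDeriv F q‖ + ‖spaceDeriv (leafSpaceDeriv F) q‖) := by
  set e := (Module.finBasis ℝ A).prod (Module.finBasis ℝ B) with he
  set N : _ → A × B → A × B := fun i y => (g y).inverse (coordL e i) with hN
  set R : A × B → A × B := fun y => metricTrace (g y) fun u v => levi g y u v with hR
  have hgat : ∀ z ∈ U, ContDiffAt ℝ ∞ g z := fun z hz => hg.contDiffOn.contDiffAt (hU.mem_nhds hz)
  have hNs : ∀ i, ∀ z ∈ U, ContDiffAt ℝ ∞ (N i) z := fun i z hz =>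
    ((hg.isInner z hz).contDiffAt_inverse (hgat z hz)).clm_apply contDiffAt_const
  have hRs : ∀ z ∈ U, ContDiffAt ℝ ∞ R z := fun z hz =>
    ContDiffAt.metricTrace (hgat z hz) (hg.isInner z hz) (ContDiffAt.levi (hgat z hz) (hg.isInner z hz))
  have hΓs : ∀ y ∈ O, ContDiffAt ℝ ∞ (levi h) y := fun y hy =>
    ContDiffAt.levi (hh.contDiffAt (hO.mem_nhds hy)) (hhI y hy)
  -- A basis vector from `A` has no transverse part. The coordinate form of one from `B` factors
  -- through the projection to `B`, so the transverse part of its dual vector does not vary along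
  -- the leaves.
  have hN' : ∀ z ∈ U, ∀ i, (e i).2 = 0 ∨ ∀ a : A, (fderiv ℝ (N i) z (a, 0)).2 = 0 := by
    rintro z hz (i | j)
    · left; simp [he]
    · right
      intro a
      have hc : coordL e (Sum.inr j)
          = (coordL (Module.finBasis ℝ B) j).comp (ContinuousLinearMap.snd ℝ A B) := by
        ext <;> simp [he]
      simp only [hN, hc]
      exact hg.inverse_snd z hz _ a
  have hq₂ := hq₀.2
  have hF₀ := hFO q₀ hq₀
  have cw : ∀ {X : Type _} [NormedAddCommGroup X] [NormedSpace ℝ X] {k : A × B → X},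
      ContDiffAt ℝ ∞ k q₀.2 →
      ContinuousWithinAt (fun q : ℝ × (A × B) => k q.2) (J ×ˢ U) q₀ := fun hk =>
    (hk.continuousAt.comp (x := q₀) continuousAt_snd).continuousWithinAt
  have cF := hF.continuousOn q₀ hq₀
  obtain ⟨K1, hK1⟩ := exists_eventually_norm_le (f := fun q : ℝ × (A × B) => fun i => N i q.2)
    (continuousWithinAt_pi.2 fun i => cw (hNs i _ hq₂))
  obtain ⟨K2, hK2⟩ := exists_eventually_norm_le
    (f := fun q : ℝ × (A × B) => fun i => fderiv ℝ (N i) q.2)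
    (continuousWithinAt_pi.2 fun i => ((((hNs i _ hq₂).fderiv_right (m := ∞)
      (by simp)).continuousAt.comp (x := q₀) continuousAt_snd).continuousWithinAt))
  obtain ⟨K3, hK3⟩ := exists_eventually_norm_le (cw (hRs _ hq₂))
  obtain ⟨K4, hK4⟩ := exists_eventually_norm_le
    (f := fun q : ℝ × (A × B) => fderiv ℝ R q.2) ((((hRs _ hq₂).fderiv_right (m := ∞)
      (by simp)).continuousAt.comp (x := q₀) continuousAt_snd).continuousWithinAt)
  obtain ⟨K5, hK5⟩ := exists_eventually_norm_le ((hF.spaceDeriv hJ hU).continuousOn q₀ hq₀)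
  obtain ⟨K6, hK6⟩ := exists_eventually_norm_le (f := fun q => levi h (F q))
    ((hΓs _ hF₀).continuousAt.comp_continuousWithinAt cF)
  obtain ⟨K7, hK7⟩ := exists_eventually_norm_le (f := fun q => fderiv ℝ (levi h) (F q))
    (((hΓs _ hF₀).fderiv_right (m := ∞) (by simp)).continuousAt.comp_continuousWithinAt cF)
  set K := max 1 (max ‖fun i => e i‖ (max K1 (max K2 (max K3 (max K4 (max K5 (max K6 K7)))))))
    with hK
  refine ⟨(5 * Fintype.card (Fin (Module.finrank ℝ A) ⊕ Fin (Module.finrank ℝ B)) + 2) * K ^ 5, ?_⟩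
  filter_upwards [hK1, hK2, hK3, hK4, hK5, hK6, hK7, self_mem_nhdsWithin]
    with q h1 h2 h3 h4 h5 h6 h7 hq
  have hf := hF.slice hU hq
  have hK0 : 0 ≤ K := zero_le_one.trans (le_max_left _ _)
  have key := norm_fderiv_tension_sub_le hf ((hΓs _ (hFO q hq)).differentiableAt (by simp))
    (e := e) (N := N) (fun i => (hNs i _ hq.2).differentiableAt (by simp)) (R := R)
    ((hRs _ hq.2).differentiableAt (by simp)) (hN' q.2 hq.2) (hg.trace_snd q.2 hq.2)
    (K := K) (le_max_left _ _)
    (fun i => (norm_le_pi_norm (fun i => e i) i).trans (by simp [hK]))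
    (fun i => (norm_le_pi_norm (fun i => N i q.2) i).trans (h1.trans (by simp [hK])))
    (fun i => (norm_le_pi_norm (fun i => fderiv ℝ (N i) q.2) i).trans (h2.trans (by simp [hK])))
    (h3.trans (by simp [hK])) (h4.trans (by simp [hK])) (h5.trans (by simp [hK]))
    (h6.trans (by simp [hK])) (h7.trans (by simp [hK]))
  have hrhs : ∀ᶠ y in 𝓝 q.2, timeDeriv J F (q.1, y) =
      ∑ i, (fderiv ℝ (fderiv ℝ (fun y => F (q.1, y))) y (e i) (N i y)
          + levi h (F (q.1, y)) (fderiv ℝ (fun y => F (q.1, y)) y (e i))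
            (fderiv ℝ (fun y => F (q.1, y)) y (N i y)))
        - fderiv ℝ (fun y => F (q.1, y)) y (R y) := by
    filter_upwards [hU.mem_nhds hq.2] with y hy
    rw [hev (q.1, y) ⟨hq.1, hy⟩, metricTrace_eq e]
    simp only [hR]
    rw [metricTrace_eq e, map_sum, ← Finset.sum_sub_distrib]
    refine Finset.sum_congr rfl fun i _ => ?_
    rw [hess_apply]
    simp only [hN]
    abel
  -- Commuting the derivatives lets the flow equation be differentiated in space instead of in time.
  have hW : timeDeriv J (leafSpaceDeriv F) q = ContinuousLinearMap.precomp V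
      (ContinuousLinearMap.inl ℝ A B) (spaceDeriv (timeDeriv J F) q) := by
    rw [← timeDeriv_spaceDeriv hJ hJ' hU hF hq]
    exact timeDeriv_clm_comp hJ (hF.spaceDeriv hJ hU) _ hq
  have hsd : spaceDeriv (timeDeriv J F) q = fderiv ℝ (fun y =>
      ∑ i, (fderiv ℝ (fderiv ℝ (fun y => F (q.1, y))) y (e i) (N i y)
          + levi h (F (q.1, y)) (fderiv ℝ (fun y => F (q.1, y)) y (e i))
            (fderiv ℝ (fun y => F (q.1, y)) y (N i y)))
        - fderiv ℝ (fun y => F (q.1, y)) y (R y)) q.2 := Filter.EventuallyEq.fderiv_eq hrhs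
  refine ContinuousLinearMap.opNorm_le_bound _ (by positivity) fun a => ?_
  refine le_trans (le_of_eq ?_) (key a)
  congr 1
  rw [sub_apply, hW, hsd, metricTrace_eq e, FunLike.coe_sum, Finset.sum_apply]
  rfl

theorem ContDiffOn.bilinearComp {X C D D' : Type*} [NormedAddCommGroup X] [NormedSpace ℝ X]
    [NormedAddCommGroup C] [NormedSpace ℝ C] [NormedAddCommGroup D] [NormedSpace ℝ D]
    [NormedAddCommGroup D'] [NormedSpace ℝ D']
    {S : Set X} {b : X → C →L[ℝ] C →L[ℝ] V} {L : X → D →L[ℝ] C} {M : X → D' →L[ℝ] C}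
    (hb : ContDiffOn ℝ ∞ b S) (hL : ContDiffOn ℝ ∞ L S) (hM : ContDiffOn ℝ ∞ M S) :
    ContDiffOn ℝ ∞ (fun x => (b x).bilinearComp (L x) (M x)) S := by
  have h1 : ContDiffOn ℝ ∞ (fun x => ((b x).comp (L x)).flip) S :=
    (ContinuousLinearMap.flipₗᵢ ℝ D C V).contDiff.comp_contDiffOn (hb.clm_comp hL)
  exact (ContinuousLinearMap.flipₗᵢ ℝ D' D V).contDiff.comp_contDiffOn (h1.clm_comp hM)

/-- The energy of `F` along finitely many vector fields tangent to the leaves. -/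
def leafEnergy {ι : Type*} [Fintype ι] (h : V → V →L[ℝ] V →L[ℝ] ℝ) (c : ι → A × B → A)
    (F : ℝ × (A × B) → V) (q : ℝ × (A × B)) : ℝ :=
  ∑ j, h (F q) (leafSpaceDeriv F q (c j q.2)) (leafSpaceDeriv F q (c j q.2))

theorem ContDiffOn.leafEnergy {J : Set ℝ} {U : Set (A × B)} (hJ : UniqueDiffOn ℝ J)
    (hU : IsOpen U) {h : V → V →L[ℝ] V →L[ℝ] ℝ} {O : Set V} (hh : ContDiffOn ℝ ∞ h O)
    {F : ℝ × (A × B) → V} (hF : ContDiffOn ℝ ∞ F (J ×ˢ U)) (hFO : ∀ q ∈ J ×ˢ U, F q ∈ O)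
    {ι : Type*} [Fintype ι] {c : ι → A × B → A} (hc : ∀ j, ContDiffOn ℝ ∞ (c j) U) :
    ContDiffOn ℝ ∞ (leafEnergy h c F) (J ×ˢ U) := by
  have hW : ContDiffOn ℝ ∞ (leafSpaceDeriv F) (J ×ˢ U) :=
    (ContinuousLinearMap.contDiff _).comp_contDiffOn (hF.spaceDeriv hJ hU)
  have hcj : ∀ j, ContDiffOn ℝ ∞ (fun q : ℝ × (A × B) => c j q.2) (J ×ˢ U) := fun j =>
    (hc j).comp contDiff_snd.contDiffOn fun q hq => hq.2
  exact ContDiffOn.sum fun j _ => ((hh.comp hF hFO).clm_apply (hW.clm_apply (hcj j))).clm_apply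
    (hW.clm_apply (hcj j))

/-- At a spatial maximum, the leafwise energy of a solution of the heat flow grows at most
exponentially. -/
theorem exists_leafEnergy_bound {J : Set ℝ} {U : Set (A × B)} (hJ : UniqueDiffOn ℝ J)
    (hJ' : J ⊆ closure (interior J)) (hU : IsOpen U)
    {g : A × B → A × B →L[ℝ] A × B →L[ℝ] ℝ} (hg : IsTenseMetricOn g U)
    {h : V → V →L[ℝ] V →L[ℝ] ℝ} {O : Set V} (hO : IsOpen O) (hh : ContDiffOn ℝ ∞ h O)
    (hhI : ∀ y ∈ O, IsInner (h y))
    {F : ℝ × (A × B) → V} (hF : ContDiffOn ℝ ∞ F (J ×ˢ U)) (hFO : ∀ q ∈ J ×ˢ U, F q ∈ O)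
    (hev : ∀ q ∈ J ×ˢ U, timeDeriv J F q =
      metricTrace (g q.2) fun u v => hess g h (fun y => F (q.1, y)) q.2 u v)
    {ι : Type*} [Fintype ι] {c : ι → A × B → A} (hc : ∀ j, ContDiffOn ℝ ∞ (c j) U)
    (hspan : ∀ z ∈ U, ∀ w : A →L[ℝ] V, (∀ j, w (c j z) = 0) → w = 0)
    {q₀ : ℝ × (A × B)} (hq₀ : q₀ ∈ J ×ˢ U) :
    ∃ C, ∀ᶠ q in 𝓝[J ×ˢ U] q₀, IsLocalMax (fun y => leafEnergy h c F (q.1, y)) q.2 →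
      timeDeriv J (leafEnergy h c F) q ≤ C * leafEnergy h c F q := by
  -- The energy is a quadratic form in the leafwise derivative, viewed as an element of `A →L[ℝ] V`.
  -- It is definite because a linear map vanishing on all `c j z` vanishes.
  set Q : ℝ × (A × B) → (A →L[ℝ] V) →L[ℝ] (A →L[ℝ] V) →L[ℝ] ℝ := fun q =>
    ∑ j, (h (F q)).bilinearComp (ContinuousLinearMap.apply ℝ V (c j q.2))
      (ContinuousLinearMap.apply ℝ V (c j q.2)) with hQdef
  have hQa : ∀ q w w', Q q w w' = ∑ j, h (F q) (w (c j q.2)) (w' (c j q.2)) := by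
    intro q w w'
    simp [hQdef]
  have happ : ∀ j, ContDiffOn ℝ ∞
      (fun q : ℝ × (A × B) => ContinuousLinearMap.apply ℝ V (c j q.2)) (J ×ˢ U) := fun j =>
    (ContinuousLinearMap.contDiff _).comp_contDiffOn
      ((hc j).comp contDiff_snd.contDiffOn fun q hq => hq.2)
  have hQ : ContDiffOn ℝ ∞ Q (J ×ˢ U) := ContDiffOn.sum fun j _ =>
    ContDiffOn.bilinearComp (hh.comp hF hFO) (happ j) (happ j)
  have hQI : ∀ q ∈ J ×ˢ U, IsInner (Q q) := by
    intro q hq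
    have hI := hhI _ (hFO q hq)
    refine ⟨fun w w' => ?_, fun w hw => ?_⟩
    · rw [hQa, hQa]
      exact Finset.sum_congr rfl fun j _ => hI.symm _ _
    · rw [hQa]
      obtain ⟨j, hj⟩ : ∃ j, w (c j q.2) ≠ 0 := by
        by_contra hne
        push Not at hne
        exact hw (hspan q.2 hq.2 w hne)
      exact Finset.sum_pos' (fun j _ => hI.nonneg _) ⟨j, Finset.mem_univ j, hI.pos _ hj⟩
  have hW : ContDiffOn ℝ ∞ (leafSpaceDeriv F) (J ×ˢ U) :=
    (ContinuousLinearMap.contDiff _).comp_contDiffOn (hF.spaceDeriv hJ hU)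
  have hE : leafEnergy h c F = fun q => Q q (leafSpaceDeriv F q) (leafSpaceDeriv F q) := by
    funext q
    rw [hQa, leafEnergy]
  have := exists_parabolic_bound hJ hU hg.contDiffOn.continuousOn hg.isInner hQ hQI hW hq₀
    (exists_evolution_bound hJ hJ' hU hg hO hh hhI hF hFO hev hq₀)
  rw [hE]
  exact this

end FlatHeatFlow

/-! ### Fields of bilinear forms under parametrizations, and smooth metrics. -/

section Manifolds

variable {E : Type*} [NormedAddCommGroup E] [NormedSpace ℝ E]
  {M : Type*} [TopologicalSpace M] [ChartedSpace E M]
  {E₁ : Type*} [NormedAddCommGroup E₁] [NormedSpace ℝ E₁]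
  {E₂ : Type*} [NormedAddCommGroup E₂] [NormedSpace ℝ E₂]
  {E' : Type*} [NormedAddCommGroup E'] [NormedSpace ℝ E']
  {M' : Type*} [TopologicalSpace M'] [ChartedSpace E' M']
  {E'' : Type*} [NormedAddCommGroup E''] [NormedSpace ℝ E'']
  {M'' : Type*} [TopologicalSpace M''] [ChartedSpace E'' M'']

variable (E E') in
/-- The derivative of a map between manifolds, as a linear map between the model spaces. -/
def tderiv (s : M → M') (x : M) : E →L[ℝ] E' := mfderiv 𝓘(ℝ, E) 𝓘(ℝ, E') s x

/-- A field of bilinear forms at a point, as a bilinear form on the model space. -/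
def bil (B : BilinField E M) (x : M) : E →L[ℝ] E →L[ℝ] ℝ := B x

theorem pullbackBilin_eq (s : M → M') (B : BilinField E' M') (x : M) :
    bil (pullbackBilin s B : BilinField E M) x =
      (bil B (s x)).bilinearComp (tderiv E E' s x) (tderiv E E' s x) := rfl

theorem tderiv_comp {g : M' → M''} {f : M → M'} {x : M}
    (hg : MDifferentiableAt 𝓘(ℝ, E') 𝓘(ℝ, E'') g (f x))
    (hf : MDifferentiableAt 𝓘(ℝ, E) 𝓘(ℝ, E') f x) :
    tderiv E E'' (g ∘ f) x = (tderiv E' E'' g (f x)).comp (tderiv E E' f x) :=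
  mfderiv_comp x hg hf

theorem tderiv_eq_fderiv (f : E → E') (x : E) : tderiv E E' f x = fderiv ℝ f x :=
  mfderiv_eq_fderiv

theorem tderiv_id (x : M) : tderiv E E (id : M → M) x = ContinuousLinearMap.id ℝ E := mfderiv_id

theorem tderiv_congr {f g : M → M'} {x : M} (h : f =ᶠ[𝓝 x] g) :
    tderiv E E' f x = tderiv E E' g x := h.mfderiv_eq

theorem pullbackBilin_congr {s t : M → M'} {x : M} (h : s =ᶠ[𝓝 x] t) (B : BilinField E' M') :
    bil (pullbackBilin s B : BilinField E M) x = bil (pullbackBilin t B : BilinField E M) x := by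
  rw [pullbackBilin_eq, pullbackBilin_eq, tderiv_congr h, h.self_of_nhds]

theorem pullbackBilin_comp {s : M → M'} {p : M' → M''} {x : M} (B : BilinField E'' M'')
    (hp : MDifferentiableAt 𝓘(ℝ, E') 𝓘(ℝ, E'') p (s x))
    (hs : MDifferentiableAt 𝓘(ℝ, E) 𝓘(ℝ, E') s x) :
    bil (pullbackBilin (p ∘ s) B : BilinField E M) x =
      bil (pullbackBilin s (pullbackBilin p B : BilinField E' M') : BilinField E M) x := by
  rw [pullbackBilin_eq, pullbackBilin_eq, pullbackBilin_eq, tderiv_comp hp hs]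
  rfl

theorem ContMDiffAt.mdiff {f : M → M'} {x : M} (h : ContMDiffAt 𝓘(ℝ, E) 𝓘(ℝ, E') ∞ f x) :
    MDifferentiableAt 𝓘(ℝ, E) 𝓘(ℝ, E') f x := h.mdifferentiableAt (by simp)

/-- Change of parametrization. -/
theorem pullbackBilin_param [IsManifold 𝓘(ℝ, E) ∞ M] {s₁ : E₁ → M} {s₂ : E₂ → M} {ψ : E₁ → E₂}
    {z : E₁} (hψ : ContDiffAt ℝ ∞ ψ z) (hs₂ : ContMDiffAt 𝓘(ℝ, E₂) 𝓘(ℝ, E) ∞ s₂ (ψ z))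
    (h : s₁ =ᶠ[𝓝 z] s₂ ∘ ψ) (B : BilinField E M) :
    ∀ᶠ y in 𝓝 z, bil (pullbackBilin s₁ B : BilinField E₁ E₁) y =
      (bil (pullbackBilin s₂ B : BilinField E₂ E₂) (ψ y)).bilinearComp (fderiv ℝ ψ y)
        (fderiv ℝ ψ y) := by
  have h1 : ∀ᶠ y in 𝓝 z, ContDiffAt ℝ 1 ψ y := (hψ.of_le one_le_infty).eventually (by simp)
  have h2 : ∀ᶠ y in 𝓝 z, ContMDiffAt 𝓘(ℝ, E₂) 𝓘(ℝ, E) 1 s₂ (ψ y) := by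
    have : IsManifold 𝓘(ℝ, E) 1 M := IsManifold.of_le one_le_infty
    exact hψ.continuousAt.eventually ((contMDiffAt_iff_contMDiffAt_nhds (by simp)).1
      (hs₂.of_le one_le_infty))
  filter_upwards [h1, h2, h.eventuallyEq_nhds] with y hy1 hy2 hy3
  have hs : MDifferentiableAt 𝓘(ℝ, E₂) 𝓘(ℝ, E) s₂ (ψ y) := hy2.mdifferentiableAt one_ne_zero
  have hp : MDifferentiableAt 𝓘(ℝ, E₁) 𝓘(ℝ, E₂) ψ y :=
    (hy1.differentiableAt one_ne_zero).mdifferentiableAt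
  rw [pullbackBilin_congr hy3, pullbackBilin_comp B hs hp, pullbackBilin_eq, tderiv_eq_fderiv]

variable [FiniteDimensional ℝ E]

/-- Smooth Riemannian metrics, as fields of bilinear forms. -/
structure IsSmoothMetric (B : BilinField E M) : Prop where
  contDiffOn : ∀ c : M, ContDiffOn ℝ ∞ (coordMetric B c) (extChartAt 𝓘(ℝ, E) c).target
  isInner : ∀ x, IsInner (bil B x)

theorem coordMetric_eq (B : BilinField E M) (c : M) (z : E) :
    coordMetric B c z = bil (pullbackBilin (extChartAt 𝓘(ℝ, E) c).symm B : BilinField E E) z := rfl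

section Charts

variable [IsManifold 𝓘(ℝ, E) ∞ M]

theorem contMDiffAt_chart {c x : M} (hx : x ∈ (extChartAt 𝓘(ℝ, E) c).source) :
    ContMDiffAt 𝓘(ℝ, E) 𝓘(ℝ, E) ∞ (extChartAt 𝓘(ℝ, E) c) x :=
  contMDiffAt_extChartAt' (by simpa using hx)

theorem contMDiffAt_chart_symm {c : M} {z : E} (hz : z ∈ (extChartAt 𝓘(ℝ, E) c).target) :
    ContMDiffAt 𝓘(ℝ, E) 𝓘(ℝ, E) ∞ (extChartAt 𝓘(ℝ, E) c).symm z :=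
  (contMDiffOn_extChartAt_symm c).contMDiffAt ((isOpen_extChartAt_target c).mem_nhds hz)

theorem tderiv_chart_symm_injective {c : M} {z : E} (hz : z ∈ (extChartAt 𝓘(ℝ, E) c).target) :
    Function.Injective (tderiv E E (extChartAt 𝓘(ℝ, E) c).symm z) := by
  have h : (extChartAt 𝓘(ℝ, E) c ∘ (extChartAt 𝓘(ℝ, E) c).symm : E → E) =ᶠ[𝓝 z] id := by
    filter_upwards [(isOpen_extChartAt_target c).mem_nhds hz] with y hy
    exact (extChartAt 𝓘(ℝ, E) c).right_inv hy
  have h1 := tderiv_comp (contMDiffAt_chart ((extChartAt 𝓘(ℝ, E) c).map_target hz)).mdiff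
    (contMDiffAt_chart_symm hz).mdiff
  rw [tderiv_congr h, tderiv_id] at h1
  intro u v huv
  have := congrArg (tderiv E E (extChartAt 𝓘(ℝ, E) c) ((extChartAt 𝓘(ℝ, E) c).symm z)) huv
  rwa [← ContinuousLinearMap.comp_apply, ← ContinuousLinearMap.comp_apply, ← h1] at this

theorem coordMetric_isInner {B : BilinField E M} (hB : IsSmoothMetric B) {c : M} {z : E}
    (hz : z ∈ (extChartAt 𝓘(ℝ, E) c).target) : IsInner (coordMetric B c z) := by
  have hI := hB.isInner ((extChartAt 𝓘(ℝ, E) c).symm z)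
  rw [coordMetric_eq, pullbackBilin_eq]
  exact ⟨fun u v => hI.symm _ _, fun v hv => hI.pos _
    fun h0 => hv (tderiv_chart_symm_injective hz (h0.trans (map_zero _).symm))⟩

/-- The pull-back of a smooth metric under a parametrization is smooth. -/
theorem IsSmoothMetric.contDiffAt_pullback {B : BilinField E M} (hB : IsSmoothMetric B)
    {s : E₁ → M} {z : E₁} (hs : ContMDiffAt 𝓘(ℝ, E₁) 𝓘(ℝ, E) ∞ s z) :
    ContDiffAt ℝ ∞ (fun y => bil (pullbackBilin s B : BilinField E₁ E₁) y) z := by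
  have hsrc : s z ∈ (extChartAt 𝓘(ℝ, E) (s z)).source := mem_extChartAt_source (s z)
  set ψ : E₁ → E := extChartAt 𝓘(ℝ, E) (s z) ∘ s with hψ
  have hψc : ContDiffAt ℝ ∞ ψ z := ((contMDiffAt_chart hsrc).comp z hs).contDiffAt
  have ht : ψ z ∈ (extChartAt 𝓘(ℝ, E) (s z)).target := mem_extChartAt_target (s z)
  have he : s =ᶠ[𝓝 z] (extChartAt 𝓘(ℝ, E) (s z)).symm ∘ ψ := by
    filter_upwards [hs.continuousAt.preimage_mem_nhds
      ((isOpen_extChartAt_source (s z)).mem_nhds hsrc)] with y hy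
    exact ((extChartAt 𝓘(ℝ, E) (s z)).left_inv hy).symm
  have h := pullbackBilin_param hψc (contMDiffAt_chart_symm ht) he B
  refine ContDiffAt.congr_of_eventuallyEq ?_ h
  have hc : ContDiffAt ℝ ∞ (fun y => coordMetric B (s z) (ψ y)) z :=
    ((hB.contDiffOn (s z)).contDiffAt ((isOpen_extChartAt_target (s z)).mem_nhds ht)).comp z hψc
  have hd : ContDiffAt ℝ ∞ (fderiv ℝ ψ) z := hψc.fderiv_right (by simp)
  have h1 : ContDiffAt ℝ ∞ (fun y => ((coordMetric B (s z) (ψ y)).comp (fderiv ℝ ψ y)).flip) z :=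
    (ContinuousLinearMap.flipₗᵢ ℝ E₁ E ℝ).contDiff.contDiffAt.comp z (hc.clm_comp hd)
  exact (ContinuousLinearMap.flipₗᵢ ℝ E₁ E₁ ℝ).contDiff.contDiffAt.comp z (h1.clm_comp hd)

theorem IsSmoothMetric.isInner_pullback {B : BilinField E M} (hB : IsSmoothMetric B)
    {s : E₁ → M} {z : E₁} (hs : Function.Injective (tderiv E₁ E s z)) :
    IsInner (bil (pullbackBilin s B : BilinField E₁ E₁) z) := by
  have hI := hB.isInner (s z)
  rw [pullbackBilin_eq]
  exact ⟨fun u v => hI.symm _ _, fun v hv => hI.pos _ fun h0 => hv (hs (h0.trans (map_zero _).symm))⟩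

/-- Smoothness of the metric as a bundle section is evaluated on the coordinate fields `ds(u)` and
`ds(v)`; the fibre component of the resulting section of the trivial bundle is the coefficient in
the chart. -/
theorem isSmoothMetric_riemMetric (g : RiemMetric E M) : IsSmoothMetric (g.inner : BilinField E M) := by
  refine ⟨fun c => ?_, fun x => ⟨fun u v => g.symm x u v, fun v hv => g.pos x v hv⟩⟩
  have hM1 : IsManifold 𝓘(ℝ, E) 1 M := IsManifold.of_le one_le_infty
  set s : E → M := ⇑(extChartAt 𝓘(ℝ, E) c).symm with hs
  set T := (extChartAt 𝓘(ℝ, E) c).target with hT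
  have hTo : IsOpen T := isOpen_extChartAt_target c
  have hsm : ContMDiffOn 𝓘(ℝ, E) 𝓘(ℝ, E) ∞ s T := contMDiffOn_extChartAt_symm c
  have hsec : ∀ u : E, ContMDiffOn 𝓘(ℝ, E) 𝓘(ℝ, E).tangent ∞
      (fun z => (⟨s z, mfderiv 𝓘(ℝ, E) 𝓘(ℝ, E) s z u⟩ : TangentBundle 𝓘(ℝ, E) M)) T := by
    intro u
    have h1 := hsm.contMDiffOn_tangentMapWithin (m := ∞) (by simp) hTo.uniqueMDiffOn
    have h2 : ContMDiffOn 𝓘(ℝ, E) 𝓘(ℝ, E).tangent ∞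
        (fun z : E => (⟨z, u⟩ : TangentBundle 𝓘(ℝ, E) E)) T :=
      contMDiffOn_vectorSpace_iff_contDiffOn.2 contDiffOn_const
    refine (h1.comp h2 fun z hz => hz).congr fun z hz => ?_
    simp only [Function.comp_apply, tangentMapWithin, mfderivWithin_of_isOpen hTo hz]
  rw [contDiffOn_clm_apply]
  intro u
  rw [contDiffOn_clm_apply]
  intro v
  have hg : ContMDiffOn 𝓘(ℝ, E) (𝓘(ℝ, E).prod 𝓘(ℝ, E →L[ℝ] E →L[ℝ] ℝ)) ∞
      (fun z => TotalSpace.mk' (E →L[ℝ] E →L[ℝ] ℝ)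
        (E := fun x : M => TangentSpace 𝓘(ℝ, E) x →L[ℝ] TangentSpace 𝓘(ℝ, E) x →L[ℝ] ℝ)
        (s z) (g.inner (s z))) T :=
    g.contMDiff.comp_contMDiffOn hsm
  have h3 : ContMDiffOn 𝓘(ℝ, E) (𝓘(ℝ, E).prod 𝓘(ℝ)) ∞
      (fun z ↦ TotalSpace.mk' ℝ (E := Bundle.Trivial M ℝ) (s z) (g.inner (s z)
        (mfderiv 𝓘(ℝ, E) 𝓘(ℝ, E) s z u) (mfderiv 𝓘(ℝ, E) 𝓘(ℝ, E) s z v))) T := by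
    apply ContMDiffOn.clm_bundle_apply₂ (F₁ := E) (F₂ := E)
    · exact hg
    · exact hsec u
    · exact hsec v
  intro z hz
  have h4 := h3 z hz
  simp only [contMDiffWithinAt_totalSpace] at h4
  exact h4.2.contDiffWithinAt

end Charts

end Manifolds

/-! ### The tension field in arbitrary charts. -/

section SmoothCharts

variable {E : Type*} [NormedAddCommGroup E] [NormedSpace ℝ E]
  {M : Type*} [TopologicalSpace M] [ChartedSpace E M]
  {E₁ : Type*} [NormedAddCommGroup E₁] [NormedSpace ℝ E₁]
  {E' : Type*} [NormedAddCommGroup E'] [NormedSpace ℝ E']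
  {M' : Type*} [TopologicalSpace M'] [ChartedSpace E' M']

variable (E) in
/-- Smooth charts of a manifold with values in an arbitrary normed space. -/
structure IsSmoothChart (φ : OpenPartialHomeomorph M E₁) : Prop where
  contMDiffOn : ContMDiffOn 𝓘(ℝ, E) 𝓘(ℝ, E₁) ∞ φ φ.source
  contMDiffOn_symm : ContMDiffOn 𝓘(ℝ, E₁) 𝓘(ℝ, E) ∞ φ.symm φ.target

variable {φ : OpenPartialHomeomorph M E₁}

theorem IsSmoothChart.contMDiffAt (hφ : IsSmoothChart E φ) {x : M} (hx : x ∈ φ.source) :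
    ContMDiffAt 𝓘(ℝ, E) 𝓘(ℝ, E₁) ∞ φ x :=
  hφ.contMDiffOn.contMDiffAt (φ.open_source.mem_nhds hx)

theorem IsSmoothChart.contMDiffAt_symm (hφ : IsSmoothChart E φ) {z : E₁} (hz : z ∈ φ.target) :
    ContMDiffAt 𝓘(ℝ, E₁) 𝓘(ℝ, E) ∞ φ.symm z :=
  hφ.contMDiffOn_symm.contMDiffAt (φ.open_target.mem_nhds hz)

theorem IsSmoothChart.tderiv_symm_tderiv (hφ : IsSmoothChart E φ) {x : M} (hx : x ∈ φ.source)
    (v : E) : tderiv E₁ E φ.symm (φ x) (tderiv E E₁ φ x v) = v := by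
  have h : (φ.symm ∘ φ : M → M) =ᶠ[𝓝 x] id := by
    filter_upwards [φ.open_source.mem_nhds hx] with y hy using φ.left_inv hy
  have h1 := tderiv_comp (hφ.contMDiffAt_symm (φ.map_source hx)).mdiff (hφ.contMDiffAt hx).mdiff
  rw [tderiv_congr h, tderiv_id] at h1
  exact (DFunLike.congr_fun h1 v).symm

theorem IsSmoothChart.tderiv_tderiv_symm (hφ : IsSmoothChart E φ) {x : M} (hx : x ∈ φ.source)
    (v : E₁) : tderiv E E₁ φ x (tderiv E₁ E φ.symm (φ x) v) = v := by
  have h : (φ ∘ φ.symm : E₁ → E₁) =ᶠ[𝓝 (φ x)] id := by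
    filter_upwards [φ.open_target.mem_nhds (φ.map_source hx)] with y hy using φ.right_inv hy
  have h0 : MDifferentiableAt 𝓘(ℝ, E) 𝓘(ℝ, E₁) φ (φ.symm (φ x)) := by
    rw [φ.left_inv hx]
    exact (hφ.contMDiffAt hx).mdiff
  have h1 := tderiv_comp h0 (hφ.contMDiffAt_symm (φ.map_source hx)).mdiff
  rw [tderiv_congr h, tderiv_id, φ.left_inv hx] at h1
  exact (DFunLike.congr_fun h1 v).symm

/-- The derivative of a smooth chart as an isomorphism. -/
def IsSmoothChart.equiv (hφ : IsSmoothChart E φ) {x : M} (hx : x ∈ φ.source) : E₁ ≃L[ℝ] E :=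
  ContinuousLinearEquiv.equivOfInverse (tderiv E₁ E φ.symm (φ x)) (tderiv E E₁ φ x)
    (hφ.tderiv_tderiv_symm hx) (hφ.tderiv_symm_tderiv hx)

theorem IsSmoothChart.tderiv_symm_injective (hφ : IsSmoothChart E φ) {z : E₁}
    (hz : z ∈ φ.target) : Function.Injective (tderiv E₁ E φ.symm z) := by
  have h := (hφ.equiv (φ.map_target hz)).injective
  intro u v huv
  apply h
  change tderiv E₁ E φ.symm (φ (φ.symm z)) u = tderiv E₁ E φ.symm (φ (φ.symm z)) v
  rwa [φ.right_inv hz]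

/-- A field of bilinear forms read in a chart. -/
def chartForm (B : BilinField E M) (φ : OpenPartialHomeomorph M E₁) (z : E₁) : E₁ →L[ℝ] E₁ →L[ℝ] ℝ :=
  bil (pullbackBilin φ.symm B : BilinField E₁ E₁) z

theorem chartForm_apply (B : BilinField E M) (φ : OpenPartialHomeomorph M E₁) (z u v : E₁) :
    chartForm B φ z u v =
      bil B (φ.symm z) (tderiv E₁ E φ.symm z u) (tderiv E₁ E φ.symm z v) := rfl

theorem levi_congr {b₁ b₂ : E → E →L[ℝ] E →L[ℝ] ℝ} {z : E} (h : b₁ =ᶠ[𝓝 z] b₂) :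
    levi b₁ z = levi b₂ z := by
  simp only [levi, h.fderiv_eq, h.self_of_nhds]

theorem hess_congr {b : E → E →L[ℝ] E →L[ℝ] ℝ} {b' : E' → E' →L[ℝ] E' →L[ℝ] ℝ} {F₁ F₂ : E → E'}
    {z : E} (h : F₁ =ᶠ[𝓝 z] F₂) : hess b b' F₁ z = hess b b' F₂ z := by
  have h2 : fderiv ℝ F₁ =ᶠ[𝓝 z] fderiv ℝ F₂ := h.fderiv
  simp only [hess, hessFlat, h.fderiv_eq, h.self_of_nhds, h2.fderiv_eq]

theorem map_metricTrace [FiniteDimensional ℝ E] {V V' : Type*} [NormedAddCommGroup V]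
    [NormedSpace ℝ V] [NormedAddCommGroup V'] [NormedSpace ℝ V'] (L : V →L[ℝ] V')
    (G : E →L[ℝ] E →L[ℝ] ℝ) (b : E → E → V) :
    L (metricTrace G b) = metricTrace G fun u v => L (b u v) := by
  simp only [metricTrace, map_sum]

variable [FiniteDimensional ℝ E]

section

variable [IsManifold 𝓘(ℝ, E) ∞ M]

theorem IsSmoothMetric.chartForm_contDiffOn {B : BilinField E M} (hB : IsSmoothMetric B)
    (hφ : IsSmoothChart E φ) : ContDiffOn ℝ ∞ (chartForm B φ) φ.target := fun _ hz =>
  (hB.contDiffAt_pullback (hφ.contMDiffAt_symm hz)).contDiffWithinAt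

theorem IsSmoothMetric.chartForm_isInner {B : BilinField E M} (hB : IsSmoothMetric B)
    (hφ : IsSmoothChart E φ) {z : E₁} (hz : z ∈ φ.target) : IsInner (chartForm B φ z) :=
  hB.isInner_pullback (hφ.tderiv_symm_injective hz)

/-- The tangent space at `x` is identified with `E` through the chart centred at `x`. Hence the
formulas defining `tension` and `covDeriv` in that chart give tangent vectors without further
conversion. -/
theorem tderiv_chart_self (x : M) :
    tderiv E E (extChartAt 𝓘(ℝ, E) x) x = ContinuousLinearMap.id ℝ E := by
  have : IsManifold 𝓘(ℝ, E) 1 M := IsManifold.of_le one_le_infty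
  have h := mfderiv_chartAt_eq_tangentCoordChange (I := 𝓘(ℝ, E)) (x := x) (y := x)
    (mem_chart_source E x)
  ext v
  have h2 : tangentCoordChange 𝓘(ℝ, E) x x x v = v :=
    tangentCoordChange_self (mem_extChartAt_source x)
  exact (DFunLike.congr_fun h v).trans h2

end

/-- The tension field read in arbitrary charts. -/
theorem tderiv_tension [FiniteDimensional ℝ E₁] [FiniteDimensional ℝ E'] [IsManifold 𝓘(ℝ, E) ∞ M]
    [IsManifold 𝓘(ℝ, E') ∞ M']
    {B : BilinField E M} (hB : IsSmoothMetric B) {B' : BilinField E' M'} (hB' : IsSmoothMetric B')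
    (hφ : IsSmoothChart E φ) {f : M → M'} {z : E₁} (hz : z ∈ φ.target)
    (hf : ContMDiffAt 𝓘(ℝ, E) 𝓘(ℝ, E') ∞ f (φ.symm z)) {c' : M'}
    (hc : f (φ.symm z) ∈ (extChartAt 𝓘(ℝ, E') c').source) :
    tderiv E' E' (extChartAt 𝓘(ℝ, E') c') (f (φ.symm z)) (tension B B' f (φ.symm z)) =
      metricTrace (chartForm B φ z) (fun u v => hess (chartForm B φ) (coordMetric B' c')
        (extChartAt 𝓘(ℝ, E') c' ∘ f ∘ φ.symm) z u v) := by
  set x := φ.symm z with hx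
  set y := f x with hy
  set κ := extChartAt 𝓘(ℝ, E) x with hκ
  set κ' := extChartAt 𝓘(ℝ, E') y with hκ'
  set F₁ : E → E' := κ' ∘ f ∘ κ.symm with hF₁
  set ψ : E₁ → E := κ ∘ φ.symm with hψ
  set ψ' : E' → E' := extChartAt 𝓘(ℝ, E') c' ∘ κ'.symm with hψ'
  have hxκ : x ∈ κ.source := mem_extChartAt_source x
  have hyκ : y ∈ κ'.source := mem_extChartAt_source y
  have hψz : ψ z = κ x := rfl
  have hκt : κ x ∈ κ.target := κ.map_source hxκ
  have hκt' : κ' y ∈ κ'.target := κ'.map_source hyκ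
  have hF₁z : F₁ (κ x) = κ' y := by
    simp only [hF₁, Function.comp_apply, κ.left_inv hxκ, hy]
  have hsm : ContMDiffAt 𝓘(ℝ, E₁) 𝓘(ℝ, E) ∞ φ.symm z := hφ.contMDiffAt_symm hz
  have hψc : ContDiffAt ℝ ∞ ψ z := ((contMDiffAt_chart hxκ).comp z hsm).contDiffAt
  have hκs : ContMDiffAt 𝓘(ℝ, E) 𝓘(ℝ, E) ∞ κ.symm (κ x) := contMDiffAt_chart_symm hκt
  have hκs' : ContMDiffAt 𝓘(ℝ, E') 𝓘(ℝ, E') ∞ κ'.symm (κ' y) := contMDiffAt_chart_symm hκt'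
  have hF₁c : ContDiffAt ℝ ∞ F₁ (κ x) := by
    refine ContMDiffAt.contDiffAt ?_
    refine ContMDiffAt.comp_of_eq (y := y) (contMDiffAt_chart hyκ) ?_
      (by simp only [Function.comp_apply, κ.left_inv hxκ, hy])
    exact hf.comp_of_eq hκs (κ.left_inv hxκ)
  have hψc' : ContDiffAt ℝ ∞ ψ' (κ' y) :=
    ((contMDiffAt_chart hc).comp_of_eq hκs' (κ'.left_inv hyκ)).contDiffAt
  -- invertibility of the coordinate changes
  have hφx : φ x = z := φ.right_inv hz
  have hxφ : x ∈ φ.source := φ.map_target hz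
  have hDψ : fderiv ℝ ψ z = tderiv E₁ E φ.symm z := by
    have h := tderiv_comp (g := κ) (f := φ.symm) (contMDiffAt_chart hxκ).mdiff hsm.mdiff
    have h0 : tderiv E E κ (φ.symm z) = ContinuousLinearMap.id ℝ E := tderiv_chart_self x
    rw [← tderiv_eq_fderiv, h, h0]
    rfl
  have hA : ((hφ.equiv hxφ : E₁ ≃L[ℝ] E) : E₁ →L[ℝ] E) = fderiv ℝ ψ z := by
    rw [hDψ, ← hφx]
    rfl
  have hinj' : Function.Injective (fderiv ℝ ψ' (κ' y)) := by
    set κc := extChartAt 𝓘(ℝ, E') c' with hκc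
    have h1 : (κ' ∘ κc.symm) ∘ ψ' =ᶠ[𝓝 (κ' y)] id := by
      have h2 : ∀ᶠ w in 𝓝 (κ' y), κ'.symm w ∈ κc.source := by
        refine hκs'.continuousAt.preimage_mem_nhds ?_
        rw [κ'.left_inv hyκ]
        exact (isOpen_extChartAt_source c').mem_nhds hc
      filter_upwards [h2, (isOpen_extChartAt_target y).mem_nhds hκt'] with w hw hw'
      simp only [Function.comp_apply, hψ', κc.left_inv hw, id]
      exact κ'.right_inv hw'
    have h3 : ψ' (κ' y) = κc y := by simp only [hψ', Function.comp_apply, κ'.left_inv hyκ]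
    have h4 : ContMDiffAt 𝓘(ℝ, E') 𝓘(ℝ, E') ∞ (κ' ∘ κc.symm) (ψ' (κ' y)) := by
      rw [h3]
      exact ContMDiffAt.comp_of_eq (contMDiffAt_chart hyκ)
        (contMDiffAt_chart_symm (κc.map_source hc)) (κc.left_inv hc)
    have h5 := fderiv_comp (κ' y) (h4.contDiffAt.differentiableAt (by simp))
      (hψc'.differentiableAt (by simp))
    rw [h1.fderiv_eq, fderiv_id] at h5
    intro u v huv
    have := congrArg (fderiv ℝ (κ' ∘ κc.symm) (ψ' (κ' y))) huv
    rwa [← ContinuousLinearMap.comp_apply, ← ContinuousLinearMap.comp_apply, ← h5] at this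
  have hsurj' : Function.Surjective (fderiv ℝ ψ' (κ' y)) :=
    LinearMap.surjective_of_injective (f := (fderiv ℝ ψ' (κ' y) : E' →ₗ[ℝ] E')) hinj'
  have hsurj : Function.Surjective (fderiv ℝ ψ z) := by
    rw [← hA]
    exact (hφ.equiv hxφ).surjective
  -- the metrics
  have hb₁ := pullbackBilin_param hψc (s₁ := φ.symm) (s₂ := κ.symm) hκs (by
    filter_upwards [hsm.continuousAt.preimage_mem_nhds
      ((isOpen_extChartAt_source x).mem_nhds hxκ)] with w hw
    exact (κ.left_inv hw).symm) B
  have hψ'y : ψ' (κ' y) = extChartAt 𝓘(ℝ, E') c' y := by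
    simp only [hψ', Function.comp_apply, κ'.left_inv hyκ]
  have htc : extChartAt 𝓘(ℝ, E') c' y ∈ (extChartAt 𝓘(ℝ, E') c').target :=
    (extChartAt 𝓘(ℝ, E') c').map_source hc
  have hb₂ := pullbackBilin_param hψc' (s₁ := κ'.symm) (s₂ := (extChartAt 𝓘(ℝ, E') c').symm)
    (by rw [hψ'y]; exact contMDiffAt_chart_symm htc) (by
    have h2 : ∀ᶠ w in 𝓝 (κ' y), κ'.symm w ∈ (extChartAt 𝓘(ℝ, E') c').source := by
      refine hκs'.continuousAt.preimage_mem_nhds ?_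
      rw [κ'.left_inv hyκ]
      exact (isOpen_extChartAt_source c').mem_nhds hc
    filter_upwards [h2] with w hw
    exact ((extChartAt 𝓘(ℝ, E') c').left_inv hw).symm) B'
  have hdiff : ∀ (c : M') (w : E'), w ∈ (extChartAt 𝓘(ℝ, E') c).target →
      DifferentiableAt ℝ (coordMetric B' c) w := fun c w hw =>
    ((hB'.contDiffOn c).contDiffAt ((isOpen_extChartAt_target c).mem_nhds hw)).differentiableAt
      (by simp)
  have hinn : ∀ (c : M') (w : E'), w ∈ (extChartAt 𝓘(ℝ, E') c).target →
      ∀ᶠ w' in 𝓝 w, IsInner (coordMetric B' c w') := fun c w hw => by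
    filter_upwards [(isOpen_extChartAt_target c).mem_nhds hw] with w' hw'
    exact coordMetric_isInner hB' hw'
  -- The Hessian is tensorial at both ends: `hess_comp_target` extracts `dψ'`, then
  -- `hess_comp_source` inserts `dψ` in both arguments.
  have hs : ∀ u v, hess (chartForm B φ) (coordMetric B' c')
        (extChartAt 𝓘(ℝ, E') c' ∘ f ∘ φ.symm) z u v =
      fderiv ℝ ψ' (κ' y) (hess (coordMetric B x) (coordMetric B' y) F₁ (κ x)
        (fderiv ℝ ψ z u) (fderiv ℝ ψ z v)) := by
    intro u v
    have he : (extChartAt 𝓘(ℝ, E') c' ∘ f ∘ φ.symm : E₁ → E') =ᶠ[𝓝 z] ψ' ∘ (F₁ ∘ ψ) := by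
      have h1 : ∀ᶠ w in 𝓝 z, φ.symm w ∈ κ.source :=
        hsm.continuousAt.preimage_mem_nhds ((isOpen_extChartAt_source x).mem_nhds hxκ)
      have h2 : ∀ᶠ w in 𝓝 z, f (φ.symm w) ∈ κ'.source :=
        (hf.continuousAt.comp hsm.continuousAt).preimage_mem_nhds
          ((isOpen_extChartAt_source y).mem_nhds hyκ)
      filter_upwards [h1, h2] with w hw hw'
      simp only [Function.comp_apply, hψ', hF₁, hψ, κ.left_inv hw, κ'.left_inv hw']
    have hFψ : (F₁ ∘ ψ) z = κ' y := hF₁z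
    rw [hess_congr he, hess_comp_target (b₁ := coordMetric B' y) (chartForm B φ)
      (by rw [hFψ]; exact hψc'.of_le two_le_infty)
      (by rw [hFψ, hψ'y]; exact hdiff _ _ htc) (by rw [hFψ, hψ'y]; exact hinn _ _ htc)
      (by
        rw [hFψ]
        filter_upwards [hb₂] with w hw u v
        exact DFunLike.congr_fun (DFunLike.congr_fun hw u) v)
      (by rw [hFψ]; exact hdiff _ _ hκt') (by rw [hFψ]; exact hsurj')
      (by rw [hFψ]; exact (hinn _ _ hκt').self_of_nhds)
      ((ContDiffAt.comp z (by rw [hψz]; exact hF₁c) hψc).of_le two_le_infty), hFψ]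
    congr 1
    refine hess_comp_source (b₂ := coordMetric B x) (coordMetric B' y) (hψc.of_le two_le_infty)
      ?_ ?_ ?_ ?_ hsurj (hB.chartForm_isInner hφ hz) (hF₁c.of_le two_le_infty) u v
    · exact ((hB.contDiffOn x).contDiffAt
        ((isOpen_extChartAt_target x).mem_nhds hκt)).differentiableAt (by simp)
    · filter_upwards [(isOpen_extChartAt_target x).mem_nhds hκt] with w' hw'
      exact coordMetric_isInner hB hw'
    · filter_upwards [hb₁] with w hw u v
      exact DFunLike.congr_fun (DFunLike.congr_fun hw u) v
    · exact ((hB.chartForm_contDiffOn hφ).contDiffAt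
        (φ.open_target.mem_nhds hz)).differentiableAt (by simp)
  have hL : tderiv E' E' (extChartAt 𝓘(ℝ, E') c') y = fderiv ℝ ψ' (κ' y) := by
    have he : (extChartAt 𝓘(ℝ, E') c' : M' → E') =ᶠ[𝓝 y] ψ' ∘ κ' := by
      filter_upwards [(isOpen_extChartAt_source y).mem_nhds hyκ] with w hw
      simp only [Function.comp_apply, hψ', κ'.left_inv hw]
    rw [tderiv_congr he, tderiv_comp (E' := E') hψc'.contMDiffAt.mdiff (contMDiffAt_chart hyκ).mdiff,
      tderiv_chart_self, tderiv_eq_fderiv]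
    rfl
  have hT : tension B B' f x = metricTrace (coordMetric B x (κ x))
      (fun u v => hess (coordMetric B x) (coordMetric B' y) F₁ (κ x) u v) := rfl
  rw [hL, hT]
  have hm := metricTrace_comp (coordMetric_isInner hB hκt) (hφ.equiv hxφ)
    ((ContinuousLinearMap.compL ℝ E E' E' (fderiv ℝ ψ' (κ' y))).comp
      (hess (coordMetric B x) (coordMetric B' y) F₁ (κ x)))
  rw [hA] at hm
  have hA' : ∀ w, (hφ.equiv hxφ) w = fderiv ℝ ψ z w := fun w => DFunLike.congr_fun hA w
  simp only [hA'] at hm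
  refine (map_metricTrace (fderiv ℝ ψ' (κ' y)) _ _).trans ?_
  refine hm.symm.trans ?_
  have h0 : chartForm B φ z = (coordMetric B x (κ x)).bilinearComp (fderiv ℝ ψ z) (fderiv ℝ ψ z) :=
    hb₁.self_of_nhds
  rw [h0]
  simp only [hs]
  rfl

end SmoothCharts

/-! ### Vector fields, brackets and covariant derivatives in charts. -/

section Fields

variable {E : Type*} [NormedAddCommGroup E] [NormedSpace ℝ E] [FiniteDimensional ℝ E]
  {M : Type*} [TopologicalSpace M] [ChartedSpace E M] [IsManifold 𝓘(ℝ, E) ∞ M]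
  {E₁ : Type*} [NormedAddCommGroup E₁] [NormedSpace ℝ E₁] [FiniteDimensional ℝ E₁]
  {φ : OpenPartialHomeomorph M E₁}

/-- A vector field read in a chart. -/
def chartField (φ : OpenPartialHomeomorph M E₁) (V : VField E M) (z : E₁) : E₁ :=
  tderiv E E₁ φ (φ.symm z) (V (φ.symm z))

theorem IsSmoothChart.inverse_symm (hφ : IsSmoothChart E φ) {z : E₁} (hz : z ∈ φ.target) (v : E) :
    (tderiv E₁ E φ.symm z).inverse v = tderiv E E₁ φ (φ.symm z) v := by
  have hx := φ.map_target hz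
  have h : tderiv E₁ E φ.symm z = (hφ.equiv hx : E₁ →L[ℝ] E) := by
    conv_lhs => rw [← φ.right_inv hz]
    rfl
  rw [h, ContinuousLinearMap.inverse_equiv]
  rfl

theorem IsSmoothChart.isInvertible_symm (hφ : IsSmoothChart E φ) {z : E₁} (hz : z ∈ φ.target) :
    (tderiv E₁ E φ.symm z).IsInvertible :=
  ⟨hφ.equiv (φ.map_target hz), by
    conv_rhs => rw [← φ.right_inv hz]
    rfl⟩

theorem IsSmoothChart.inverse_tderiv (hφ : IsSmoothChart E φ) {x : M} (hx : x ∈ φ.source) (v : E₁) :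
    (tderiv E E₁ φ x).inverse v = tderiv E₁ E φ.symm (φ x) v := by
  have h : tderiv E E₁ φ x = ((hφ.equiv hx).symm : E →L[ℝ] E₁) := rfl
  rw [h, ContinuousLinearMap.inverse_equiv]
  rfl

theorem IsSmoothChart.isInvertible (hφ : IsSmoothChart E φ) {x : M} (hx : x ∈ φ.source) :
    (tderiv E E₁ φ x).IsInvertible := ⟨(hφ.equiv hx).symm, rfl⟩

theorem IsSmoothChart.mpullback_symm (hφ : IsSmoothChart E φ) (V : VField E M) {z : E₁}
    (hz : z ∈ φ.target) : VectorField.mpullback 𝓘(ℝ, E₁) 𝓘(ℝ, E) φ.symm V z = chartField φ V z :=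
  hφ.inverse_symm hz _

theorem IsSmoothChart.contDiffAt_chartField (hφ : IsSmoothChart E φ) {V : VField E M} {z : E₁}
    (hz : z ∈ φ.target) (hV : SmoothVFieldAt V (φ.symm z)) : ContDiffAt ℝ ∞ (chartField φ V) z := by
  have h := ContMDiffAt.mpullback_vectorField_preimage (m := ∞) (n := ∞) hV (hφ.contMDiffAt_symm hz)
    (hφ.isInvertible_symm hz) (by simp)
  have h2 := contMDiffAt_vectorSpace_iff_contDiffAt.1 h
  refine h2.congr_of_eventuallyEq ?_
  filter_upwards [φ.open_target.mem_nhds hz] with w hw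
  exact (hφ.mpullback_symm V hw).symm

/-- The vector field with given components in a chart. -/
def fieldOfChart (φ : OpenPartialHomeomorph M E₁) (c : E₁ → E₁) : VField E M := fun x =>
  tderiv E₁ E φ.symm (φ x) (c (φ x))

theorem IsSmoothChart.chartField_fieldOfChart (hφ : IsSmoothChart E φ) (c : E₁ → E₁) {z : E₁}
    (hz : z ∈ φ.target) : chartField φ (fieldOfChart (E := E) φ c) z = c z := by
  have h := hφ.tderiv_tderiv_symm (φ.map_target hz) (c (φ (φ.symm z)))
  refine h.trans ?_
  rw [φ.right_inv hz]

theorem IsSmoothChart.smoothVFieldAt_fieldOfChart (hφ : IsSmoothChart E φ) {c : E₁ → E₁} {x : M}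
    (hx : x ∈ φ.source) (hc : ContDiffAt ℝ ∞ c (φ x)) :
    SmoothVFieldAt (fieldOfChart (E := E) φ c) x := by
  have h := ContMDiffAt.mpullback_vectorField_preimage (m := ∞) (n := ∞)
    (V := fun z : E₁ => (c z : TangentSpace 𝓘(ℝ, E₁) z))
    (contMDiffAt_vectorSpace_iff_contDiffAt.2 hc) (hφ.contMDiffAt hx)
    (hφ.isInvertible hx) (by simp)
  refine h.congr_of_eventuallyEq ?_
  filter_upwards [φ.open_source.mem_nhds hx] with y hy
  have : VectorField.mpullback 𝓘(ℝ, E) 𝓘(ℝ, E₁) φ (fun z : E₁ => (c z : TangentSpace 𝓘(ℝ, E₁) z)) y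
      = fieldOfChart (E := E) φ c y := hφ.inverse_tderiv hy _
  rw [this]

/-- Truncated coordinate fields. -/
theorem IsSmoothChart.exists_field [T2Space M] (hφ : IsSmoothChart E φ) {x : M} (hx : x ∈ φ.source)
    (c : E₁) : ∃ V : VField E M, (∀ y, SmoothVFieldAt V y) ∧
      (∀ y, V y = 0 ∨ ∃ a : ℝ, y ∈ φ.source ∧ V y = a • tderiv E₁ E φ.symm (φ y) c) ∧
      ∀ᶠ y in 𝓝 x, V y = tderiv E₁ E φ.symm (φ y) c := by
  -- The cut-off is supported inside the domain, so extension by zero is smooth. The values remain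
  -- multiples of the coordinate field, which preserves tangency to a foliation.
  obtain ⟨χ, -, hχ⟩ := (SmoothBumpFunction.nhds_basis_tsupport (I := 𝓘(ℝ, E)) x).mem_iff.1
    (φ.open_source.mem_nhds hx)
  refine ⟨fun y => χ y • fieldOfChart φ (fun _ => c) y, fun y => ?_, fun y => ?_, ?_⟩
  · by_cases hy : y ∈ tsupport χ
    · exact ContMDiffAt.smul_section χ.contMDiffAt
        (hφ.smoothVFieldAt_fieldOfChart (hχ hy) contDiffAt_const)
    · have h0 : ContMDiffAt 𝓘(ℝ, E) 𝓘(ℝ, E).tangent ∞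
          (zeroSection E (TangentSpace 𝓘(ℝ, E) : M → Type _)) y :=
        Bundle.contMDiffAt_zeroSection ℝ (TangentSpace 𝓘(ℝ, E) : M → Type _)
      refine h0.congr_of_eventuallyEq ?_
      filter_upwards [notMem_tsupport_iff_eventuallyEq.1 hy] with w hw
      simp [hw, zeroSection]
  · by_cases hy : y ∈ tsupport χ
    · exact Or.inr ⟨χ y, hχ hy, rfl⟩
    · left
      simp [image_eq_zero_of_notMem_tsupport hy]
  · filter_upwards [χ.eventuallyEq_one] with y hy
    have h1 : χ y = 1 := hy
    change χ y • tderiv E₁ E φ.symm (φ y) c = _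
    rw [h1, one_smul]

theorem IsSmoothChart.chartField_mlieBracket (hφ : IsSmoothChart E φ) {V W : VField E M} {z : E₁}
    (hz : z ∈ φ.target) (hV : SmoothVFieldAt V (φ.symm z)) (hW : SmoothVFieldAt W (φ.symm z)) :
    chartField φ (VectorField.mlieBracket 𝓘(ℝ, E) V W) z =
      VectorField.lieBracket ℝ (chartField φ V) (chartField φ W) z := by
  have hM : IsManifold 𝓘(ℝ, E) (minSmoothness ℝ 2) M :=
    IsManifold.of_le (n := ∞) (by simpa using two_le_infty)
  have hE : IsManifold 𝓘(ℝ, E₁) (minSmoothness ℝ 2) E₁ := inferInstance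
  have h := VectorField.mpullback_mlieBracket (n := ∞) (hV.mdifferentiableAt (by simp))
    (hW.mdifferentiableAt (by simp)) (hφ.contMDiffAt_symm hz)
    (by simpa using two_le_infty)
  rw [hφ.mpullback_symm _ hz] at h
  rw [h, ← VectorField.mlieBracketWithin_univ, VectorField.mlieBracketWithin_eq_lieBracketWithin]
  refine (congrFun (VectorField.lieBracketWithin_univ (𝕜 := ℝ)) z).trans ?_
  refine Filter.EventuallyEq.lieBracket_vectorField_eq ?_ ?_
  · filter_upwards [φ.open_target.mem_nhds hz] with w hw using hφ.mpullback_symm V hw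
  · filter_upwards [φ.open_target.mem_nhds hz] with w hw using hφ.mpullback_symm W hw

/-- The Levi-Civita derivative read in an arbitrary chart. -/
theorem IsSmoothChart.covDeriv_eq (hφ : IsSmoothChart E φ) {B : BilinField E M}
    (hB : IsSmoothMetric B) {V : VField E M} {z : E₁} (hz : z ∈ φ.target)
    (hV : SmoothVFieldAt V (φ.symm z)) (u : E₁) :
    covDeriv B V (φ.symm z) (tderiv E₁ E φ.symm z u) = tderiv E₁ E φ.symm z
      (fderiv ℝ (chartField φ V) z u + levi (chartForm B φ) z u (chartField φ V z)) := by
  set x := φ.symm z with hx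
  set κ := extChartAt 𝓘(ℝ, E) x with hκ
  set ψ : E₁ → E := κ ∘ φ.symm with hψ
  have hxκ : x ∈ κ.source := mem_extChartAt_source x
  have hκt : κ x ∈ κ.target := κ.map_source hxκ
  have hsm : ContMDiffAt 𝓘(ℝ, E₁) 𝓘(ℝ, E) ∞ φ.symm z := hφ.contMDiffAt_symm hz
  have hκs : ContMDiffAt 𝓘(ℝ, E) 𝓘(ℝ, E) ∞ κ.symm (κ x) := contMDiffAt_chart_symm hκt
  have hψc : ContDiffAt ℝ ∞ ψ z := ((contMDiffAt_chart hxκ).comp z hsm).contDiffAt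
  have hDψ : fderiv ℝ ψ z = tderiv E₁ E φ.symm z := by
    have h := tderiv_comp (g := κ) (f := φ.symm) (contMDiffAt_chart hxκ).mdiff hsm.mdiff
    have h0 : tderiv E E κ (φ.symm z) = ContinuousLinearMap.id ℝ E := tderiv_chart_self x
    rw [← tderiv_eq_fderiv, h, h0]
    rfl
  have hsurj : Function.Surjective (fderiv ℝ ψ z) := by
    rw [hDψ]
    intro v
    refine ⟨tderiv E E₁ φ x v, ?_⟩
    have := hφ.tderiv_symm_tderiv (φ.map_target hz) v
    rwa [φ.right_inv hz] at this
  have hb₁ := pullbackBilin_param hψc (s₁ := φ.symm) (s₂ := κ.symm) hκs (by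
    filter_upwards [hsm.continuousAt.preimage_mem_nhds
      ((isOpen_extChartAt_source x).mem_nhds hxκ)] with w hw
    exact (κ.left_inv hw).symm) B
  set Vloc : E → E := VectorField.mpullback 𝓘(ℝ, E) 𝓘(ℝ, E) κ.symm V with hVloc
  -- the field in the chart `κ`
  have hinv : ∀ w ∈ κ.target, (tderiv E E κ.symm w).IsInvertible := fun w hw => by
    have hbij : Function.Bijective (tderiv E E κ.symm w) :=
      ⟨tderiv_chart_symm_injective hw, LinearMap.surjective_of_injective
        (f := (tderiv E E κ.symm w : E →ₗ[ℝ] E)) (tderiv_chart_symm_injective hw)⟩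
    exact ⟨(LinearEquiv.ofBijective (tderiv E E κ.symm w : E →ₗ[ℝ] E) hbij).toContinuousLinearEquiv,
      by ext; rfl⟩
  have hVc : ContDiffAt ℝ ∞ Vloc (κ x) := by
    have h := ContMDiffAt.mpullback_vectorField_preimage (m := ∞) (n := ∞) (V := V)
      (f := κ.symm) (x₀ := κ x) (by rw [κ.left_inv hxκ]; exact hV) hκs (hinv _ hκt) (by simp)
    exact contMDiffAt_vectorSpace_iff_contDiffAt.1 h
  have hrel : ∀ᶠ w in 𝓝 z, Vloc (ψ w) = fderiv ℝ ψ w (chartField φ V w) := by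
    have h1 : ∀ᶠ w in 𝓝 z, φ.symm w ∈ κ.source :=
      hsm.continuousAt.preimage_mem_nhds ((isOpen_extChartAt_source x).mem_nhds hxκ)
    filter_upwards [h1, φ.open_target.mem_nhds hz] with w hw hw'
    have hψt : ψ w ∈ κ.target := κ.map_source hw
    have e1 : κ.symm (ψ w) = φ.symm w := κ.left_inv hw
    have h2 : Vloc (ψ w) = (tderiv E E κ.symm (ψ w)).inverse (V (φ.symm w)) := by
      have : ∀ y, y = φ.symm w → ∀ L : E →L[ℝ] E, L.inverse (V y) = L.inverse (V (φ.symm w)) := by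
        rintro y rfl L
        rfl
      exact this _ e1 _
    rw [h2]
    obtain ⟨e, he⟩ := hinv _ hψt
    rw [← he, ContinuousLinearMap.inverse_equiv]
    change e.symm (V (φ.symm w)) = _
    refine (ContinuousLinearEquiv.symm_apply_eq e).2 ?_
    have h3 : e (fderiv ℝ ψ w (chartField φ V w)) =
        tderiv E E κ.symm (ψ w) (fderiv ℝ ψ w (chartField φ V w)) := by
      rw [← he]
      rfl
    rw [h3, ← tderiv_eq_fderiv, ← ContinuousLinearMap.comp_apply]
    have h4 : (κ.symm ∘ ψ : E₁ → M) =ᶠ[𝓝 w] φ.symm := by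
      have : ∀ᶠ y in 𝓝 w, φ.symm y ∈ κ.source :=
        (hφ.contMDiffAt_symm hw').continuousAt.preimage_mem_nhds
          ((isOpen_extChartAt_source x).mem_nhds hw)
      filter_upwards [this] with y hy using κ.left_inv hy
    have h5 : MDifferentiableAt 𝓘(ℝ, E₁) 𝓘(ℝ, E) ψ w :=
      ((contMDiffAt_chart hw).comp w (hφ.contMDiffAt_symm hw')).mdiff
    rw [← tderiv_comp (contMDiffAt_chart_symm hψt).mdiff h5, tderiv_congr h4]
    have := hφ.tderiv_symm_tderiv (φ.map_target hw') (V (φ.symm w))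
    rw [φ.right_inv hw'] at this
    exact this.symm
  -- Differentiating `Vloc ∘ ψ = dψ(V)` produces `D²ψ(u, V)`, exactly the inhomogeneous term in the
  -- transformation law `hl`.
  have hrel' : fderiv ℝ Vloc (κ x) (fderiv ℝ ψ z u) = fderiv ℝ (fderiv ℝ ψ) z u (chartField φ V z)
      + fderiv ℝ ψ z (fderiv ℝ (chartField φ V) z u) := by
    have h1 : HasFDerivAt (Vloc ∘ ψ) ((fderiv ℝ Vloc (κ x)).comp (fderiv ℝ ψ z)) z :=
      HasFDerivAt.comp z (hVc.differentiableAt (by simp)).hasFDerivAt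
        (hψc.differentiableAt (by simp)).hasFDerivAt
    have h2 := ((hψc.fderiv_right (m := 1) (by norm_num; exact two_le_infty)).differentiableAt
      (by simp)).hasFDerivAt.clm_apply
        ((hφ.contDiffAt_chartField hz hV).differentiableAt (by simp)).hasFDerivAt
    have h3 := DFunLike.congr_fun (h1.unique (h2.congr_of_eventuallyEq hrel)) u
    simp at h3
    rw [h3]
    abel
  have hl := levi_pullback (hψc.of_le two_le_infty) (b₂ := coordMetric B x)
    (b₁ := chartForm B φ) (((hB.contDiffOn x).contDiffAt
        ((isOpen_extChartAt_target x).mem_nhds hκt)).differentiableAt (by simp))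
    (by
      filter_upwards [(isOpen_extChartAt_target x).mem_nhds hκt] with w' hw'
      exact coordMetric_isInner hB hw')
    (by
      filter_upwards [hb₁] with w hw u v
      exact DFunLike.congr_fun (DFunLike.congr_fun hw u) v)
    (((hB.chartForm_contDiffOn hφ).contDiffAt
        (φ.open_target.mem_nhds hz)).differentiableAt (by simp)) hsurj
    (hB.chartForm_isInner hφ hz) u (chartField φ V z)
  have hdef : covDeriv B V x (tderiv E₁ E φ.symm z u) =
      fderiv ℝ Vloc (κ x) (tderiv E₁ E φ.symm z u) +
        levi (coordMetric B x) (κ x) (tderiv E₁ E φ.symm z u) (Vloc (κ x)) := rfl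
  have hr0 : Vloc (κ x) = fderiv ℝ ψ z (chartField φ V z) := hrel.self_of_nhds
  have hψz : ψ z = κ x := rfl
  rw [hψz] at hl
  rw [hdef, ← hDψ, hrel', hr0, map_add, hl]
  abel

end Fields

/-! ### Bundle-like and tense metrics in foliated charts. -/

section FoliatedCharts

variable {E : Type*} [NormedAddCommGroup E] [NormedSpace ℝ E] [FiniteDimensional ℝ E]
  {M : Type*} [TopologicalSpace M] [ChartedSpace E M] [IsManifold 𝓘(ℝ, E) ∞ M]
  {m n : ℕ} {D : Distribution E M}
  {φ : OpenPartialHomeomorph M (EuclideanSpace ℝ (Fin m) × EuclideanSpace ℝ (Fin n))}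

theorem IsFoliatedChart.isSmoothChart (hφ : IsFoliatedChart D φ) : IsSmoothChart E φ :=
  ⟨hφ.contMDiffOn, hφ.contMDiffOn_symm⟩

theorem IsSmoothChart.mfderiv_snd (hφ : IsSmoothChart E φ) {x : M} (hx : x ∈ φ.source)
    (v : TangentSpace 𝓘(ℝ, E) x) :
    mfderiv 𝓘(ℝ, E) 𝓘(ℝ, EuclideanSpace ℝ (Fin n)) (fun y => (φ y).2) x v =
      (tderiv E (EuclideanSpace ℝ (Fin m) × EuclideanSpace ℝ (Fin n)) φ x v).2 := by
  have h := tderiv_comp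
    (g := (Prod.snd : EuclideanSpace ℝ (Fin m) × EuclideanSpace ℝ (Fin n) → _))
    (f := φ) (x := x) (differentiableAt_snd.mdifferentiableAt) (hφ.contMDiffAt hx).mdiff
  rw [tderiv_eq_fderiv, fderiv_snd] at h
  exact DFunLike.congr_fun h v

theorem IsFoliatedChart.mem_iff_snd (hφ : IsFoliatedChart D φ) {x : M} (hx : x ∈ φ.source)
    (v : TangentSpace 𝓘(ℝ, E) x) :
    v ∈ D x ↔ (tderiv E (EuclideanSpace ℝ (Fin m) × EuclideanSpace ℝ (Fin n)) φ x v).2 = 0 := by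
  rw [hφ.mem_iff x hx v]
  exact Eq.congr_left (hφ.isSmoothChart.mfderiv_snd hx v)

theorem IsFoliatedChart.tderiv_symm_mem (hφ : IsFoliatedChart D φ) {x : M} (hx : x ∈ φ.source)
    (a : EuclideanSpace ℝ (Fin m)) :
    (tderiv (EuclideanSpace ℝ (Fin m) × EuclideanSpace ℝ (Fin n)) E φ.symm (φ x) (a, 0) :
      TangentSpace 𝓘(ℝ, E) x) ∈ D x := by
  refine (hφ.mem_iff_snd hx _).2 ?_
  have := hφ.isSmoothChart.tderiv_tderiv_symm hx (a, 0)
  exact congrArg Prod.snd this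

/-- In foliated charts, the transverse part of a foliated field is constant along the leaves. -/
theorem IsFoliatedChart.fderiv_chartField_snd [T2Space M] (hφ : IsFoliatedChart D φ)
    {H : VField E M} (hH : IsFoliatedField D H)
    {z : EuclideanSpace ℝ (Fin m) × EuclideanSpace ℝ (Fin n)} (hz : z ∈ φ.target)
    (a : EuclideanSpace ℝ (Fin m)) : (fderiv ℝ (chartField φ H) z (a, 0)).2 = 0 := by
  have hs := hφ.isSmoothChart
  have hx := φ.map_target hz
  -- `IsFoliatedField` tests against globally defined tangent fields, hence the cut-off. Near the
  -- point `V` is the constant coordinate field `(a, 0)`, and its bracket with `H` is the derivative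
  -- of `H` in that direction.
  obtain ⟨V, hV, hV0, hVx⟩ := hs.exists_field hx (a, 0)
  have hVD : ∀ y, V y ∈ D y := by
    intro y
    rcases hV0 y with h | ⟨b, hy, h⟩
    · rw [h]
      exact zero_mem _
    · rw [h]
      exact (D y).smul_mem b (hφ.tderiv_symm_mem hy a)
  have hb := (hφ.mem_iff_snd hx _).1 (hH.2 V hV hVD (φ.symm z))
  have hc := hs.chartField_mlieBracket hz (hV _) (hH.1 _)
  have hb' : (chartField φ (VectorField.mlieBracket 𝓘(ℝ, E) V H) z).2 = 0 := hb
  have hconst : chartField φ V =ᶠ[𝓝 z] fun _ => (a, 0) := by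
    have h1 := (hs.contMDiffAt_symm hz).continuousAt.eventually hVx
    filter_upwards [h1, φ.open_target.mem_nhds hz] with w hw hw'
    refine Eq.trans (congrArg (tderiv E _ φ (φ.symm w)) hw) ?_
    exact hs.tderiv_tderiv_symm (φ.map_target hw') _
  rw [hc, VectorField.lieBracket, hconst.self_of_nhds, hconst.fderiv_eq] at hb'
  simpa using hb'

/-- The mean curvature in a foliated chart. -/
theorem IsFoliatedChart.metricTrace_levi_eq {𝓕 : Foliation E M m n}
    (hφ : IsFoliatedChart 𝓕.tangent φ) {B : BilinField E M}
    (hB : IsSmoothMetric B) {H : VField E M} (hH : IsMeanCurvatureField B 𝓕 H)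
    {z : EuclideanSpace ℝ (Fin m) × EuclideanSpace ℝ (Fin n)} (hz : z ∈ φ.target) :
    metricTrace (resLeft (chartForm B φ z))
      (fun u v => (levi (chartForm B φ) z (u, 0) (v, 0)).2) = (chartField φ H z).2 := by
  have hs := hφ.isSmoothChart
  have hx := φ.map_target hz
  have hzz : φ (φ.symm z) = z := φ.right_inv hz
  have hP : ContDiffAt ℝ ∞ (fun y => resLeft (chartForm B φ y)) z := by
    have h := (hB.chartForm_contDiffOn hs).contDiffAt (φ.open_target.mem_nhds hz)
    exact ContDiffAt.bilinearComp_const (A := EuclideanSpace ℝ (Fin m))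
      (B := EuclideanSpace ℝ (Fin m)) h (ContinuousLinearMap.inl ℝ _ _) _
  have hI : ∀ y ∈ φ.target, IsInner (chartForm B φ y) := fun y hy => hB.chartForm_isInner hs hy
  obtain ⟨e, he, heo⟩ := exists_orthonormal_family (P := fun y => resLeft (chartForm B φ y)) hP (by
    filter_upwards [φ.open_target.mem_nhds hz] with y hy using (hI y hy).resLeft) m
    (by rw [finrank_euclideanSpace_fin])
  -- An orthonormal frame of the leaves, obtained from an orthonormal family for the restriction of
  -- the metric to the leaf factor.
  set c : Fin m → EuclideanSpace ℝ (Fin m) × EuclideanSpace ℝ (Fin n) →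
    EuclideanSpace ℝ (Fin m) × EuclideanSpace ℝ (Fin n) := fun i y => (e i y, 0) with hc
  have hcs : ∀ i, ContDiffAt ℝ ∞ (c i) z := fun i => (he i).prodMk contDiffAt_const
  have hsm : ∀ i, SmoothVFieldAt (fieldOfChart (E := E) φ (c i)) (φ.symm z) := fun i =>
    hs.smoothVFieldAt_fieldOfChart hx (by rw [hzz]; exact hcs i)
  have hframe : IsOrthonormalFrameNear B 𝓕.tangent (fun i => fieldOfChart φ (c i)) (φ.symm z) := by
    refine ⟨hsm, ?_, ?_⟩
    · filter_upwards [φ.open_source.mem_nhds hx] with y hy i using hφ.tderiv_symm_mem hy _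
    · have h1 : ∀ᶠ y in 𝓝 (φ.symm z), ∀ i j, resLeft (chartForm B φ (φ y)) (e i (φ y)) (e j (φ y))
          = if i = j then 1 else 0 := by
        have h2 : Tendsto φ (𝓝 (φ.symm z)) (𝓝 z) := by
          have := (hs.contMDiffAt hx).continuousAt.tendsto
          rwa [hzz] at this
        exact h2.eventually heo
      filter_upwards [φ.open_source.mem_nhds hx, h1] with y hy hy1 i j
      rw [← hy1 i j]
      change bil B y _ _ = bil B (φ.symm (φ y)) _ _
      rw [φ.left_inv hy]
      rfl
  have hD := (hφ.mem_iff_snd hx _).1 ((hH (φ.symm z)).2 _ hframe)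
  have hcov : ∀ i, tderiv E (EuclideanSpace ℝ (Fin m) × EuclideanSpace ℝ (Fin n)) φ (φ.symm z)
      (covDeriv B (fieldOfChart φ (c i)) (φ.symm z) (fieldOfChart φ (c i) (φ.symm z))) =
      fderiv ℝ (c i) z (c i z) + levi (chartForm B φ) z (c i z) (c i z) := by
    intro i
    have h1 : fieldOfChart (E := E) φ (c i) (φ.symm z) = tderiv _ E φ.symm z (c i z) := by
      change tderiv _ E φ.symm (φ (φ.symm z)) (c i (φ (φ.symm z))) = _
      rw [hzz]
    have h2 : chartField φ (fieldOfChart (E := E) φ (c i)) =ᶠ[𝓝 z] c i := by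
      filter_upwards [φ.open_target.mem_nhds hz] with y hy using hs.chartField_fieldOfChart _ hy
    have h3 := hs.covDeriv_eq hB hz (hsm i) (c i z)
    rw [h2.fderiv_eq, h2.self_of_nhds] at h3
    rw [h1, h3]
    have h4 := hs.tderiv_tderiv_symm hx (fderiv ℝ (c i) z (c i z)
      + levi (chartForm B φ) z (c i z) (c i z))
    rw [hzz] at h4
    exact h4
  -- The fields stay in the leaf factor, so their ordinary derivatives do too. Only the Christoffel
  -- symbols contribute to the transverse part of `∇_{e_i} e_i`.
  have hd2 : ∀ i, (fderiv ℝ (c i) z (c i z)).2 = 0 := by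
    intro i
    have h1 : HasFDerivAt (c i) ((fderiv ℝ (e i) z).prod 0) z :=
      ((he i).differentiableAt (by simp)).hasFDerivAt.prodMk (hasFDerivAt_const _ _)
    rw [h1.fderiv]
    rfl
  have hsum : ∑ i, (levi (chartForm B φ) z (c i z) (c i z)).2 = (chartField φ H z).2 := by
    have key : ∀ (L : E →L[ℝ] EuclideanSpace ℝ (Fin m) × EuclideanSpace ℝ (Fin n))
        (f : Fin m → E) (v : E), (L (∑ i, f i - v)).2 = 0 → ∑ i, (L (f i)).2 = (L v).2 := by
      intro L f v h
      rwa [map_sub, map_sum, Prod.snd_sub, Prod.snd_sum, sub_eq_zero] at h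
    refine Eq.trans (Finset.sum_congr rfl fun i _ => ?_) (key _ _ _ hD)
    refine Eq.trans ?_ (congrArg Prod.snd (hcov i)).symm
    rw [Prod.snd_add, hd2, zero_add]
  have ho := heo.self_of_nhds
  have hli := linearIndependent_of_orthonormal ho
  have htr := metricTrace_eq_orthonormal
    (Module.Basis.mk hli (hli.span_eq_top_of_card_eq_finrank' (by simp)).ge) (hI z hz).resLeft
    (fun i j => by simpa using ho i j)
    ((ContinuousLinearMap.compL ℝ (EuclideanSpace ℝ (Fin m))
      (EuclideanSpace ℝ (Fin m) × EuclideanSpace ℝ (Fin n)) (EuclideanSpace ℝ (Fin n))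
      (ContinuousLinearMap.snd ℝ _ _)).comp (resLeft (levi (chartForm B φ) z)))
  simp only [Module.Basis.mk_apply] at htr
  exact htr.trans hsum

/-- In suitable foliated charts, a tense bundle-like metric has a horizontal part and a
horizontal trace of the Christoffel symbols which are constant along the leaves. -/
theorem RiemFoliation.exists_tense_chart [T2Space M] {𝓕 : RiemFoliation E M m n}
    {B : BilinField E M} (hB : IsSmoothMetric B) (hbundle : IsBundleLike B 𝓕)
    (htense : IsTense B 𝓕.toFoliation) (x : M) :
    ∃ φ : OpenPartialHomeomorph M (EuclideanSpace ℝ (Fin m) × EuclideanSpace ℝ (Fin n)),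
      x ∈ φ.source ∧ IsFoliatedChart 𝓕.tangent φ ∧ IsTenseMetricOn (chartForm B φ) φ.target := by
  obtain ⟨H, hHm, hHf⟩ := htense
  obtain ⟨φ, hxφ, hφ, G, hG, hT⟩ := 𝓕.transverse_basic x
  have hs := hφ.isSmoothChart
  refine ⟨φ, hxφ, hφ, ?_⟩
  have hGo : IsOpen (Prod.snd '' φ.target) := isOpenMap_snd _ φ.open_target
  have hI : ∀ y ∈ φ.target, IsInner (chartForm B φ y) := fun y hy => hB.chartForm_isInner hs hy
  have hIe : ∀ z ∈ φ.target, ∀ᶠ y in 𝓝 z, IsInner (chartForm B φ y) := fun z hz => by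
    filter_upwards [φ.open_target.mem_nhds hz] with y hy using hI y hy
  have hbc : ∀ z ∈ φ.target, ContDiffAt ℝ ∞ (chartForm B φ) z := fun z hz =>
    (hB.chartForm_contDiffOn hs).contDiffAt (φ.open_target.mem_nhds hz)
  have hGc : ∀ z ∈ φ.target, ContDiffAt ℝ ∞ G z.2 := fun z hz =>
    hG.contDiffAt (hGo.mem_nhds ⟨z, hz, rfl⟩)
  -- In the chart the leaf directions are the vectors `(a, 0)`, so orthogonality to them means
  -- membership in the normal space; there the metric is the transverse one, which reads `G`.
  have hbl : ∀ z ∈ φ.target, BundleLikeAt (chartForm B φ) G z := by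
    intro z hz u v hu hv
    have hx := φ.map_target hz
    have hzz : φ (φ.symm z) = z := φ.right_inv hz
    have hn : ∀ u, (∀ a, chartForm B φ z u (a, 0) = 0) →
        (tderiv _ E φ.symm z u : TangentSpace 𝓘(ℝ, E) (φ.symm z)) ∈
          normalSpace B 𝓕.tangent (φ.symm z) := by
      intro u hu w hw
      have h1 := (hφ.mem_iff_snd hx w).1 hw
      have h2 := hs.tderiv_symm_tderiv hx w
      rw [hzz] at h2
      set w' := tderiv E (EuclideanSpace ℝ (Fin m) × EuclideanSpace ℝ (Fin n)) φ (φ.symm z) w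
      have h3 : w' = (w'.1, 0) := Prod.ext rfl h1
      have h4 := hu w'.1
      rw [← h3, chartForm_apply, h2] at h4
      exact h4
    have h1 := (hbundle _ _ (hn u hu) _ (hn v hv)).trans (hT _ hx _ _)
    have h2 : ∀ u, tderiv E (EuclideanSpace ℝ (Fin m) × EuclideanSpace ℝ (Fin n)) φ (φ.symm z)
        (tderiv _ E φ.symm z u) = u := fun u => by
      have := hs.tderiv_tderiv_symm hx u
      rwa [hzz] at this
    have h3 : ∀ u : EuclideanSpace ℝ (Fin m) × EuclideanSpace ℝ (Fin n), mfderiv 𝓘(ℝ, E) 𝓘(ℝ, EuclideanSpace ℝ (Fin n)) (fun y => (φ y).2) (φ.symm z)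
        (tderiv _ E φ.symm z u) = u.2 := fun u =>
      (hs.mfderiv_snd hx _).trans (congrArg Prod.snd (h2 u))
    refine h1.trans ((congrArg₂ (fun b c => G (φ (φ.symm z)).2 b c) (h3 u) (h3 v)).trans ?_)
    rw [hzz]
  have hble : ∀ z ∈ φ.target, ∀ᶠ y in 𝓝 z, BundleLikeAt (chartForm B φ) G y := fun z hz => by
    filter_upwards [φ.open_target.mem_nhds hz] with y hy using hbl y hy
  have hsnd : ∀ {P : EuclideanSpace ℝ (Fin m) × EuclideanSpace ℝ (Fin n) →
      EuclideanSpace ℝ (Fin m) × EuclideanSpace ℝ (Fin n)} {z}, DifferentiableAt ℝ P z →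
      HasFDerivAt (fun y => (P y).2) ((ContinuousLinearMap.snd ℝ _ _).comp (fderiv ℝ P z)) z :=
    fun hP => (ContinuousLinearMap.snd ℝ (EuclideanSpace ℝ (Fin m))
      (EuclideanSpace ℝ (Fin n))).hasFDerivAt.comp _ hP.hasFDerivAt
  refine ⟨hB.chartForm_contDiffOn hs, hI, fun z hz β a => ?_, fun z hz a => ?_⟩
  · have hP : DifferentiableAt ℝ (fun y => (chartForm B φ y).inverse
        (β.comp (ContinuousLinearMap.snd ℝ (EuclideanSpace ℝ (Fin m)) (EuclideanSpace ℝ (Fin n))))) z :=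
      (((hI z hz).contDiffAt_inverse (hbc z hz)).clm_apply contDiffAt_const).differentiableAt
        (by simp)
    have h := hsnd hP
    -- By `BundleLikeAt.inverse_snd` the transverse block of the inverse metric is the inverse of
    -- `G`, a function of the transverse coordinate alone.
    have h0 := fderiv_left_eq_zero (k := fun b => (G b).inverse β) (z := z) (by
      filter_upwards [φ.open_target.mem_nhds hz] with y hy
      exact (hbl y hy).inverse_snd (hI y hy) β) h.differentiableAt a
    rw [h.fderiv] at h0
    exact h0
  · have hlc : ContDiffAt ℝ ∞ (levi (chartForm B φ)) z := ContDiffAt.levi (hbc z hz) (hI z hz)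
    have hP : DifferentiableAt ℝ (fun y => metricTrace (chartForm B φ y)
        fun u v => levi (chartForm B φ) y u v) z :=
      (ContDiffAt.metricTrace (hbc z hz) (hI z hz) hlc).differentiableAt (by simp)
    have hH2 : DifferentiableAt ℝ (chartField φ H) z :=
      (hs.contDiffAt_chartField hz (hHf.1 _)).differentiableAt (by simp)
    -- After subtracting the mean curvature, the transverse part of the trace depends only on the
    -- transverse coordinate. The mean curvature itself has vanishing leafwise derivative by
    -- `fderiv_chartField_snd`.
    have h := (hsnd hP).sub (hsnd hH2)
    have h0 := fderiv_left_eq_zero (k := fun b => metricTrace (G b) (fun u v => levi G b u v))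
      (z := z) (by
      filter_upwards [φ.open_target.mem_nhds hz] with y hy
      have h1 := BundleLikeAt.metricTrace_levi_snd (hbc y hy) (hIe y hy) (hble y hy)
        ((hGc y hy).differentiableAt (by simp))
      rw [hφ.metricTrace_levi_eq hB hHm hy] at h1
      exact sub_eq_of_eq_add' h1) h.differentiableAt a
    rw [h.fderiv] at h0
    have h2 := hφ.fderiv_chartField_snd hHf hz a
    have h3 : ((fderiv ℝ (fun y => metricTrace (chartForm B φ y)
        fun u v => levi (chartForm B φ) y u v) z (a, 0)).2 : EuclideanSpace ℝ (Fin n))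
        - (fderiv ℝ (chartField φ H) z (a, 0)).2 = 0 := h0
    rwa [h2, sub_zero] at h3

end FoliatedCharts

/-! ### The universal cover: lifted charts, deck transformations, compactness. -/

section Covers

variable {E : Type*} [NormedAddCommGroup E] [NormedSpace ℝ E] [FiniteDimensional ℝ E]
  {X : Type*} [TopologicalSpace X] [ChartedSpace E X] [IsManifold 𝓘(ℝ, E) ∞ X]
  {X' : Type*} [TopologicalSpace X'] [ChartedSpace E X'] [IsManifold 𝓘(ℝ, E) ∞ X']
  {p : X' → X}

theorem IsSmoothUniversalCover.contMDiff (hp : IsSmoothUniversalCover E E p) :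
    ContMDiff 𝓘(ℝ, E) 𝓘(ℝ, E) ∞ p := hp.isLocalDiffeomorph.contMDiff

theorem IsSmoothUniversalCover.exists_equiv (hp : IsSmoothUniversalCover E E p) (x : X') :
    ∃ e : E ≃L[ℝ] E, (e : E →L[ℝ] E) = tderiv E E p x :=
  ⟨hp.isLocalDiffeomorph.mfderivToContinuousLinearEquiv (by simp) x,
    hp.isLocalDiffeomorph.mfderivToContinuousLinearEquiv_coe (x := x) (by simp)⟩

theorem IsSmoothUniversalCover.isSmoothMetric (hp : IsSmoothUniversalCover E E p)
    {B : BilinField E X} (hB : IsSmoothMetric B) :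
    IsSmoothMetric (pullbackBilin p B : BilinField E X') := by
  refine ⟨fun c z hz => ?_, fun x => ?_⟩
  · have hs : ContMDiffAt 𝓘(ℝ, E) 𝓘(ℝ, E) ∞ (p ∘ (extChartAt 𝓘(ℝ, E) c).symm) z :=
      hp.contMDiff.contMDiffAt.comp z (contMDiffAt_chart_symm hz)
    refine ((hB.contDiffAt_pullback hs).congr_of_eventuallyEq ?_).contDiffWithinAt
    filter_upwards [(isOpen_extChartAt_target c).mem_nhds hz] with w hw
    exact (pullbackBilin_comp B hp.contMDiff.contMDiffAt.mdiff (contMDiffAt_chart_symm hw).mdiff).symm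
  · obtain ⟨e, he⟩ := hp.exists_equiv x
    have hI := hB.isInner (p x)
    rw [pullbackBilin_eq, ← he]
    exact ⟨fun u v => hI.symm _ _, fun v hv => hI.pos _ (by simpa using hv)⟩

/-- Charts of the base of a cover lift. -/
theorem IsSmoothUniversalCover.exists_lift_chart {E₁ : Type*} [NormedAddCommGroup E₁]
    [NormedSpace ℝ E₁] (hp : IsSmoothUniversalCover E E p) {φ : OpenPartialHomeomorph X E₁}
    (hφ : IsSmoothChart E φ) {x : X'} (hx : p x ∈ φ.source) :
    ∃ θ : OpenPartialHomeomorph X' E₁, x ∈ θ.source ∧ IsSmoothChart E θ ∧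
      ∀ z ∈ θ.target, z ∈ φ.target ∧ p (θ.symm z) = φ.symm z := by
  obtain ⟨Φ, hxΦ, hΦ⟩ := hp.isLocalDiffeomorph x
  have hsrc : ∀ y, y ∈ (Φ.toOpenPartialHomeomorph.trans φ).source ↔
      y ∈ Φ.source ∧ Φ y ∈ φ.source := fun y => by
    rw [OpenPartialHomeomorph.trans_source]
    rfl
  have htgt : ∀ z, z ∈ (Φ.toOpenPartialHomeomorph.trans φ).target ↔
      z ∈ φ.target ∧ φ.symm z ∈ Φ.target := fun y => by
    rw [OpenPartialHomeomorph.trans_target]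
    rfl
  refine ⟨Φ.toOpenPartialHomeomorph.trans φ, ?_, ⟨?_, ?_⟩, ?_⟩
  · rw [hsrc, ← hΦ hxΦ]
    exact ⟨hxΦ, hx⟩
  · exact hφ.contMDiffOn.comp (Φ.contMDiffOn_toFun.mono fun y hy => ((hsrc y).1 hy).1)
      fun y hy => ((hsrc y).1 hy).2
  · exact Φ.contMDiffOn_invFun.comp (hφ.contMDiffOn_symm.mono fun z hz => ((htgt z).1 hz).1)
      fun z hz => ((htgt z).1 hz).2
  · intro z hz
    obtain ⟨h1, h2⟩ := (htgt z).1 hz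
    refine ⟨h1, ?_⟩
    change p (Φ.toPartialEquiv.symm (φ.symm z)) = φ.symm z
    rw [hΦ (Φ.map_target h2)]
    exact Φ.right_inv h2

/-- The deck group of the universal cover is transitive on the fibres. -/
theorem IsSmoothUniversalCover.exists_deck (hp : IsSmoothUniversalCover E E p) {x y : X'}
    (h : p x = p y) : ∃ γ : deckGroup p, γ.1 x = y := by
  have := hp.simplyConnected
  have : LocallyPathConnectedSpace X' := ChartedSpace.locallyPathConnectedSpace E X'
  have hc : Continuous p := hp.contMDiff.continuous
  -- Lift `p` through itself, once with `x ↦ y` and once with `y ↦ x`. Uniqueness of lifts makes the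
  -- two maps inverse to each other.
  obtain ⟨F, ⟨hF, hpF⟩, -⟩ := hp.isCoveringMap.existsUnique_continuousMap_lifts ⟨p, hc⟩ x y h.symm
  obtain ⟨G, ⟨hG, hpG⟩, -⟩ := hp.isCoveringMap.existsUnique_continuousMap_lifts ⟨p, hc⟩ y x h
  have hF' : ∀ w, p (F w) = p w := fun w => congrFun hpF w
  have hG' : ∀ w, p (G w) = p w := fun w => congrFun hpG w
  have h1 : G ∘ F = id := hp.isCoveringMap.eq_of_comp_eq (by fun_prop) continuous_id
    (funext fun w => (hG' (F w)).trans (hF' w)) x (by simp [hF, hG])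
  have h2 : F ∘ G = id := hp.isCoveringMap.eq_of_comp_eq (by fun_prop) continuous_id
    (funext fun w => (hF' (G w)).trans (hG' w)) y (by simp [hF, hG])
  exact ⟨⟨⟨⟨F, G, congrFun h1, congrFun h2⟩, F.continuous, G.continuous⟩, hF'⟩, hF⟩

/-- Near `x`, a deck transformation is `p` followed by a smooth local inverse of `p` at `γ x`. -/
theorem IsSmoothUniversalCover.deck_contMDiff (hp : IsSmoothUniversalCover E E p)
    (γ : deckGroup p) : ContMDiff 𝓘(ℝ, E) 𝓘(ℝ, E) ∞ γ.1 := by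
  intro x
  obtain ⟨Φ, hxΦ, hΦ⟩ := hp.isLocalDiffeomorph (γ.1 x)
  have hx : p x ∈ Φ.target := by
    rw [← γ.2 x, hΦ hxΦ]
    exact Φ.map_source hxΦ
  have h1 : ContMDiffAt 𝓘(ℝ, E) 𝓘(ℝ, E) ∞ (Φ.toPartialEquiv.symm ∘ p) x :=
    (Φ.contMDiffOn_invFun.contMDiffAt (Φ.open_target.mem_nhds hx)).comp x hp.contMDiff.contMDiffAt
  refine h1.congr_of_eventuallyEq ?_
  filter_upwards [γ.1.continuous.continuousAt.preimage_mem_nhds (Φ.open_source.mem_nhds hxΦ)]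
    with y hy
  have h2 : p y = Φ (γ.1 y) := by rw [← γ.2 y, hΦ hy]
  change γ.1 y = Φ.toPartialEquiv.symm (p y)
  rw [h2]
  exact (Φ.left_inv hy).symm

/-- A substitute for a compact fundamental domain: finitely many images of compact neighbourhoods
cover the base. -/
theorem IsSmoothUniversalCover.exists_compact [CompactSpace X] (hp : IsSmoothUniversalCover E E p) :
    ∃ K : Set X', IsCompact K ∧ p '' K = univ := by
  have : LocallyCompactSpace X' := ChartedSpace.locallyCompactSpace E X'
  have h : ∃ K : Set X', IsCompact K ∧ univ ⊆ p '' K := by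
    refine isCompact_univ.induction_on (p := fun S => ∃ K : Set X', IsCompact K ∧ S ⊆ p '' K)
      ⟨∅, isCompact_empty, by simp⟩ ?_ ?_ ?_
    · rintro s t hst ⟨K, hK, h⟩
      exact ⟨K, hK, hst.trans h⟩
    · rintro s t ⟨K, hK, h⟩ ⟨L, hL, h'⟩
      exact ⟨K ∪ L, hK.union hL, by
        rw [image_union]
        exact union_subset_union h h'⟩
    · intro x _
      obtain ⟨x', rfl⟩ := hp.surjective x
      obtain ⟨K, hK, hx⟩ := exists_compact_mem_nhds x'
      exact ⟨p '' K, mem_nhdsWithin_of_mem_nhds (hp.isLocalDiffeomorph.isOpenMap.image_mem_nhds hx),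
        K, hK, subset_rfl⟩
  obtain ⟨K, hK, h⟩ := h
  exact ⟨K, hK, univ_subset_iff.1 h⟩

end Covers

/-! ### A maximum principle for functions determined on a compact set. -/

section MaximumPrinciple

/-- Moving from `t` towards `0` stays in the interval even when `t = t₀`; this one direction already
gives the sign. -/
theorem HasDerivWithinAt.nonneg_of_max {φ : ℝ → ℝ} {d t t₀ : ℝ} (ht : 0 < t) (ht₀ : t ≤ t₀)
    (h : HasDerivWithinAt φ d (Icc 0 t₀) t) (hmax : ∀ s ∈ Icc 0 t₀, φ s ≤ φ t) : 0 ≤ d := by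
  have h1 : IsLocalMaxOn φ (Icc 0 t₀) t :=
    (show IsMaxOn φ (Icc 0 t₀) t from fun s hs => hmax s hs).localize
  have hseg : segment ℝ t 0 ⊆ Icc 0 t₀ :=
    (convex_Icc (0 : ℝ) t₀).segment_subset ⟨ht.le, ht₀⟩ ⟨le_rfl, ht.le.trans ht₀⟩
  have h2 := h1.hasFDerivWithinAt_nonpos h.hasFDerivWithinAt
    (sub_mem_posTangentConeAt_of_segment_subset hseg)
  simp at h2
  nlinarith

/-- A maximum principle: a nonnegative function vanishing at time `0`, determined by its values
on a compact set, which grows at most exponentially at its spatial maxima, vanishes. -/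
theorem eq_zero_of_growth_at_max {Z : Type*} [TopologicalSpace Z] {t₀ : ℝ} {u : ℝ → Z → ℝ}
    (hu : ∀ t ∈ Icc 0 t₀, ∀ x, 0 ≤ u t x)
    (hc : ContinuousOn (fun q : ℝ × Z => u q.1 q.2) (Icc 0 t₀ ×ˢ univ))
    {K : Set Z} (hK : IsCompact K) (hKu : ∀ x, ∃ y ∈ K, ∀ t ∈ Icc 0 t₀, u t x = u t y)
    (hloc : ∀ q₀ ∈ Icc 0 t₀ ×ˢ (univ : Set Z), ∃ C, ∀ᶠ q in 𝓝[Icc 0 t₀ ×ˢ univ] q₀,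
      ∃ d, HasDerivWithinAt (fun s => u s q.2) d (Icc 0 t₀) q.1 ∧
        (IsLocalMax (u q.1) q.2 → d ≤ C * u q.1 q.2))
    (h0 : ∀ x, u 0 x = 0) : ∀ t ∈ Icc 0 t₀, ∀ x, u t x = 0 := by
  set S : Set (ℝ × Z) := Icc 0 t₀ ×ˢ K with hS
  have hSc : IsCompact S := isCompact_Icc.prod hK
  have hsub : S ⊆ Icc 0 t₀ ×ˢ univ := prod_mono_right (subset_univ _)
  -- Local constants combine over finitely many pieces by taking maxima, which is legitimate because
  -- `u ≥ 0`.
  obtain ⟨C, hC⟩ : ∃ C, ∀ q ∈ S, ∃ d, HasDerivWithinAt (fun s => u s q.2) d (Icc 0 t₀) q.1 ∧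
      (IsLocalMax (u q.1) q.2 → d ≤ C * u q.1 q.2) := by
    have h : ∃ C, ∀ q ∈ S, q ∈ S → ∃ d, HasDerivWithinAt (fun s => u s q.2) d (Icc 0 t₀) q.1 ∧
        (IsLocalMax (u q.1) q.2 → d ≤ C * u q.1 q.2) := by
      refine hSc.induction_on (p := fun T => ∃ C, ∀ q ∈ T, q ∈ S → ∃ d,
        HasDerivWithinAt (fun s => u s q.2) d (Icc 0 t₀) q.1 ∧
          (IsLocalMax (u q.1) q.2 → d ≤ C * u q.1 q.2)) ⟨0, by simp⟩ ?_ ?_ ?_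
      · rintro s t hst ⟨C, h⟩
        exact ⟨C, fun q hq => h q (hst hq)⟩
      · rintro s t ⟨C, h⟩ ⟨C', h'⟩
        refine ⟨max C C', fun q hq hqS => ?_⟩
        have hpos := hu q.1 (hsub hqS).1 q.2
        rcases hq with hq | hq
        · obtain ⟨d, hd, hd'⟩ := h q hq hqS
          exact ⟨d, hd, fun hm => (hd' hm).trans
            (mul_le_mul_of_nonneg_right (le_max_left _ _) hpos)⟩
        · obtain ⟨d, hd, hd'⟩ := h' q hq hqS
          exact ⟨d, hd, fun hm => (hd' hm).trans
            (mul_le_mul_of_nonneg_right (le_max_right _ _) hpos)⟩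
      · intro q hq
        obtain ⟨C, hC⟩ := hloc q (hsub hq)
        exact ⟨_, nhdsWithin_mono q hsub hC, C, fun q hq _ => hq⟩
    obtain ⟨C, hC⟩ := h
    exact ⟨C, fun q hq => hC q hq hq⟩
  intro t ht x
  obtain ⟨y, hy, hxy⟩ := hKu x
  rw [hxy t ht]
  -- With `C + 1` instead of `C`, a positive maximum of `v` is contradictory: it would give `(C + 1)
  -- u ≤ d ≤ C u` with `u > 0`.
  set v : ℝ × Z → ℝ := fun q => Real.exp (-((C + 1) * q.1)) * u q.1 q.2 with hv
  have hvc : ContinuousOn v S :=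
    (Continuous.continuousOn (by fun_prop)).mul (hc.mono hsub)
  obtain ⟨q, hqS, hq⟩ := hSc.exists_isMaxOn ⟨(t, y), ht, hy⟩ hvc
  by_contra hne
  have hpos : 0 < v q := by
    refine lt_of_lt_of_le ?_ (hq (show (t, y) ∈ S from ⟨ht, hy⟩))
    exact mul_pos (Real.exp_pos _) (lt_of_le_of_ne (hu t ht y) (Ne.symm hne))
  have huq : 0 < u q.1 q.2 := by
    have := Real.exp_pos (-((C + 1) * q.1))
    exact pos_of_mul_pos_right hpos this.le
  have hq0 : 0 < q.1 := by
    refine lt_of_le_of_ne hqS.1.1 fun h => ?_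
    rw [← h, h0] at huq
    exact lt_irrefl _ huq
  -- The maximum was taken over `K` only, but every value of `u` at time `q.1` occurs on `K`, so it
  -- is a maximum over the whole space.
  have hmax : IsLocalMax (u q.1) q.2 := by
    refine Eventually.of_forall fun w => ?_
    obtain ⟨w', hw', hww'⟩ := hKu w
    rw [hww' q.1 hqS.1]
    have h1 : v (q.1, w') ≤ v q := hq (show (q.1, w') ∈ S from ⟨hqS.1, hw'⟩)
    exact le_of_mul_le_mul_left h1 (Real.exp_pos _)
  obtain ⟨d, hd, hd'⟩ := hC q hqS
  have hexp : HasDerivWithinAt (fun s : ℝ => Real.exp (-((C + 1) * s)))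
      (Real.exp (-((C + 1) * q.1)) * -((C + 1) * 1)) (Icc 0 t₀) q.1 :=
    ((((hasDerivAt_id q.1).const_mul (C + 1)).neg).exp).hasDerivWithinAt
  have hnn := (hexp.mul hd).nonneg_of_max hq0 hqS.1.2 fun s hs =>
    hq (show (s, q.2) ∈ S from ⟨hs, hqS.2⟩)
  have hE := Real.exp_pos (-((C + 1) * q.1))
  have h3 : 0 ≤ Real.exp (-((C + 1) * q.1)) * (d - (C + 1) * u q.1 q.2) := by
    convert hnn using 1
    ring
  have h4 := nonneg_of_mul_nonneg_right h3 hE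
  have h5 := hd' hmax
  linarith

end MaximumPrinciple

/-! ### The leafwise energy, its invariance and its chart expression. -/

section LeafwiseEnergy

universe v

variable {E : Type*} [NormedAddCommGroup E] [NormedSpace ℝ E] [FiniteDimensional ℝ E]
  {X : Type v} [TopologicalSpace X] [ChartedSpace E X] [IsManifold 𝓘(ℝ, E) ∞ X]
  {X' : Type*} [TopologicalSpace X'] [ChartedSpace E X'] [IsManifold 𝓘(ℝ, E) ∞ X']
  {p : X' → X}
  {E' : Type*} [NormedAddCommGroup E'] [NormedSpace ℝ E'] [FiniteDimensional ℝ E']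
  {Y : Type*} [TopologicalSpace Y] [ChartedSpace E' Y] [IsManifold 𝓘(ℝ, E') ∞ Y]
  {m n : ℕ}

/-- On a compact manifold, the tangent spaces of a foliation are spanned by finitely many smooth
tangent fields. -/
theorem Foliation.exists_spanning_fields [T2Space X] [CompactSpace X] (𝓕 : Foliation E X m n) :
    ∃ (ι : Type v) (_ : Fintype ι) (V : ι → VField E X), (∀ j x, SmoothVFieldAt (V j) x) ∧
      (∀ j x, V j x ∈ 𝓕.tangent x) ∧
      ∀ x, 𝓕.tangent x ≤ Submodule.span ℝ (range fun j => V j x) := by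
  have hloc : ∀ x : X, ∃ V : Fin m → VField E X, (∀ j y, SmoothVFieldAt (V j) y) ∧
      (∀ j y, V j y ∈ 𝓕.tangent y) ∧
      ∀ᶠ y in 𝓝 x, 𝓕.tangent y ≤ Submodule.span ℝ (range fun j => V j y) := by
    intro x
    obtain ⟨φ, hx, hφ⟩ := 𝓕.exists_chart x
    have hs := hφ.isSmoothChart
    choose V hV hV0 hVx using fun j : Fin m =>
      hs.exists_field hx (EuclideanSpace.basisFun (Fin m) ℝ j, 0)
    refine ⟨V, hV, fun j y => ?_, ?_⟩
    · rcases hV0 j y with h | ⟨b, hy, h⟩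
      · rw [h]
        exact zero_mem _
      · rw [h]
        exact (𝓕.tangent y).smul_mem b (hφ.tderiv_symm_mem hy _)
    · filter_upwards [φ.open_source.mem_nhds hx, eventually_all.2 hVx] with y hy hVy w hw
      set a := (tderiv E (EuclideanSpace ℝ (Fin m) × EuclideanSpace ℝ (Fin n)) φ y w).1 with ha
      have h1 : tderiv E (EuclideanSpace ℝ (Fin m) × EuclideanSpace ℝ (Fin n)) φ y w = (a, 0) :=
        Prod.ext rfl ((hφ.mem_iff_snd hy w).1 hw)
      have h2 := hs.tderiv_symm_tderiv hy w
      rw [h1] at h2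
      have h3 : ((a, 0) : EuclideanSpace ℝ (Fin m) × EuclideanSpace ℝ (Fin n)) =
          ∑ j, a j • ((EuclideanSpace.basisFun (Fin m) ℝ j, 0) :
            EuclideanSpace ℝ (Fin m) × EuclideanSpace ℝ (Fin n)) := by
        refine Prod.ext ?_ (by simp [Prod.snd_sum])
        rw [Prod.fst_sum]
        have := (EuclideanSpace.basisFun (Fin m) ℝ).sum_repr a
        simpa using this.symm
      rw [h3, map_sum] at h2
      rw [← h2]
      refine Submodule.sum_mem _ fun j _ => ?_
      rw [map_smul, ← hVy j]
      exact Submodule.smul_mem _ _ (Submodule.subset_span ⟨j, rfl⟩)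
  choose V hV hVD hVs using hloc
  obtain ⟨t, ht⟩ := isCompact_univ.elim_nhds_subcover
    (fun x => {y | 𝓕.tangent y ≤ Submodule.span ℝ (range fun j => V x j y)}) fun x _ => hVs x
  -- The tangent bundle of the leaves need not be trivial, so a redundant spanning family replaces a
  -- frame.
  refine ⟨t × Fin m, inferInstance, fun i => V i.1 i.2, fun i => hV _ _, fun i => hVD _ _,
    fun x => ?_⟩
  obtain ⟨y, hy, hxy⟩ := mem_iUnion₂.1 (ht.2 (mem_univ x))
  refine le_trans hxy (Submodule.span_mono ?_)
  rintro - ⟨j, rfl⟩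
  exact ⟨(⟨y, hy⟩, j), rfl⟩

/-- The lift of a vector field to a cover. -/
def coverLift (p : X' → X) (V : VField E X) (x : X') : E := (tderiv E E p x).inverse (V (p x))

theorem IsSmoothUniversalCover.tderiv_coverLift (hp : IsSmoothUniversalCover E E p)
    (V : VField E X) (x : X') : tderiv E E p x (coverLift p V x) = V (p x) := by
  obtain ⟨e, he⟩ := hp.exists_equiv x
  rw [coverLift, ← he, ContinuousLinearMap.inverse_equiv]
  exact e.apply_symm_apply _

theorem IsSmoothUniversalCover.eq_coverLift (hp : IsSmoothUniversalCover E E p)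
    (V : VField E X) {x : X'} {w : E} (h : tderiv E E p x w = V (p x)) : coverLift p V x = w := by
  obtain ⟨e, he⟩ := hp.exists_equiv x
  have := (hp.tderiv_coverLift V x).trans h.symm
  rw [← he] at this
  exact e.injective this

/-- A lift of a chart to a cover. -/
structure IsLiftedChart {E₁ : Type*} [NormedAddCommGroup E₁] [NormedSpace ℝ E₁] (p : X' → X)
    (φ : OpenPartialHomeomorph X E₁) (θ : OpenPartialHomeomorph X' E₁) : Prop where
  isSmoothChart : IsSmoothChart E θ
  mem_target : ∀ z ∈ θ.target, z ∈ φ.target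
  map_symm : ∀ z ∈ θ.target, p (θ.symm z) = φ.symm z

theorem IsLiftedChart.tderiv_tderiv {E₁ : Type*} [NormedAddCommGroup E₁] [NormedSpace ℝ E₁]
    {φ : OpenPartialHomeomorph X E₁} {θ : OpenPartialHomeomorph X' E₁}
    (hθ : IsLiftedChart (E := E) p φ θ) (hp : IsSmoothUniversalCover E E p) {z : E₁}
    (hz : z ∈ θ.target) (c : E₁) :
    tderiv E E p (θ.symm z) (tderiv E₁ E θ.symm z c) = tderiv E₁ E φ.symm z c := by
  have h1 : (p ∘ θ.symm : E₁ → X) =ᶠ[𝓝 z] φ.symm := by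
    filter_upwards [θ.open_target.mem_nhds hz] with w hw using hθ.map_symm w hw
  have h2 := tderiv_comp (g := p) (f := θ.symm) hp.contMDiff.contMDiffAt.mdiff
    (hθ.isSmoothChart.contMDiffAt_symm hz).mdiff
  rw [← tderiv_congr h1, h2]
  rfl

theorem IsLiftedChart.chartForm_eq {E₁ : Type*} [NormedAddCommGroup E₁] [NormedSpace ℝ E₁]
    {φ : OpenPartialHomeomorph X E₁} {θ : OpenPartialHomeomorph X' E₁}
    (hθ : IsLiftedChart (E := E) p φ θ) (hp : IsSmoothUniversalCover E E p) (B : BilinField E X)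
    {z : E₁} (hz : z ∈ θ.target) :
    chartForm (pullbackBilin p B : BilinField E X') θ z = chartForm B φ z := by
  have h1 : (p ∘ θ.symm : E₁ → X) =ᶠ[𝓝 z] φ.symm := by
    filter_upwards [θ.open_target.mem_nhds hz] with w hw using hθ.map_symm w hw
  exact (pullbackBilin_comp (s := θ.symm) (p := p) B hp.contMDiff.contMDiffAt.mdiff
    (hθ.isSmoothChart.contMDiffAt_symm hz).mdiff).symm.trans (pullbackBilin_congr h1 B)

theorem IsLiftedChart.coverLift_eq {D : Distribution E X}
    {φ : OpenPartialHomeomorph X (EuclideanSpace ℝ (Fin m) × EuclideanSpace ℝ (Fin n))}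
    {θ : OpenPartialHomeomorph X' (EuclideanSpace ℝ (Fin m) × EuclideanSpace ℝ (Fin n))}
    (hθ : IsLiftedChart (E := E) p φ θ) (hp : IsSmoothUniversalCover E E p)
    (hφ : IsFoliatedChart D φ) {V : VField E X} (hV : ∀ x, V x ∈ D x)
    {z : EuclideanSpace ℝ (Fin m) × EuclideanSpace ℝ (Fin n)} (hz : z ∈ θ.target) :
    coverLift p V (θ.symm z) =
      tderiv (EuclideanSpace ℝ (Fin m) × EuclideanSpace ℝ (Fin n)) E θ.symm z ((chartField φ V z).1, 0) := by
  have hzφ := hθ.mem_target z hz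
  apply hp.eq_coverLift
  rw [hθ.tderiv_tderiv hp hz]
  have h1 : chartField φ V z = ((chartField φ V z).1, 0) :=
    Prod.ext rfl ((hφ.mem_iff_snd (φ.map_target hzφ) _).1 (hV _))
  rw [← h1]
  have h2 := hφ.isSmoothChart.tderiv_symm_tderiv (φ.map_target hzφ) (V (φ.symm z))
  rw [φ.right_inv hzφ] at h2
  refine h2.trans ?_
  exact (congrArg (fun y => (V y : E)) (hθ.map_symm z hz)).symm

/-- The leafwise energy density of a map, in terms of tangent fields of the foliation. -/
def tangentEnergy {ι : Type*} [Fintype ι] (h : BilinField E' Y) (p : X' → X) (V : ι → VField E X)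
    (f : X' → Y) (x : X') : ℝ :=
  ∑ j, bil h (f x) (tderiv E E' f x (coverLift p (V j) x)) (tderiv E E' f x (coverLift p (V j) x))

theorem tangentEnergy_nonneg {ι : Type*} [Fintype ι] {h : BilinField E' Y} (hh : IsSmoothMetric h)
    (V : ι → VField E X) (f : X' → Y) (x : X') : 0 ≤ tangentEnergy h p V f x :=
  Finset.sum_nonneg fun _ _ => (hh.isInner _).nonneg _

theorem tangentEnergy_eq_zero_iff {ι : Type*} [Fintype ι] {h : BilinField E' Y}
    (hh : IsSmoothMetric h) (V : ι → VField E X) (f : X' → Y) (x : X') :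
    tangentEnergy h p V f x = 0 ↔ ∀ j, tderiv E E' f x (coverLift p (V j) x) = 0 := by
  rw [tangentEnergy, Finset.sum_eq_zero_iff_of_nonneg fun _ _ => (hh.isInner _).nonneg _]
  refine ⟨fun h0 j => ?_, fun h0 j _ => by simp [h0 j]⟩
  by_contra hne
  exact ((hh.isInner _).pos _ hne).ne' (h0 j (Finset.mem_univ j))

theorem coordMetric_tderiv (h : BilinField E' Y) {c y : Y}
    (hy : y ∈ (extChartAt 𝓘(ℝ, E') c).source) (v w : E') :
    coordMetric h c (extChartAt 𝓘(ℝ, E') c y) (tderiv E' E' (extChartAt 𝓘(ℝ, E') c) y v)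
      (tderiv E' E' (extChartAt 𝓘(ℝ, E') c) y w) = bil h y v w := by
  set κ := extChartAt 𝓘(ℝ, E') c with hκ
  have h1 : (κ.symm ∘ κ : Y → Y) =ᶠ[𝓝 y] id := by
    filter_upwards [(isOpen_extChartAt_source c).mem_nhds hy] with w hw using κ.left_inv hw
  have h2 := tderiv_comp (g := κ.symm) (f := κ) (contMDiffAt_chart_symm (κ.map_source hy)).mdiff
    (contMDiffAt_chart hy).mdiff
  rw [tderiv_congr h1, tderiv_id] at h2
  have h3 : ∀ v, tderiv E' E' κ.symm (κ y) (tderiv E' E' κ y v) = v := fun v =>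
    (DFunLike.congr_fun h2 v).symm
  rw [coordMetric_eq, pullbackBilin_eq, ContinuousLinearMap.bilinearComp_apply, h3, h3,
    κ.left_inv hy]

/-- The leafwise energy density in charts. -/
theorem IsLiftedChart.tangentEnergy_eq {ι : Type*} [Fintype ι] {D : Distribution E X}
    {φ : OpenPartialHomeomorph X (EuclideanSpace ℝ (Fin m) × EuclideanSpace ℝ (Fin n))}
    {θ : OpenPartialHomeomorph X' (EuclideanSpace ℝ (Fin m) × EuclideanSpace ℝ (Fin n))}
    (hθ : IsLiftedChart (E := E) p φ θ) (hp : IsSmoothUniversalCover E E p)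
    (hφ : IsFoliatedChart D φ) {V : ι → VField E X} (hV : ∀ j x, V j x ∈ D x)
    (h : BilinField E' Y) {f : ℝ → X' → Y} {c : Y} {t : ℝ}
    {z : EuclideanSpace ℝ (Fin m) × EuclideanSpace ℝ (Fin n)} (hz : z ∈ θ.target)
    (hf : ContMDiffAt 𝓘(ℝ, E) 𝓘(ℝ, E') ∞ (f t) (θ.symm z))
    (hc : f t (θ.symm z) ∈ (extChartAt 𝓘(ℝ, E') c).source) :
    tangentEnergy h p V (f t) (θ.symm z) =
      leafEnergy (coordMetric h c) (fun j z => (chartField φ (V j) z).1)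
        (fun q => extChartAt 𝓘(ℝ, E') c (f q.1 (θ.symm q.2))) (t, z) := by
  refine Finset.sum_congr rfl fun j _ => ?_
  have h1 : leafSpaceDeriv (fun q : ℝ × (EuclideanSpace ℝ (Fin m) × EuclideanSpace ℝ (Fin n)) =>
      extChartAt 𝓘(ℝ, E') c (f q.1 (θ.symm q.2))) (t, z) (chartField φ (V j) z).1 =
      tderiv E' E' (extChartAt 𝓘(ℝ, E') c) (f t (θ.symm z))
        (tderiv E E' (f t) (θ.symm z) (coverLift p (V j) (θ.symm z))) := by
    rw [hθ.coverLift_eq hp hφ (hV j) hz]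
    have hs := hθ.isSmoothChart.contMDiffAt_symm hz
    have h2 := tderiv_comp (g := extChartAt 𝓘(ℝ, E') c) (f := f t ∘ θ.symm)
      (contMDiffAt_chart hc).mdiff (hf.comp z hs).mdiff
    have h3 := tderiv_comp (g := f t) (f := θ.symm) hf.mdiff hs.mdiff
    rw [tderiv_eq_fderiv, h3] at h2
    exact DFunLike.congr_fun h2 ((chartField φ (V j) z).1, 0)
  rw [h1]
  exact (coordMetric_tderiv h hc _ _).symm

/-- Lifted fields are invariant under deck transformations, and equivariance changes `df` by the
differential of `ρ γ`, an isometry. Invariance reduces the analysis to a compact set. -/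
theorem tangentEnergy_deck (hp : IsSmoothUniversalCover E E p) {ι : Type*} [Fintype ι]
    (h : BilinField E' Y) {ρ : deckGroup p →* isometryGroup h} (V : ι → VField E X) {f : X' → Y}
    (hf : ContMDiff 𝓘(ℝ, E) 𝓘(ℝ, E') ∞ f) (hρ : IsEquivariant p ρ f) (γ : deckGroup p) (x : X') :
    tangentEnergy h p V f (γ.1 x) = tangentEnergy h p V f x := by
  refine Finset.sum_congr rfl fun j _ => ?_
  have hγ := (hp.deck_contMDiff γ x).mdiff
  have h1 : coverLift p (V j) (γ.1 x) = tderiv E E γ.1 x (coverLift p (V j) x) := by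
    apply hp.eq_coverLift
    have h2 := tderiv_comp (g := p) (f := γ.1) (hp.contMDiff (γ.1 x)).mdiff hγ
    have h3 : (p ∘ γ.1 : X' → X) = p := funext γ.2
    rw [h3] at h2
    refine (DFunLike.congr_fun h2 _).symm.trans ((hp.tderiv_coverLift _ _).trans ?_)
    exact (congrArg (fun y => (V j y : E)) (γ.2 x)).symm
  have h2 : tderiv E E' f (γ.1 x) (coverLift p (V j) (γ.1 x)) =
      tderiv E' E' (ρ γ).1 (f x) (tderiv E E' f x (coverLift p (V j) x)) := by
    have h3 : (f ∘ γ.1 : X' → Y) = (ρ γ).1 ∘ f := funext (hρ γ)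
    have h4 := tderiv_comp (g := f) (f := γ.1) (hf _).mdiff hγ
    have h5 := tderiv_comp (g := (ρ γ).1) (f := f) (((ρ γ).2.1 (f x)).mdiff) (hf x).mdiff
    rw [h3, h5] at h4
    rw [h1]
    exact (DFunLike.congr_fun h4 _).symm
  rw [h2, hρ γ x]
  exact (ρ γ).2.2.2 (f x) _ _

end LeafwiseEnergy

/-! ### The heat flow on the cover, read in lifted foliated charts. -/

section Flow

universe v

variable {E : Type*} [NormedAddCommGroup E] [NormedSpace ℝ E] [FiniteDimensional ℝ E]
  {X : Type v} [TopologicalSpace X] [ChartedSpace E X] [IsManifold 𝓘(ℝ, E) ∞ X]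
  {X' : Type*} [TopologicalSpace X'] [ChartedSpace E X'] [IsManifold 𝓘(ℝ, E) ∞ X']
  {p : X' → X}
  {E' : Type*} [NormedAddCommGroup E'] [NormedSpace ℝ E'] [FiniteDimensional ℝ E']
  {Y : Type*} [TopologicalSpace Y] [ChartedSpace E' Y] [IsManifold 𝓘(ℝ, E') ∞ Y]
  {m n : ℕ} {D : Distribution E X}
  {φ : OpenPartialHomeomorph X (EuclideanSpace ℝ (Fin m) × EuclideanSpace ℝ (Fin n))}
  {θ : OpenPartialHomeomorph X' (EuclideanSpace ℝ (Fin m) × EuclideanSpace ℝ (Fin n))}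

theorem IsHeatFlow.contMDiff {B : BilinField E X'} {h : BilinField E' Y} {t₀ : ℝ} {f : ℝ → X' → Y}
    (hf : IsHeatFlow B h t₀ f) {t : ℝ} (ht : t ∈ Icc 0 t₀) :
    ContMDiff 𝓘(ℝ, E) 𝓘(ℝ, E') ∞ (f t) := by
  have h1 : ContMDiff 𝓘(ℝ, E) (𝓘(ℝ, ℝ).prod 𝓘(ℝ, E)) ∞ (fun x : X' => (t, x)) :=
    contMDiff_const.prodMk contMDiff_id
  exact contMDiffOn_univ.1 (hf.smooth.comp h1.contMDiffOn fun x _ => ⟨ht, mem_univ _⟩)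

/-- The heat flow equation in charts. -/
theorem IsHeatFlow.derivWithin_eq {B : BilinField E X'} (hB : IsSmoothMetric B)
    {h : BilinField E' Y} (hh : IsSmoothMetric h) {t₀ : ℝ} (ht₀ : 0 < t₀) {f : ℝ → X' → Y}
    (hf : IsHeatFlow B h t₀ f) {E₁ : Type*} [NormedAddCommGroup E₁] [NormedSpace ℝ E₁]
    [FiniteDimensional ℝ E₁] {θ : OpenPartialHomeomorph X' E₁} (hθ : IsSmoothChart E θ)
    {t : ℝ} (ht : t ∈ Icc 0 t₀) {z : E₁} (hz : z ∈ θ.target) {c : Y}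
    (hc : f t (θ.symm z) ∈ (extChartAt 𝓘(ℝ, E') c).source) :
    derivWithin (fun s => extChartAt 𝓘(ℝ, E') c (f s (θ.symm z))) (Icc 0 t₀) t =
      metricTrace (chartForm B θ z) (fun u v => hess (chartForm B θ) (coordMetric h c)
        (fun w => extChartAt 𝓘(ℝ, E') c (f t (θ.symm w))) z u v) := by
  have h1 : ContMDiffWithinAt 𝓘(ℝ, ℝ) 𝓘(ℝ, E') ∞ (fun s => f s (θ.symm z)) (Icc 0 t₀) t := by
    have h2 : ContMDiff 𝓘(ℝ, ℝ) (𝓘(ℝ, ℝ).prod 𝓘(ℝ, E)) ∞ (fun s : ℝ => (s, θ.symm z)) :=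
      contMDiff_id.prodMk contMDiff_const
    exact (hf.smooth.comp h2.contMDiffOn fun s hs => ⟨hs, mem_univ _⟩) t ht
  have h3 := mfderiv_comp_mfderivWithin (I := 𝓘(ℝ, ℝ)) (I' := 𝓘(ℝ, E')) (I'' := 𝓘(ℝ, E'))
    (g := extChartAt 𝓘(ℝ, E') c) t (contMDiffAt_chart hc).mdiff
    (h1.mdifferentiableWithinAt (by simp))
    ((uniqueDiffOn_Icc ht₀ t ht).uniqueMDiffWithinAt)
  rw [mfderivWithin_eq_fderivWithin] at h3
  have h4 : derivWithin (fun s => extChartAt 𝓘(ℝ, E') c (f s (θ.symm z))) (Icc 0 t₀) t =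
      tderiv E' E' (extChartAt 𝓘(ℝ, E') c) (f t (θ.symm z)) (tension B h (f t) (θ.symm z)) := by
    rw [← hf.evolution t ht]
    exact DFunLike.congr_fun h3 (1 : ℝ)
  rw [h4, tderiv_tension hB hh hθ hz (hf.contMDiff ht _) hc]
  rfl

/-- At its spatial maxima, the leafwise energy density of a solution of the heat flow grows at most
exponentially. -/
theorem IsLiftedChart.exists_tangentEnergy_bound {ι : Type*} [Fintype ι]
    (hθ : IsLiftedChart (E := E) p φ θ) (hp : IsSmoothUniversalCover E E p)
    (hφ : IsFoliatedChart D φ) {g : BilinField E X} (hg : IsSmoothMetric g)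
    (hT : IsTenseMetricOn (chartForm g φ) φ.target) {h : BilinField E' Y} (hh : IsSmoothMetric h)
    {V : ι → VField E X} (hVs : ∀ j x, SmoothVFieldAt (V j) x) (hVD : ∀ j x, V j x ∈ D x)
    (hspan : ∀ x, D x ≤ Submodule.span ℝ (range fun j => V j x))
    {t₀ : ℝ} (ht₀ : 0 < t₀) {f : ℝ → X' → Y}
    (hf : IsHeatFlow (pullbackBilin p g : BilinField E X') h t₀ f)
    {q₀ : ℝ × X'} (hq₀ : q₀.1 ∈ Icc 0 t₀) (hx₀ : q₀.2 ∈ θ.source) :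
    ContinuousWithinAt (fun q : ℝ × X' => tangentEnergy h p V (f q.1) q.2)
      (Icc 0 t₀ ×ˢ univ) q₀ ∧
    ∃ C, ∀ᶠ q in 𝓝[Icc 0 t₀ ×ˢ univ] q₀,
      ∃ d, HasDerivWithinAt (fun s => tangentEnergy h p V (f s) q.2) d (Icc 0 t₀) q.1 ∧
        (IsLocalMax (tangentEnergy h p V (f q.1)) q.2 → d ≤ C * tangentEnergy h p V (f q.1) q.2) := by
  obtain ⟨t₁, x₁⟩ := q₀
  set c := f t₁ x₁ with hc
  set κ := extChartAt 𝓘(ℝ, E') c with hκ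
  have hs := hθ.isSmoothChart
  -- a neighborhood mapped into a chart
  obtain ⟨T, W, hTo, hWo, hT₁, hW₁, hTW⟩ : ∃ (T : Set ℝ) (W : Set X'), IsOpen T ∧ IsOpen W ∧
      t₁ ∈ T ∧ x₁ ∈ W ∧ ∀ t ∈ Icc 0 t₀, t ∈ T → ∀ x ∈ W, f t x ∈ κ.source := by
    have h1 : ContinuousWithinAt (fun q : ℝ × X' => f q.1 q.2) (Icc 0 t₀ ×ˢ univ) (t₁, x₁) :=
      hf.smooth.continuousOn _ ⟨hq₀, mem_univ _⟩
    have h2 := h1.preimage_mem_nhdsWithin ((isOpen_extChartAt_source c).mem_nhds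
      (mem_extChartAt_source (I := 𝓘(ℝ, E')) c))
    obtain ⟨O, hO, hO₁, hOs⟩ := mem_nhdsWithin.1 h2
    obtain ⟨T, W, hT, hW, h3, h4, h5⟩ := isOpen_prod_iff.1 hO t₁ x₁ hO₁
    exact ⟨T, W, hT, hW, h3, h4, fun t ht htT x hx =>
      hOs (⟨h5 ⟨htT, hx⟩, ht, mem_univ _⟩ : ((t, x) : ℝ × X') ∈ O ∩ Icc 0 t₀ ×ˢ univ)⟩
  -- `J` is a relative neighbourhood of `t₁`, so end points are allowed. On `J × U` the whole flow
  -- stays in one chart of the target.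
  set J : Set ℝ := Icc 0 t₀ ∩ T with hJdef
  set U : Set (EuclideanSpace ℝ (Fin m) × EuclideanSpace ℝ (Fin n)) :=
    θ.target ∩ θ.symm ⁻¹' W with hUdef
  have hJ : UniqueDiffOn ℝ J := (uniqueDiffOn_Icc ht₀).inter hTo
  have hJ' : J ⊆ closure (interior J) := by
    have h1 : Icc 0 t₀ ⊆ closure (Ioo 0 t₀) := by rw [closure_Ioo ht₀.ne]
    have h2 : T ∩ Ioo 0 t₀ ⊆ interior J := by
      rw [hJdef, interior_inter, interior_Icc, hTo.interior_eq, inter_comm]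
    exact fun s hs => closure_mono h2 (hTo.inter_closure ⟨hs.2, h1 hs.1⟩)
  have hU : IsOpen U := θ.isOpen_inter_preimage_symm hWo
  have hUt : ∀ z ∈ U, z ∈ θ.target := fun z hz => hz.1
  have hUφ : U ⊆ φ.target := fun z hz => hθ.mem_target z hz.1
  have hsrc : ∀ t ∈ J, ∀ z ∈ U, f t (θ.symm z) ∈ κ.source := fun t ht z hz =>
    hTW t ht.1 ht.2 _ hz.2
  set F : ℝ × (EuclideanSpace ℝ (Fin m) × EuclideanSpace ℝ (Fin n)) → E' :=
    fun q => κ (f q.1 (θ.symm q.2)) with hF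
  have hFc : ContDiffOn ℝ ∞ F (J ×ˢ U) := by
    intro q hq
    refine ContMDiffWithinAt.contDiffWithinAt ?_
    have h1 : ContMDiffWithinAt 𝓘(ℝ, ℝ × (EuclideanSpace ℝ (Fin m) × EuclideanSpace ℝ (Fin n)))
        (𝓘(ℝ, ℝ).prod 𝓘(ℝ, E)) ∞ (fun q : ℝ × (EuclideanSpace ℝ (Fin m) ×
          EuclideanSpace ℝ (Fin n)) => (q.1, θ.symm q.2)) (J ×ˢ U) q := by
      refine ContMDiffAt.contMDiffWithinAt (ContMDiffAt.prodMk contDiff_fst.contMDiff.contMDiffAt ?_)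
      exact (hs.contMDiffAt_symm (hUt _ hq.2)).comp q contDiff_snd.contMDiff.contMDiffAt
    have h2 := ContMDiffWithinAt.comp (t := Icc 0 t₀ ×ˢ univ) q
      (hf.smooth (q.1, θ.symm q.2) ⟨hq.1.1, mem_univ _⟩) h1 fun q' hq' => ⟨hq'.1.1, mem_univ _⟩
    exact (contMDiffAt_chart (hsrc q.1 hq.1 q.2 hq.2)).comp_contMDiffWithinAt q h2
  have hFO : ∀ q ∈ J ×ˢ U, F q ∈ κ.target := fun q hq => κ.map_source (hsrc q.1 hq.1 q.2 hq.2)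
  have hev : ∀ q ∈ J ×ˢ U, timeDeriv J F q = metricTrace (chartForm g φ q.2)
      fun u v => hess (chartForm g φ) (coordMetric h c) (fun y => F (q.1, y)) q.2 u v := by
    intro q hq
    have h1 : timeDeriv J F q = derivWithin (fun s => κ (f s (θ.symm q.2))) (Icc 0 t₀) q.1 :=
      derivWithin_inter (hTo.mem_nhds hq.1.2)
    -- In a lifted chart the pulled-back metric has the coefficients of `g` in `φ`, so tenseness
    -- proved on the base applies upstairs.
    have h2 : chartForm (pullbackBilin p g : BilinField E X') θ =ᶠ[𝓝 q.2] chartForm g φ := by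
      filter_upwards [θ.open_target.mem_nhds (hUt _ hq.2)] with w hw using hθ.chartForm_eq hp g hw
    rw [h1, hf.derivWithin_eq (hp.isSmoothMetric hg) hh ht₀ hs hq.1.1 (hUt _ hq.2)
      (hsrc q.1 hq.1 q.2 hq.2), h2.self_of_nhds]
    simp only [hess, hessFlat, levi_congr h2]
    rfl
  have hcc : ∀ j, ContDiffOn ℝ ∞ (fun z => (chartField φ (V j) z).1) U := fun j z hz =>
    (hφ.isSmoothChart.contDiffAt_chartField (hUφ hz) (hVs j _)).fst.contDiffWithinAt
  have hcs : ∀ z ∈ U, ∀ w : EuclideanSpace ℝ (Fin m) →L[ℝ] E',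
      (∀ j, w (chartField φ (V j) z).1 = 0) → w = 0 := by
    intro z hz w hw
    have hx := φ.map_target (hUφ hz)
    set L : E →L[ℝ] E' := w.comp ((ContinuousLinearMap.fst ℝ _ _).comp
      (tderiv E (EuclideanSpace ℝ (Fin m) × EuclideanSpace ℝ (Fin n)) φ (φ.symm z))) with hL
    have hker : D (φ.symm z) ≤ LinearMap.ker (L : E →ₗ[ℝ] E') :=
      (hspan _).trans (Submodule.span_le.2 (by
        rintro - ⟨j, rfl⟩
        exact hw j))
    ext1 a
    have h1 := hker (hφ.tderiv_symm_mem hx a)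
    have h2 : w (tderiv E (EuclideanSpace ℝ (Fin m) × EuclideanSpace ℝ (Fin n)) φ (φ.symm z)
      (tderiv (EuclideanSpace ℝ (Fin m) × EuclideanSpace ℝ (Fin n)) E φ.symm (φ (φ.symm z))
        (a, 0))).1 = 0 := h1
    rwa [hφ.isSmoothChart.tderiv_tderiv_symm hx] at h2
  have hho : ContDiffOn ℝ ∞ (coordMetric h c) κ.target := hh.contDiffOn c
  set u := leafEnergy (coordMetric h c) (fun j z => (chartField φ (V j) z).1) F with hu
  have huc : ContDiffOn ℝ ∞ u (J ×ˢ U) := ContDiffOn.leafEnergy hJ hU hho hFc hFO hcc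
  have hz₁ : θ x₁ ∈ U := ⟨θ.map_source hx₀, by
    change θ.symm (θ x₁) ∈ W
    rwa [θ.left_inv hx₀]⟩
  have htz : (t₁, θ x₁) ∈ J ×ˢ U := ⟨⟨hq₀, hT₁⟩, hz₁⟩
  have heq : ∀ t ∈ J, ∀ z ∈ U, tangentEnergy h p V (f t) (θ.symm z) = u (t, z) := fun t ht z hz =>
    hθ.tangentEnergy_eq hp hφ hVD h (hUt z hz) (hf.contMDiff ht.1 _) (hsrc t ht z hz)
  have heq' : ∀ t ∈ J, ∀ x ∈ θ.source, θ x ∈ U → tangentEnergy h p V (f t) x = u (t, θ x) :=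
    fun t ht x hx hxU => by rw [← heq t ht _ hxU, θ.left_inv hx]
  have hθc : ContinuousAt θ x₁ := θ.continuousAt hx₀
  have hnear : ∀ᶠ q in 𝓝[Icc 0 t₀ ×ˢ (univ : Set X')] (t₁, x₁),
      q.1 ∈ J ∧ q.2 ∈ θ.source ∧ θ q.2 ∈ U := by
    have h1 : ∀ᶠ q in 𝓝 (t₁, x₁), q.1 ∈ T ∧ q.2 ∈ θ.source ∧ θ q.2 ∈ U := by
      have h2 : ∀ᶠ t in 𝓝 t₁, t ∈ T := hTo.mem_nhds hT₁
      have h3 : ∀ᶠ x in 𝓝 x₁, x ∈ θ.source ∧ θ x ∈ U :=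
        (θ.open_source.eventually_mem hx₀).and (hθc.eventually (hU.mem_nhds hz₁))
      exact Filter.Eventually.prod_nhds h2 h3
    filter_upwards [mem_nhdsWithin_of_mem_nhds h1, self_mem_nhdsWithin] with q hq hq'
    exact ⟨⟨hq'.1, hq.1⟩, hq.2⟩
  have hΨ : Tendsto (fun q : ℝ × X' => (q.1, θ q.2)) (𝓝[Icc 0 t₀ ×ˢ univ] (t₁, x₁))
      (𝓝[J ×ˢ U] (t₁, θ x₁)) := by
    refine tendsto_nhdsWithin_of_tendsto_nhds_of_eventually_within _ ?_
      (hnear.mono fun q hq => ⟨hq.1, hq.2.2⟩)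
    have h1 : ContinuousAt (fun q : ℝ × X' => (q.1, θ q.2)) (t₁, x₁) :=
      continuousAt_fst.prodMk (ContinuousAt.comp (g := θ) hθc continuousAt_snd)
    exact h1.tendsto.mono_left nhdsWithin_le_nhds
  refine ⟨?_, ?_⟩
  · have h1 : Tendsto (fun q : ℝ × X' => u (q.1, θ q.2)) (𝓝[Icc 0 t₀ ×ˢ univ] (t₁, x₁))
        (𝓝 (u (t₁, θ x₁))) := (huc.continuousOn _ htz).tendsto.comp hΨ
    have h2 := heq' t₁ htz.1 x₁ hx₀ hz₁
    rw [ContinuousWithinAt, h2]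
    refine h1.congr' (hnear.mono fun q hq => ?_)
    exact (heq' q.1 hq.1 q.2 hq.2.1 hq.2.2).symm
  · obtain ⟨C, hC⟩ := exists_leafEnergy_bound hJ hJ' hU
      (⟨hT.contDiffOn.mono hUφ, fun z hz => hT.isInner z (hUφ hz),
        fun z hz => hT.inverse_snd z (hUφ hz), fun z hz => hT.trace_snd z (hUφ hz)⟩ :
          IsTenseMetricOn (chartForm g φ) U)
      (isOpen_extChartAt_target c) hho (fun y hy => coordMetric_isInner hh hy) hFc hFO hev hcc hcs
      htz
    refine ⟨C, ?_⟩
    filter_upwards [hnear, hΨ.eventually hC] with q hq hqC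
    obtain ⟨hqJ, hqs, hqU⟩ := hq
    refine ⟨timeDeriv J u (q.1, θ q.2), ?_, fun hmax => ?_⟩
    · have h1 := hasDerivWithinAt_slice huc (q := (q.1, θ q.2)) ⟨hqJ, hqU⟩
      rw [← timeDeriv_eq hJ huc ⟨hqJ, hqU⟩] at h1
      have h2 := h1.congr (f₁ := fun s => tangentEnergy h p V (f s) q.2)
        (fun s hs => heq' s hs q.2 hqs hqU) (heq' q.1 hqJ q.2 hqs hqU)
      -- `T` is a neighbourhood of the time, so derivatives within `J` and within the whole interval
      -- agree.
      exact (hasDerivWithinAt_inter (hTo.mem_nhds hqJ.2)).1 h2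
    · rw [heq' q.1 hqJ q.2 hqs hqU]
      refine hqC ?_
      have h1 : Tendsto θ.symm (𝓝 (θ q.2)) (𝓝 q.2) := by
        have := (θ.symm.continuousAt (x := θ q.2) (θ.map_source hqs)).tendsto
        rwa [θ.left_inv hqs] at this
      filter_upwards [h1.eventually hmax, hU.mem_nhds hqU] with z hz hzU
      change u (q.1, z) ≤ u (q.1, θ q.2)
      rw [← heq q.1 hqJ z hzU, ← heq' q.1 hqJ q.2 hqs hqU]
      exact hz

end Flow

/-! ### Leafwise constancy and vanishing leafwise derivative. -/

section Invariance

variable {E : Type*} [NormedAddCommGroup E] [NormedSpace ℝ E] [FiniteDimensional ℝ E]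
  {X : Type*} [TopologicalSpace X] [ChartedSpace E X] [IsManifold 𝓘(ℝ, E) ∞ X]
  {X' : Type*} [TopologicalSpace X'] [ChartedSpace E X'] [IsManifold 𝓘(ℝ, E) ∞ X']
  {p : X' → X}
  {E' : Type*} [NormedAddCommGroup E'] [NormedSpace ℝ E'] [FiniteDimensional ℝ E']
  {Y : Type*} [TopologicalSpace Y] [ChartedSpace E' Y] [IsManifold 𝓘(ℝ, E') ∞ Y]
  {m n : ℕ} {D : Distribution E X}
  {φ : OpenPartialHomeomorph X (EuclideanSpace ℝ (Fin m) × EuclideanSpace ℝ (Fin n))}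
  {θ : OpenPartialHomeomorph X' (EuclideanSpace ℝ (Fin m) × EuclideanSpace ℝ (Fin n))}

/-- The derivative of a leafwise constant map vanishes along the leaves. -/
theorem IsLiftedChart.tderiv_eq_zero (hθ : IsLiftedChart (E := E) p φ θ)
    (hp : IsSmoothUniversalCover E E p) (hφ : IsFoliatedChart D φ) {f : X' → Y}
    (hf : ContMDiff 𝓘(ℝ, E) 𝓘(ℝ, E') ∞ f)
    (hfD : IsLeafwiseConstant (pullbackDistribution p D : Distribution E X') f)
    {z : EuclideanSpace ℝ (Fin m) × EuclideanSpace ℝ (Fin n)} (hz : z ∈ θ.target)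
    (a : EuclideanSpace ℝ (Fin m)) :
    tderiv E E' f (θ.symm z)
      (tderiv (EuclideanSpace ℝ (Fin m) × EuclideanSpace ℝ (Fin n)) E θ.symm z (a, 0)) = 0 := by
  have hs := hθ.isSmoothChart
  obtain ⟨ε, hε, hball⟩ := Metric.isOpen_iff.1 θ.open_target z hz
  set b : EuclideanSpace ℝ (Fin m) × EuclideanSpace ℝ (Fin n) := (a, 0) with hb
  set δ : ℝ := ε / (‖b‖ + 1) with hδ
  have hδ0 : 0 < δ := by positivity
  have hδb : δ * ‖b‖ < ε := by
    rw [hδ, div_mul_eq_mul_div, div_lt_iff₀ (by positivity)]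
    nlinarith [norm_nonneg b]
  -- `SameLeaf` asks for curves defined on all of `ℝ`. The sine keeps this one inside the chart at
  -- all times, and its velocity at `0` is `δ • b`.
  set β : ℝ → EuclideanSpace ℝ (Fin m) × EuclideanSpace ℝ (Fin n) :=
    fun τ => z + (δ * Real.sin τ) • b with hβ
  have hβt : ∀ τ, β τ ∈ θ.target := by
    intro τ
    apply hball
    rw [Metric.mem_ball, dist_eq_norm, hβ]
    simp only [add_sub_cancel_left, norm_smul, Real.norm_eq_abs, abs_mul, abs_of_pos hδ0]
    have := Real.abs_sin_le_one τ
    calc δ * |Real.sin τ| * ‖b‖ ≤ δ * 1 * ‖b‖ := by gcongr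
      _ < ε := by rwa [mul_one]
  have hβd : ∀ s τ : ℝ, HasDerivAt (fun τ => β (s * τ)) ((δ * (Real.cos (s * τ) * s)) • b) τ := by
    intro s τ
    have h1 : HasDerivAt (fun τ : ℝ => s * τ) s τ := by
      simpa using (hasDerivAt_id τ).const_mul s
    exact (((h1.sin).const_mul δ).smul_const b).const_add z
  have hβs : ContDiff ℝ ∞ β := by
    rw [hβ]
    exact contDiff_const.add ((contDiff_const.mul Real.contDiff_sin).smul contDiff_const)
  have hβs' : ∀ s : ℝ, ContDiff ℝ ∞ (fun τ => β (s * τ)) := fun s =>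
    hβs.comp (contDiff_const.mul contDiff_id)
  have hγs : ∀ s τ : ℝ, ContMDiffAt 𝓘(ℝ, ℝ) 𝓘(ℝ, E) ∞ (fun τ => θ.symm (β (s * τ))) τ := fun s τ =>
    ContMDiffAt.comp (g := θ.symm) (f := fun τ => β (s * τ)) τ (hs.contMDiffAt_symm (hβt _))
      (hβs' s).contMDiff.contMDiffAt
  have hγ : ∀ s τ : ℝ, tderiv ℝ E (fun τ => θ.symm (β (s * τ))) τ 1 =
      tderiv _ E θ.symm (β (s * τ)) ((δ * (Real.cos (s * τ) * s)) • b) := by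
    intro s τ
    have h1 := tderiv_comp (g := θ.symm) (f := fun τ => β (s * τ)) (x := τ)
      (hs.contMDiffAt_symm (hβt _)).mdiff (hβs' s).contMDiff.contMDiffAt.mdiff
    have h2 := DFunLike.congr_fun h1 (1 : ℝ)
    rw [tderiv_eq_fderiv] at h2
    refine h2.trans ?_
    rw [ContinuousLinearMap.comp_apply, ← (hβd s τ).deriv, fderiv_apply_one_eq_deriv]
  have hβ0 : β 0 = z := by simp [hβ]
  -- For fixed `s`, the rescaled curve `τ ↦ β (s * τ)` joins `z` to `β s` in unit time, as
  -- `SameLeaf` requires.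
  have hconst : ∀ s, f (θ.symm (β s)) = f (θ.symm z) := by
    intro s
    refine (hfD _ _ ⟨fun τ => θ.symm (β (s * τ)), hγs s, ?_, ?_, fun τ => ?_⟩).symm
    · simp only [mul_zero, hβ0]
    · simp only [mul_one]
    · have h1 : tderiv E E p (θ.symm (β (s * τ))) (tderiv ℝ E (fun τ => θ.symm (β (s * τ))) τ 1) =
          tderiv _ E φ.symm (β (s * τ)) ((δ * (Real.cos (s * τ) * s)) • b) := by
        rw [hγ, hθ.tderiv_tderiv hp (hβt _)]
      have h2 : ∀ y, y = φ.symm (β (s * τ)) → ∀ v : E,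
          v = tderiv _ E φ.symm (β (s * τ)) ((δ * (Real.cos (s * τ) * s)) • b) →
          (v : TangentSpace 𝓘(ℝ, E) y) ∈ D y := by
        rintro y rfl v rfl
        have hyφ := hθ.mem_target _ (hβt (s * τ))
        have h3 := hφ.tderiv_symm_mem (φ.map_target hyφ) ((δ * (Real.cos (s * τ) * s)) • a)
        rw [φ.right_inv hyφ] at h3
        convert h3 using 2
        simp [hb]
      exact h2 _ (hθ.map_symm _ (hβt _)) _ h1
  have h1 := tderiv_comp (g := f) (f := fun τ => θ.symm (β (1 * τ))) (x := (0 : ℝ)) (hf _).mdiff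
    (hγs 1 0).mdiff
  have h2 : (f ∘ fun τ : ℝ => θ.symm (β (1 * τ))) = fun _ : ℝ => f (θ.symm z) := by
    funext τ
    exact hconst _
  have h3 : tderiv ℝ E' (fun _ : ℝ => f (θ.symm z)) 0 = 0 := mfderiv_const
  rw [h2, h3] at h1
  have h4 := DFunLike.congr_fun h1 (1 : ℝ)
  rw [ContinuousLinearMap.comp_apply, hγ] at h4
  simp only [mul_zero, hβ0, Real.cos_zero, mul_one, map_smul] at h4
  exact (smul_eq_zero.1 h4.symm).resolve_left hδ0.ne'

/-- A curve in a manifold with vanishing derivative is constant. -/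
theorem eq_of_tderiv_eq_zero {g : ℝ → Y} (hg : ContMDiff 𝓘(ℝ, ℝ) 𝓘(ℝ, E') ∞ g)
    (h0 : ∀ t, tderiv ℝ E' g t = 0) (s t : ℝ) : g s = g t := by
  have hloc : IsLocallyConstant g := by
    rw [IsLocallyConstant.iff_eventually_eq]
    intro r
    set κ := extChartAt 𝓘(ℝ, E') (g r) with hκ
    obtain ⟨ε, hε, hball⟩ := Metric.mem_nhds_iff.1 (hg.continuous.continuousAt.preimage_mem_nhds
      ((isOpen_extChartAt_source (I := 𝓘(ℝ, E')) (g r)).mem_nhds (mem_extChartAt_source (g r))))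
    have hd : ∀ w ∈ Metric.ball r ε, HasFDerivAt (κ ∘ g) (0 : ℝ →L[ℝ] E') w := by
      intro w hw
      have h1 := tderiv_comp (g := κ) (f := g) (contMDiffAt_chart (hball hw)).mdiff (hg w).mdiff
      rw [h0, tderiv_eq_fderiv, ContinuousLinearMap.comp_zero] at h1
      rw [← h1]
      exact (((contMDiffAt_chart (hball hw)).comp w (hg w)).contDiffAt.differentiableAt
        (by simp)).hasFDerivAt
    filter_upwards [Metric.ball_mem_nhds r hε] with w hw
    have h2 : (κ ∘ g) w = (κ ∘ g) r :=
      (convex_ball r ε).is_const_of_fderivWithin_eq_zero (𝕜 := ℝ)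
        (fun y hy => (hd y hy).differentiableAt.differentiableWithinAt)
        (fun y hy => (hd y hy).hasFDerivWithinAt.fderivWithin
          (Metric.isOpen_ball.uniqueDiffWithinAt hy)) hw (Metric.mem_ball_self hε)
    exact κ.injOn (hball hw) (hball (Metric.mem_ball_self hε)) h2
  exact hloc.apply_eq_of_preconnectedSpace s t

/-- A map whose leafwise energy density vanishes is leafwise constant. -/
theorem isLeafwiseConstant_of_tangentEnergy_eq_zero {ι : Type*} [Fintype ι]
    (hp : IsSmoothUniversalCover E E p) {h : BilinField E' Y} (hh : IsSmoothMetric h)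
    {V : ι → VField E X} (hspan : ∀ x, D x ≤ Submodule.span ℝ (range fun j => V j x))
    {f : X' → Y} (hf : ContMDiff 𝓘(ℝ, E) 𝓘(ℝ, E') ∞ f)
    (h0 : ∀ x, tangentEnergy h p V f x = 0) :
    IsLeafwiseConstant (pullbackDistribution p D : Distribution E X') f := by
  rintro x y ⟨γ, hγ, rfl, rfl, hγD⟩
  refine eq_of_tderiv_eq_zero (hf.comp hγ) (fun t => ?_) 0 1
  have h1 := tderiv_comp (g := f) (f := γ) (hf _).mdiff (hγ t).mdiff
  rw [h1]
  ext
  rw [ContinuousLinearMap.comp_apply]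
  set v : E := tderiv ℝ E γ t 1 with hv
  obtain ⟨e, he⟩ := hp.exists_equiv (γ t)
  have h2 : tderiv E E p (γ t) v ∈ (D (p (γ t)) : Submodule ℝ E) := hγD t
  -- `L` is `df` transported to the tangent space of the base. It kills each `V j`, hence their
  -- span, which contains the tangent space of the leaf.
  set L : E →ₗ[ℝ] E' := (tderiv E E' f (γ t) : E →ₗ[ℝ] E').comp (e.symm : E →ₗ[ℝ] E) with hL
  have hker : (D (p (γ t)) : Submodule ℝ E) ≤ LinearMap.ker L :=
    (hspan _).trans (Submodule.span_le.2 (by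
      rintro - ⟨j, rfl⟩
      have h3 := (tangentEnergy_eq_zero_iff hh V f (γ t)).1 (h0 _) j
      rw [coverLift, ← he, ContinuousLinearMap.inverse_equiv] at h3
      exact h3))
  have h4 := hker h2
  rw [← he] at h4
  have h5 : tderiv E E' f (γ t) (e.symm (e v)) = 0 := h4
  rw [e.symm_apply_apply] at h5
  exact h5

end Invariance

end FoliatedHeatFlow

end

/-! ### Conclusion: the energy vanishes for all times. -/

theorem corollaryC {m n k : ℕ}
    -- a compact manifold of dimension `m + n`
    {X : Type*} [TopologicalSpace X] [T2Space X] [SecondCountableTopology X] [CompactSpace X]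
    [ChartedSpace (EuclideanSpace ℝ (Fin (m + n))) X] [IsManifold (𝓡 (m + n)) ∞ X]
    -- its universal cover
    {X' : Type*} [TopologicalSpace X'] [ChartedSpace (EuclideanSpace ℝ (Fin (m + n))) X']
    [IsManifold (𝓡 (m + n)) ∞ X'] (p : X' → X)
    (hp : IsSmoothUniversalCover (EuclideanSpace ℝ (Fin (m + n)))
      (EuclideanSpace ℝ (Fin (m + n))) p)
    -- a Riemannian foliation of rank `m`, with a tense bundle-like metric
    (𝓕 : RiemFoliation (EuclideanSpace ℝ (Fin (m + n))) X m n)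
    (g : RiemMetric (EuclideanSpace ℝ (Fin (m + n))) X)
    (hbundle : IsBundleLike g.inner 𝓕) (htense : IsTense g.inner 𝓕.toFoliation)
    -- the target manifold and the representation
    {Y : Type*} [TopologicalSpace Y] [T2Space Y] [SecondCountableTopology Y]
    [ChartedSpace (EuclideanSpace ℝ (Fin k)) Y] [IsManifold (𝓡 k) ∞ Y]
    (h : RiemMetric (EuclideanSpace ℝ (Fin k)) Y)
    (ρ : deckGroup p →* isometryGroup h.inner)
    -- a smooth equivariant solution of the heat flow on `[0, t₀]`
    (t₀ : ℝ) (f : ℝ → X' → Y)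
    (hequiv : ∀ t ∈ Icc 0 t₀, IsEquivariant p ρ (f t))
    (hflow : IsHeatFlow
      (pullbackBilin p g.inner : BilinField (EuclideanSpace ℝ (Fin (m + n))) X') h.inner t₀ f)
    -- whose initial datum is leafwise constant
    (hinit : IsInvariant 𝓕.toFoliation p (f 0)) :
    ∀ t ∈ Icc 0 t₀, IsInvariant 𝓕.toFoliation p (f t) := by
  intro t ht
  have hg := isSmoothMetric_riemMetric g
  have hh := isSmoothMetric_riemMetric h
  have ht₀ : 0 ≤ t₀ := ht.1.trans ht.2
  -- For `t₀ = 0` the interval is a point, where derivatives within it carry no information; the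
  -- claim is then the initial condition.
  rcases ht₀.eq_or_lt with rfl | ht₀
  · rwa [le_antisymm ht.2 ht.1]
  obtain ⟨ι, _, V, hVs, hVD, hspan⟩ := 𝓕.toFoliation.exists_spanning_fields
  have hchart : ∀ x : X',
      ∃ (φ : OpenPartialHomeomorph X (EuclideanSpace ℝ (Fin m) × EuclideanSpace ℝ (Fin n)))
        (θ : OpenPartialHomeomorph X' (EuclideanSpace ℝ (Fin m) × EuclideanSpace ℝ (Fin n))),
        IsFoliatedChart 𝓕.tangent φ ∧ IsTenseMetricOn (chartForm g.inner φ) φ.target ∧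
          IsLiftedChart (E := EuclideanSpace ℝ (Fin (m + n))) p φ θ ∧ x ∈ θ.source := by
    intro x
    obtain ⟨φ, hx, hφ, hT⟩ := RiemFoliation.exists_tense_chart hg hbundle htense (p x)
    obtain ⟨θ, hxθ, hθ, hθφ⟩ := hp.exists_lift_chart hφ.isSmoothChart hx
    exact ⟨φ, θ, hφ, hT, ⟨hθ, fun z hz => (hθφ z hz).1, fun z hz => (hθφ z hz).2⟩, hxθ⟩
  have hbound : ∀ q : ℝ × X', q.1 ∈ Icc 0 t₀ →
      ContinuousWithinAt (fun q : ℝ × X' => tangentEnergy h.inner p V (f q.1) q.2)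
        (Icc 0 t₀ ×ˢ univ) q ∧
      ∃ C, ∀ᶠ r in 𝓝[Icc 0 t₀ ×ˢ univ] q,
        ∃ d, HasDerivWithinAt (fun s => tangentEnergy h.inner p V (f s) r.2) d (Icc 0 t₀) r.1 ∧
          (IsLocalMax (tangentEnergy h.inner p V (f r.1)) r.2 →
            d ≤ C * tangentEnergy h.inner p V (f r.1) r.2) := by
    intro q hq
    obtain ⟨φ, θ, hφ, hT, hθ, hx⟩ := hchart q.2
    exact hθ.exists_tangentEnergy_bound hp hφ hg hT hh hVs hVD hspan ht₀ hflow hq hx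
  obtain ⟨K, hK, hpK⟩ := hp.exists_compact
  have h0 : (0 : ℝ) ∈ Icc 0 t₀ := ⟨le_rfl, ht₀.le⟩
  -- Every point of the cover is a deck translate of a point of `K`, since `K` maps onto the base
  -- and deck transformations are transitive on fibres.
  have hzero := eq_zero_of_growth_at_max
    (u := fun t x => tangentEnergy h.inner p V (f t) x)
    (fun t _ x => tangentEnergy_nonneg hh V (f t) x) (fun q hq => (hbound q hq.1).1) hK
    (fun x => by
      obtain ⟨y, hy, hxy⟩ : p x ∈ p '' K := hpK ▸ mem_univ _
      obtain ⟨γ, rfl⟩ := hp.exists_deck hxy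
      exact ⟨y, hy, fun t ht =>
        tangentEnergy_deck hp h.inner V (hflow.contMDiff ht) (hequiv t ht) γ y⟩)
    (fun q hq => (hbound q hq.1).2) fun x => by
      obtain ⟨φ, θ, hφ, -, hθ, hx⟩ := hchart x
      refine (tangentEnergy_eq_zero_iff hh V (f 0) x).2 fun j => ?_
      rw [← θ.left_inv hx, hθ.coverLift_eq hp hφ (hVD j) (θ.map_source hx)]
      exact hθ.tderiv_eq_zero hp hφ (hflow.contMDiff h0) hinit (θ.map_source hx) _
  exact isLeafwiseConstant_of_tangentEnergy_eq_zero hp hh hspan (hflow.contMDiff ht) (hzero t ht)
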